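/- **Setting.** Let $X,Y$ be Banach spaces over $\mathbb K\in\{\mathbb R,\mathbb C\}$, let $A,B$ be closed linear operators from $X$ to $Y$ with domains $D_B\supseteq D_A=:D$, $D$ dense in $X$, $\operatorname{range}A$ closed, $\dim\ker A=n<\infty$. Put $\mathbb R_+=[0,\infty)$; $D$ and all its subspaces carry the norm of $X$. Let $\lambda A+B$ be a regular pencil of index $\nu$. That is, either $\nu\ge1$ is the least natural number such that, for some $c,r>0$, every $\lambda\in\mathbb C$ with $|\lambda|\ge r$ admits a bounded inverse $(\lambda A+B)^{-1}\colon Y\to X$ with $\|(\lambda A+B)^{-1}\|\le c|\lambda|^{\nu-1}$ (for $\mathbb K=\mathbb R$ the spaces and operators are complexified), or $\nu=0$ and $A^{-1}\in L(Y,X)$ exists. Consider $$\tfrac{d}{dt}[Ax]+Bx=f(t,x),\qquad f\in C(\mathbb R_+\times D,Y).\tag{E}$$ **Projectors.** Let $\{\varphi_i^j\}_{1\le i\le n,\,1\le j\le m_i}\subset D$ ($1\le m_i\le\nu$) be a canonical system of root vectors: $\{\varphi_i^1\}$ is a basis of $\ker A$ and $A\varphi_i^j=-B\varphi_i^{j-1}$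 for $2\le j\le m_i$. Let $q_i^j\in Y^*$ satisfy $\langle B\varphi_i^j,q_k^l\rangle=\delta_{ik}\delta_{jl}$ and, for $x\in D$, $\langle Ax,q_i^{m_i}\rangle=0$ and $\langle Ax,q_i^j\rangle=-\langle Bx,q_i^{j+1}\rangle$ ($1\le j<m_i$). On $D$ and on $Y$ respectively, put $$P_{2s}^{(j)}x=\sum_{i:\,m_i=j}\langle Bx,q_i^{s+1}\rangle\varphi_i^{s+1},\qquad Q_{2s}^{(j)}y=\sum_{i:\,m_i=j}\langle y,q_i^{s+1}\rangle B\varphi_i^{s+1}\qquad(0\le s<j\le\nu),$$ $P_{2s}=\sum_{j=s+1}^{\nu}P_{2s}^{(j)}$, $Q_{2s}=\sum_{j=s+1}^{\nu}Q_{2s}^{(j)}$, $P_{2\wedge,s}=P_{2s}-P_{2s}^{(s+1)}$, $Q_{2\Sigma,s}=Q_{2s}-Q_{2s}^{(s+1)}$, $P_{2\Sigma}=\sum_{s=1}^{\nu-1}P_{2s}$, $P_1=I-\sum_{s=0}^{\nu-1}P_{2s}$, $Q_1=I-\sum_{s=0}^{\nu-1}Q_{2s}$. The ranges of these projectors are denoted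 by $D$, respectively $Y$, with the same indices ($D_1$, $D_{20}=\ker A$, $D_{2s}^{(j)}$, $D_{2\wedge,s}$, $D_{2\Sigma}$, $Y_1$, $Y_{20}$, …), and the components of $x\in D$ by $x_1=P_1x$, $x_{20}=P_{20}x$, $x_{2s}^{(j)}=P_{2s}^{(j)}x$, and so on. Projectors and spaces with an order $s\ge\nu$ or a superscript larger than $\nu$ are zero, empty sums are zero, and conditions over empty index ranges are void. Let $\widetilde A=A+\sum_{i=1}^n\langle B\,\cdot,q_i^1\rangle B\varphi_i^{m_i}\colon D\to Y$; this operator is invertible. **Structure of $f$.** For $t\ge0$, $x\in D$, $$f(t,x)=(Q_1+Q_{20})f(t,x)+\sum_{s=1}^{\nu-2}Q_{2\Sigma,s}f\Big(t,\sum_{j=1}^{\nu-1}x_{2j}^{(j+1)}+\sum_{j=s}^{\nu-2}x_{2\wedge,j}\Big)+\sum_{s=1}^{\nu-1}Q_{2s}^{(s+1)}f\Big(t,\sum_{j=s}^{\nu-1}x_{2j}^{(j+1)}\Big).$$ Define - $F_{2s}^{(s+1)}=Q_{2s}^{(s+1)}f\big(t,\sum_{j=s}^{\nu-1}x_{2j}^{(j+1)}\big)-Bx_{2s}^{(s+1)}$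 for $1\le s\le\nu-1$, a function of $t$ and $x_{2j}^{(j+1)}$, $s\le j\le\nu-1$; - $F_{2\Sigma,s}=Q_{2\Sigma,s}f\big(t,\sum_{j=1}^{\nu-1}x_{2j}^{(j+1)}+\sum_{j=s}^{\nu-2}x_{2\wedge,j}\big)-Bx_{2\wedge,s}-A[d+e]$ for $1\le s\le\nu-2$, where also $d\in D_{2(s+1)}^{(s+2)}$ and $e\in D_{2\wedge,s+1}$ are variables (for $s=\nu-2$, $D_{2\wedge,s+1}=\{0\}$); - $F_{20}(t,x_1,x_{20},x_{2\Sigma},d,e)=Q_{20}f(t,x_1+x_{20}+x_{2\Sigma})-Bx_{20}-Q_{20}A[d+e]$, where $d\in D_{21}^{(2)}$, $e\in D_{2\wedge,1}$. **Hypotheses.** Let $\widetilde M_1\subseteq Y_1$, $M_{20}\subseteq D_{20}$, $M_{2j}^{(j+1)}\subseteq D_{2j}^{(j+1)}$ ($1\le j\le\nu-1$), $M_{2\wedge,j}\subseteq D_{2\wedge,j}$ ($1\le j\le\nu-2$) be relatively open sets. Put $M_1=\widetilde A^{-1}\widetilde M_1\subseteq D_1$, $M_{2\Sigma}=\sum_{j=1}^{\nu-1}M_{2j}^{(j+1)}+\sum_{j=1}^{\nu-2}M_{2\wedge,j}$,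 $M=M_1+M_{20}+M_{2\Sigma}$. Assume: 0. For $1\le s\le\nu-2$: $Q_{2s}^{(s+1)}f$ is $C^{\nu-2}$ on $\mathbb R_+\times\sum_{i=s}^{\nu-1}M_{2i}^{(i+1)}$ and $Q_{2\Sigma,s}f$ is $C^{s}$ on $\mathbb R_+\times\big(\sum_{i=1}^{\nu-1}M_{2i}^{(i+1)}+\sum_{i=s}^{\nu-2}M_{2\wedge,i}\big)$. If $\nu\ge2$, $Q_{2(\nu-1)}f$ is $C^{\nu-1}$ on $\mathbb R_+\times M_{2(\nu-1)}^{(\nu)}$. (Differentiability is over $\mathbb R$, one-sided at $t=0$.) 1. Unique solvability. - For $1\le s\le\nu-1$, every $t\ge0$ and all $x_{2j}^{(j+1)}\in M_{2j}^{(j+1)}$ ($s<j\le\nu-1$) there is a unique $x_{2s}^{(s+1)}\in M_{2s}^{(s+1)}$ with $F_{2s}^{(s+1)}=0$. - For $1\le s\le\nu-2$, every $t\ge0$ and all $x_{2j}^{(j+1)}\in M_{2j}^{(j+1)}$ ($1\le j\le\nu-1$), $x_{2\wedge,i}\in M_{2\wedge,i}$ ($s<i\le\nu-2$), $d\in D_{2(s+1)}^{(s+2)}$,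 $e\in D_{2\wedge,s+1}$ there is a unique $x_{2\wedge,s}\in M_{2\wedge,s}$ with $F_{2\Sigma,s}=0$. - For all $t\ge0$, $x_1\in M_1$, $x_{2\Sigma}\in M_{2\Sigma}$, $d\in D_{21}^{(2)}$, $e\in D_{2\wedge,1}$ there is a unique $x_{20}\in M_{20}$ with $F_{20}=0$. 2. Invertibility and contractivity. - For $1\le s\le\nu-1$, at all points of $\mathbb R_+\times\prod_{j=s}^{\nu-1}M_{2j}^{(j+1)}$ where $F_{2s}^{(s+1)}=0$, the operator $\partial F_{2s}^{(s+1)}/\partial x_{2s}^{(s+1)}\colon D_{2s}^{(s+1)}\to Y_{2s}^{(s+1)}$ has a bounded inverse. - For $1\le s\le\nu-2$, at all points with $t\ge0$, $x_{2j}^{(j+1)}\in M_{2j}^{(j+1)}$, $x_{2\wedge,i}\in M_{2\wedge,i}$, $d\in D_{2(s+1)}^{(s+2)}$, $e\in D_{2\wedge,s+1}$ where $F_{2\Sigma,s}=0$, the operator $\partial F_{2\Sigma,s}/\partial x_{2\wedge,s}\colon D_{2\wedge,s}\to Y_{2\Sigma,s}$ has a bounded inverse. - $Q_1f$ and $Q_{20}f$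 are locally Lipschitz with respect to $x_1+x_{20}$ on $\mathbb R_+\times M$: every $(\hat t,\hat x_1+\hat x_{20}+\hat x_{2\Sigma})$ with $\hat t\ge 0$, $\hat x_1\in M_1$, $\hat x_{20}\in M_{20}$, $\hat x_{2\Sigma}\in M_{2\Sigma}$ has neighbourhoods of its components $\hat t,\hat x_1,\hat x_{20},\hat x_{2\Sigma}$ in $\mathbb R_+,M_1,M_{20},M_{2\Sigma}$ on which, for some $L$, $\|g(t,x_1+x_{20}+x_{2\Sigma})-g(t,x_1'+x_{20}'+x_{2\Sigma})\|\le L(\|x_1-x_1'\|+\|x_{20}-x_{20}'\|)$, $g=Q_1f,\,Q_{20}f$. - For all $\hat t\ge0$, $\hat x_1\in M_1$, $\hat x_{20}\in M_{20}$, $\hat x_{2\Sigma}\in M_{2\Sigma}$, $\hat d\in D_{21}^{(2)}$, $\hat e\in D_{2\wedge,1}$ with $F_{20}=0$ there are a bounded operator $\mathrm Z\colon D_{20}\to Y_{20}$ with bounded inverse and a function $k(\delta,\varepsilon)$ with $\lim_{\delta,\varepsilon\to0}k(\delta,\varepsilon)<\|\mathrm Z^{-1}\|^{-1}$ (where $0^{-1}=\infty$)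 such that, for all sufficiently small $\delta,\varepsilon>0$, all $t,x_1,x_{2\Sigma},d,e$ in the $\delta$-neighbourhoods of $\hat t,\hat x_1,\hat x_{2\Sigma},\hat d,\hat e$ in $\mathbb R_+,D_1,D_{2\Sigma},D_{21}^{(2)},D_{2\wedge,1}$, and all $x_{20}',x_{20}''\in D_{20}$ in the $\varepsilon$-neighbourhood of $\hat x_{20}$, $$\|F_{20}(t,x_1,x_{20}',x_{2\Sigma},d,e)-F_{20}(t,x_1,x_{20}'',x_{2\Sigma},d,e)-\mathrm Z[x_{20}'-x_{20}'']\|\le k(\delta,\varepsilon)\|x_{20}'-x_{20}''\|.$$ **Solutions.** A solution of (E) on an interval $J\subseteq\mathbb R_+$ is a function $x\in C(J,X)$ with values in $D$ such that $Ax\in C^1(J,Y)$ (one-sided derivatives at end points) and (E) holds on $J$; if $J=\mathbb R_+$, then $Ax\in C^1((0,\infty),Y)$ and (E) on $(0,\infty)$ suffice. **Conclusion.** For each $t_0\ge0$ and $x_{0,1}\in M_1$ there is $t_{\max}\in(t_0,\infty]$ such that the initial value problem (E), $P_1x(t_0)=x_{0,1}$, has a solution $x$ on $[t_0,t_{\max})$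 with values in $M$; this interval is maximal (no proper extension of $x$ to an interval with left end point $t_0$ is a solution with values in $M$); and the solution is unique: every solution of the initial value problem with values in $M$ on a nondegenerate interval $J$ with left end point $t_0\in J$ satisfies $J\subseteq[t_0,t_{\max})$ and coincides with $x$ on $J$. -/

import Mathlib

open Set Filter Topology

noncomputable section

namespace ADAE

section Pencil

variable {𝕜 D Y : Type*} [RCLike 𝕜]
  [NormedAddCommGroup D] [NormedSpace 𝕜 D] [NormedAddCommGroup Y] [NormedSpace 𝕜 Y]

/-- `R` is the bounded inverse of `z a + b : D → Y` (`D` carries the norm of the ambient space). -/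
def IsResolvent (a b : D →ₗ[𝕜] Y) (z : 𝕜) (R : Y →L[𝕜] D) : Prop :=
  (∀ y, z • a (R y) + b (R y) = y) ∧ ∀ x, R (z • a x + b x) = x

/-- The complexified operator `z a + b`, `z ∈ ℂ`, for real spaces: the pair `(u, v)` stands for
`u + i v`. -/
def complexifiedPencil (a b : D →ₗ[𝕜] Y) (z : ℂ) (x : D × D) : Y × Y :=
  ((z.re : 𝕜) • a x.1 - (z.im : 𝕜) • a x.2 + b x.1,
   (z.im : 𝕜) • a x.1 + (z.re : 𝕜) • a x.2 + b x.2)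

/-- `R` is the bounded inverse of the complexified operator `z a + b`. -/
def IsComplexifiedResolvent (a b : D →ₗ[𝕜] Y) (z : ℂ) (R : Y × Y →L[𝕜] D × D) : Prop :=
  (∀ y, complexifiedPencil a b z (R y) = y) ∧ ∀ x, R (complexifiedPencil a b z x) = x

/-- All `z` with `|z|` large are regular points of the pencil `z a + b`, and
`‖(z a + b)⁻¹‖ ≤ c |z| ^ (k - 1)` there (used with `k ≥ 1`). If the scalar field is `ℝ`
(that is, `RCLike.I = 0`), the parameter `z` still runs through `ℂ` and the pencil is
complexified. -/
def HasResolventGrowth (a b : D →ₗ[𝕜] Y) (k : ℕ) : Prop :=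
  (RCLike.I = (0 : 𝕜) → ∃ c > (0 : ℝ), ∃ r > (0 : ℝ), ∀ z : ℂ, r ≤ ‖z‖ →
    ∃ R : Y × Y →L[𝕜] D × D, IsComplexifiedResolvent a b z R ∧ ‖R‖ ≤ c * ‖z‖ ^ (k - 1)) ∧
  (RCLike.I ≠ (0 : 𝕜) → ∃ c > (0 : ℝ), ∃ r > (0 : ℝ), ∀ z : 𝕜, r ≤ ‖z‖ →
    ∃ R : Y →L[𝕜] D, IsResolvent a b z R ∧ ‖R‖ ≤ c * ‖z‖ ^ (k - 1))

/-- `z a + b` is a regular pencil of index `ν`: `ν ≥ 1` is the least exponent for which the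
resolvent estimate holds near infinity, or `ν = 0` and `a` has a bounded inverse. -/
def IsRegularPencilOfIndex (a b : D →ₗ[𝕜] Y) (ν : ℕ) : Prop :=
  (1 ≤ ν ∧ HasResolventGrowth a b ν ∧ ∀ k, 1 ≤ k → HasResolventGrowth a b k → ν ≤ k) ∨
  (ν = 0 ∧ ∃ R : Y →L[𝕜] D, (∀ y, a (R y) = y) ∧ ∀ x, R (a x) = x)

/-- A canonical system of root vectors `φ i j` (`1 ≤ j ≤ m i`) of the pencil `a + μ b` at `μ = 0`,
whose eigenvectors `φ i 1`, `i = 1, …, n`, form a basis of `ker a`, together with the biorthogonal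
system of functionals `q i j`. The equations for the adjoint operators are written on the
domain `D`. (Values with `j = 0` or `j > m i` play no role.) -/
structure CanonicalSystem (a b : D →ₗ[𝕜] Y) (ν n : ℕ) where
  m : Fin n → ℕ
  φ : Fin n → ℕ → D
  q : Fin n → ℕ → Y →L[𝕜] 𝕜
  one_le_m : ∀ i, 1 ≤ m i
  m_le : ∀ i, m i ≤ ν
  linearIndependent_eigenvectors : LinearIndependent 𝕜 fun i => φ i 1
  span_eigenvectors : Submodule.span 𝕜 (Set.range fun i => φ i 1) = LinearMap.ker a
  chain : ∀ i j, 2 ≤ j → j ≤ m i → a (φ i j) = -b (φ i (j - 1))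
  dual_eigen : ∀ i x, q i (m i) (a x) = 0
  dual_chain : ∀ i j, 1 ≤ j → j < m i → ∀ x, q i j (a x) = -q i (j + 1) (b x)
  biorthogonal : ∀ i j k l, 1 ≤ j → j ≤ m i → 1 ≤ l → l ≤ m k →
    q k l (b (φ i j)) = if i = k ∧ j = l then 1 else 0

namespace CanonicalSystem

variable {a b : D →ₗ[𝕜] Y} {ν n : ℕ} (C : CanonicalSystem a b ν n)

/-- `x ↦ ⟨b x, q i j⟩ φ i j`. -/
def pTerm (i : Fin n) (j : ℕ) : D →ₗ[𝕜] D :=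
  ((C.q i j : Y →ₗ[𝕜] 𝕜) ∘ₗ b).smulRight (C.φ i j)

/-- `y ↦ ⟨y, q i j⟩ b (φ i j)`. -/
def qTerm (i : Fin n) (j : ℕ) : Y →L[𝕜] Y :=
  (C.q i j).smulRight (b (C.φ i j))

/-- The projector `P₁ = I - P₂` on `D`. -/
def P1 : D →ₗ[𝕜] D :=
  LinearMap.id - ∑ i, ∑ j ∈ Finset.Icc 1 (C.m i), C.pTerm i j

/-- The projector `Q₁ = I - Q₂` on `Y`. -/
def Q1 : Y →L[𝕜] Y :=
  ContinuousLinearMap.id 𝕜 Y - ∑ i, ∑ j ∈ Finset.Icc 1 (C.m i), C.qTerm i j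

/-- `P_{2s}^{(j)}`, used for `s + 1 ≤ j`: the chains of length `j`, vectors of order `s`. -/
def P2j (s j : ℕ) : D →ₗ[𝕜] D :=
  ∑ i ∈ Finset.univ.filter (fun i => C.m i = j), C.pTerm i (s + 1)

/-- `Q_{2s}^{(j)}`, used for `s + 1 ≤ j`. -/
def Q2j (s j : ℕ) : Y →L[𝕜] Y :=
  ∑ i ∈ Finset.univ.filter (fun i => C.m i = j), C.qTerm i (s + 1)

/-- `P_{2s}`. -/
def P2 (s : ℕ) : D →ₗ[𝕜] D := ∑ j ∈ Finset.Icc (s + 1) ν, C.P2j s j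

/-- `Q_{2s}`. -/
def Q2 (s : ℕ) : Y →L[𝕜] Y := ∑ j ∈ Finset.Icc (s + 1) ν, C.Q2j s j

/-- `P_{2∧,s} = P_{2s} - P_{2s}^{(s+1)}`. -/
def PWedge (s : ℕ) : D →ₗ[𝕜] D := ∑ j ∈ Finset.Icc (s + 2) ν, C.P2j s j

/-- `Q_{2Σ,s} = Q_{2s} - Q_{2s}^{(s+1)}`. -/
def QSigma (s : ℕ) : Y →L[𝕜] Y := ∑ j ∈ Finset.Icc (s + 2) ν, C.Q2j s j

/-- `P_{2Σ}`. -/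
def PSigma : D →ₗ[𝕜] D := ∑ s ∈ Finset.Icc 1 (ν - 1), C.P2 s

/-- `D₁`. -/
abbrev D1 : Submodule 𝕜 D := LinearMap.range C.P1
/-- `D_{20}` (which is `ker a`). -/
abbrev D20 : Submodule 𝕜 D := LinearMap.range (C.P2 0)
/-- `D_{2s}^{(s+1)}`. -/
abbrev DLast (s : ℕ) : Submodule 𝕜 D := LinearMap.range (C.P2j s (s + 1))
/-- `D_{2∧,s}`. -/
abbrev DWedge (s : ℕ) : Submodule 𝕜 D := LinearMap.range (C.PWedge s)
/-- `D_{2Σ}`. -/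
abbrev DSigma : Submodule 𝕜 D := LinearMap.range C.PSigma
/-- `Y₁`. -/
abbrev Y1 : Submodule 𝕜 Y := LinearMap.range (C.Q1 : Y →ₗ[𝕜] Y)
/-- `Y_{20}`. -/
abbrev Y20 : Submodule 𝕜 Y := LinearMap.range (C.Q2 0 : Y →ₗ[𝕜] Y)
/-- `Y_{2s}^{(s+1)}`. -/
abbrev YLast (s : ℕ) : Submodule 𝕜 Y := LinearMap.range (C.Q2j s (s + 1) : Y →ₗ[𝕜] Y)
/-- `Y_{2Σ,s}`. -/
abbrev YSigma (s : ℕ) : Submodule 𝕜 Y := LinearMap.range (C.QSigma s : Y →ₗ[𝕜] Y)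

/-- The operator `Ã = a + ∑ i, ⟨b ·, q i 1⟩ b (φ i (m i)) : D → Y`. -/
def aTilde : D →ₗ[𝕜] Y :=
  a + ∑ i, ((C.q i 1 : Y →ₗ[𝕜] 𝕜) ∘ₗ b).smulRight (b (C.φ i (C.m i)))

/-- The triangular structure of `f : [0,∞) × D → Y`. -/
def HasTriangularStructure (f : ℝ → D → Y) : Prop :=
  ∀ t, 0 ≤ t → ∀ x,
    f t x = (C.Q1 + C.Q2 0) (f t x)
      + ∑ s ∈ Finset.Icc 1 (ν - 2), C.QSigma s
          (f t (∑ j ∈ Finset.Icc 1 (ν - 1), C.P2j j (j + 1) x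
            + ∑ j ∈ Finset.Icc s (ν - 2), C.PWedge j x))
      + ∑ s ∈ Finset.Icc 1 (ν - 1), C.Q2j s (s + 1)
          (f t (∑ j ∈ Finset.Icc s (ν - 1), C.P2j j (j + 1) x))

/-- `F_{2s}^{(s+1)}` (and `F_{2(ν-1)}` for `s = ν - 1`): `z` is the component in `D_{2s}^{(s+1)}`,
`u j` the components in `D_{2j}^{(j+1)}`, of which those with `s < j ≤ ν - 1` enter. -/
def FLast (f : ℝ → D → Y) (s : ℕ) (t : ℝ) (z : C.DLast s) (u : ∀ j, C.DLast j) : Y :=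
  C.Q2j s (s + 1) (f t (z + ∑ j ∈ Finset.Icc (s + 1) (ν - 1), (u j : D))) - b z

/-- `F_{2Σ,s}`: `u j` are the components in `D_{2j}^{(j+1)}`, `1 ≤ j ≤ ν - 1`; `z` is the component
in `D_{2∧,s}`; `v j` are the components in `D_{2∧,j}`, `s < j ≤ ν - 2`; `d` and `e` stand for the
time derivatives of the components in `D_{2(s+1)}^{(s+2)}` and `D_{2∧,s+1}`. For `s = ν - 2` the
space `D_{2∧,s+1}` is zero. -/
def FSigma (f : ℝ → D → Y) (s : ℕ) (t : ℝ) (u : ∀ j, C.DLast j) (z : C.DWedge s)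
    (v : ∀ j, C.DWedge j) (d : C.DLast (s + 1)) (e : C.DWedge (s + 1)) : Y :=
  C.QSigma s (f t (∑ j ∈ Finset.Icc 1 (ν - 1), (u j : D)
      + (z + ∑ j ∈ Finset.Icc (s + 1) (ν - 2), (v j : D))))
    - b z - a ((d : D) + e)

/-- `F_{20}`. -/
def F20 (f : ℝ → D → Y) (t : ℝ) (x1 : C.D1) (x20 : C.D20) (xS : C.DSigma)
    (d : C.DLast 1) (e : C.DWedge 1) : Y :=
  C.Q2 0 (f t ((x1 : D) + x20 + xS)) - b x20 - C.Q2 0 (a ((d : D) + e))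

/-- `M₁ = Ã⁻¹ M̃₁`. -/
def setM1 (N : Set C.Y1) : Set C.D1 := {x | ∃ y ∈ N, C.aTilde (x : D) = (y : Y)}

/-- The set of all `∑_{j=r}^{ν-1} u_j + ∑_{j=s}^{ν-2} v_j` with `u_j ∈ M_{2j}^{(j+1)}`,
`v_j ∈ M_{2∧,j}`. -/
def setSum (ML : ∀ j, Set (C.DLast j)) (MW : ∀ j, Set (C.DWedge j)) (r s : ℕ) : Set D :=
  {x | ∃ (u : ∀ j, C.DLast j) (v : ∀ j, C.DWedge j),
    (∀ j ∈ Finset.Icc r (ν - 1), u j ∈ ML j) ∧ (∀ j ∈ Finset.Icc s (ν - 2), v j ∈ MW j) ∧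
    x = ∑ j ∈ Finset.Icc r (ν - 1), (u j : D) + ∑ j ∈ Finset.Icc s (ν - 2), (v j : D)}

/-- The subspace `D_{2r}^{(r+1)} ∔ … ∔ D_{2(ν-1)}^{(ν)} ∔ D_{2∧,s} ∔ … ∔ D_{2∧,ν-2}`, in which
`setSum` is taken. For `s = ν - 1` there are no wedge summands. -/
abbrev spaceSum (r s : ℕ) : Submodule 𝕜 D :=
  (⨆ j ∈ Finset.Icc r (ν - 1), C.DLast j) ⊔ (⨆ j ∈ Finset.Icc s (ν - 2), C.DWedge j)

/-- `M_{2Σ}`. -/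
def setMSigma (ML : ∀ j, Set (C.DLast j)) (MW : ∀ j, Set (C.DWedge j)) : Set C.DSigma :=
  {x | (x : D) ∈ C.setSum ML MW 1 1}

/-- `M = M₁ ∔ M_{20} ∔ M_{2Σ}`. -/
def setM (N : Set C.Y1) (M20 : Set C.D20)
    (ML : ∀ j, Set (C.DLast j)) (MW : ∀ j, Set (C.DWedge j)) : Set D :=
  {x | ∃ x1 ∈ C.setM1 N, ∃ x20 ∈ M20, ∃ xS ∈ C.setMSigma ML MW, x = (x1 : D) + x20 + xS}

/-- `g(t, x₁ + x_{20} + x_{2Σ})` satisfies locally a Lipschitz condition with respect to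
`x₁ + x_{20}` on `[0,∞) × (M₁ ∔ M_{20} ∔ M_{2Σ})`; the norm of `x₁ + x_{20}` is
`‖x₁‖ + ‖x_{20}‖`. -/
def LocallyLipschitz120 (M1 : Set C.D1) (M20 : Set C.D20) (MS : Set C.DSigma)
    (g : ℝ → D → Y) : Prop :=
  ∀ t', 0 ≤ t' → ∀ x1' ∈ M1, ∀ x20' ∈ M20, ∀ xS' ∈ MS,
    ∃ r > (0 : ℝ), ∃ L ≥ (0 : ℝ), ∀ t, 0 ≤ t → |t - t'| < r →
      ∀ xS ∈ MS, ‖xS - xS'‖ < r →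
      ∀ x1 ∈ M1, ∀ y1 ∈ M1, ‖x1 - x1'‖ < r → ‖y1 - x1'‖ < r →
      ∀ x20 ∈ M20, ∀ y20 ∈ M20, ‖x20 - x20'‖ < r → ‖y20 - x20'‖ < r →
        ‖g t ((x1 : D) + x20 + xS) - g t ((y1 : D) + y20 + xS)‖
          ≤ L * (‖x1 - y1‖ + ‖x20 - y20‖)

variable [NormedSpace ℝ D] [IsScalarTower ℝ 𝕜 D] [NormedSpace ℝ Y] [IsScalarTower ℝ 𝕜 Y]

/-- The local contractivity of `F_{20}` at a point: there are an invertible operator `Z` and a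
function `k(δ,ε)`, with a limit smaller than `‖Z⁻¹‖⁻¹` as `δ, ε → 0`, such that
`‖F_{20}(…, x', …) - F_{20}(…, x'', …) - Z (x' - x'')‖ ≤ k(δ,ε) ‖x' - x''‖` for `x', x''` in the
`ε`-neighbourhood of `x20` and the other arguments in the `δ`-neighbourhoods of theirs, for all
small `δ, ε`. -/
def ContractiveAt (f : ℝ → D → Y) (t : ℝ) (x1 : C.D1) (x20 : C.D20) (xS : C.DSigma)
    (d : C.DLast 1) (e : C.DWedge 1) : Prop :=
  ∃ (Z : C.D20 ≃L[ℝ] C.Y20) (k : ℝ → ℝ → ℝ) (l : ℝ),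
    Tendsto (fun p : ℝ × ℝ => k p.1 p.2) (𝓝[>] 0 ×ˢ 𝓝[>] 0) (𝓝 l) ∧
    l * ‖(Z.symm : C.Y20 →L[ℝ] C.D20)‖ < 1 ∧
    ∃ δ₀ > (0 : ℝ), ∃ ε₀ > (0 : ℝ), ∀ δ, 0 < δ → δ ≤ δ₀ → ∀ ε, 0 < ε → ε ≤ ε₀ →
      ∀ t', 0 ≤ t' → |t' - t| < δ →
      ∀ x1' ∈ Metric.ball x1 δ, ∀ xS' ∈ Metric.ball xS δ,
      ∀ d' ∈ Metric.ball d δ, ∀ e' ∈ Metric.ball e δ,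
      ∀ y ∈ Metric.ball x20 ε, ∀ z ∈ Metric.ball x20 ε,
        ‖C.F20 f t' x1' y xS' d' e' - C.F20 f t' x1' z xS' d' e' - (Z (y - z) : Y)‖
          ≤ k δ ε * ‖y - z‖

end CanonicalSystem

section Calculus

variable [NormedSpace ℝ D] [IsScalarTower ℝ 𝕜 D] [NormedSpace ℝ Y] [IsScalarTower ℝ 𝕜 Y]

/-- `g ∈ C^k([0,∞) × S, Y)` for a subset `S` of the subspace `E` of `D`. -/
def SmoothOn (k : ℕ) (E : Submodule 𝕜 D) (S : Set D) (g : ℝ → D → Y) : Prop :=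
  ContDiffOn ℝ k (fun p : ℝ × E => g p.1 (p.2 : D)) (Ici 0 ×ˢ {x : E | (x : D) ∈ S})

/-- The derivative of `g : E → Y` at `z` exists and is an operator from `E` onto the subspace `W`
of `Y` with a bounded inverse. -/
def HasInvertibleDerivAt (E : Submodule 𝕜 D) (W : Submodule 𝕜 Y) (g : E → Y) (z : E) : Prop :=
  ∃ L : E ≃L[ℝ] W,
    HasFDerivAt g ((W.subtypeL.restrictScalars ℝ).comp (L : E →L[ℝ] W)) z

/-- The points of the interval `J` at which `d/dt [a x]` has to exist: all of `J`, except that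
the point `0` is left out if `J = [0,∞)`. -/
def diffPart (J : Set ℝ) : Set ℝ := {t ∈ J | J = Ici 0 → 0 < t}

/-- `x` is a solution of `d/dt [a x] + b x = f(t, x)` on the interval `J`: `x` is continuous on `J`,
`a x` is continuously differentiable (one-sidedly at an end point that belongs to `J`) and the
equation holds. The values of `x` outside `J` play no role. -/
def IsSolutionOn (a b : D →ₗ[𝕜] Y) (f : ℝ → D → Y) (J : Set ℝ) (x : ℝ → D) : Prop :=
  ContinuousOn x J ∧ ∃ v : ℝ → Y, ContinuousOn v (diffPart J) ∧
    ∀ t ∈ diffPart J, HasDerivWithinAt (fun τ => a (x τ)) (v t) J t ∧ v t + b (x t) = f t (x t)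

end Calculus

/-- The interval `[t₀, T)`, where `T ≤ ∞`. -/
def rightInterval (t₀ : ℝ) (T : EReal) : Set ℝ := {t | t₀ ≤ t ∧ (t : EReal) < T}

/-- `J` is a nondegenerate interval with left end point `t₀ ∈ J`. -/
def IsIntervalFrom (t₀ : ℝ) (J : Set ℝ) : Prop := J.OrdConnected ∧ IsLeast J t₀ ∧ J.Nontrivial

end Pencil

end ADAE

end

/-!
The system is equivalent to an ordinary differential equation in the space `Y₁` together with
constraints that can be solved explicitly, so that the theorem follows from the existence of a
unique maximal solution for the ordinary differential equation.

All projectors attached to the root vectors are diagonal in a common coordinate system: with `projD`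
and `projY` (sums over the index pairs `(i, r)` that satisfy a predicate, `r` being the order of
a root vector), `b` intertwines equal predicates (`b_projD`), while `a` lowers the order by one
(`projY_a`) and maps `D₁` into `Y₁`. Projecting the equation therefore gives

* for the chains of length `s + 1` and the order `s ≥ 1`, a constraint without derivatives,
  `F_{2s}^{(s+1)} = 0`, since `a x` has no component there;
* for the longer chains and an order `s ≥ 1`, the constraint `F_{2Σ,s} = 0`, in which `d` and `e`
  are the time derivatives of the components of order `s + 1`;
* for the order `0`, the constraint `F_{20} = 0`, in which `d` and `e` are the time derivatives of
  the components of order `1`;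
* on `Y₁`, the differential equation `w' = Q₁ f - b Ã⁻¹ w` for `w = a x₁ = Ã x₁`.

By the triangular structure of `f`, the constraints of positive order involve neither `x₁` nor
`x_{20}`. They are solved by downward recursion on the order with the implicit function theorem
(`contDiffOn_implicit`) and determine the components of positive order as `C¹` functions of time
alone (`SolvabilityConditions.exists_constraintCurve`). The component `x_{20}` is then a function of
`(t, w)`, continuous and locally Lipschitz in `w` by the contractivity condition
(`SolvabilityConditions.exists_zeroOrderPart`). Inserting all components yields a field on `Y₁` that
is locally Lipschitz, and `exists_maximal_solution` applies; the bounded operators `Ã⁻¹` and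
`b Ã⁻¹` needed here come from the resolvent and the closed graph theorem
(`exists_aTilde_inverse`, `continuous_closed_comp`).

Solutions of the reduced equation give solutions of the system
(`SolvabilityConditions.isSolutionOn_fullState`). Conversely, along a solution with values in `M`
the unique solvability of the constraints identifies all components
(`SolvabilityConditions.solvesODE_of_isSolutionOn`). On the interval `[0, ∞)`, where a solution need
not have a differentiable `a x` at `0`, the operator `P₁` is not assumed to be continuous, and the
limit of `w` at `0` is obtained from the linear term of the reduced equation
(`exists_tendsto_of_linear`).
-/

noncomputable section

namespace ADAE.CanonicalSystem

/-! ### Coordinate projections of a canonical system -/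

section Algebra

variable {𝕜 D Y : Type*} [RCLike 𝕜]
  [NormedAddCommGroup D] [NormedSpace 𝕜 D] [NormedAddCommGroup Y] [NormedSpace 𝕜 Y]
  {a b : D →ₗ[𝕜] Y} {ν n : ℕ} (C : CanonicalSystem a b ν n)

open Classical in
/-- The projection of `D` onto the span of those root vectors `φ i (r + 1)`, `r < m i`, whose
index satisfies `p i r`. The second index is the order `r` of the root vector, so that it is
one less than in `CanonicalSystem`. -/
def projD (p : Fin n → ℕ → Prop) : D →ₗ[𝕜] D :=
  ∑ i, ∑ r ∈ Finset.range (C.m i), if p i r then C.pTerm i (r + 1) else 0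

open Classical in
/-- The projection of `Y` onto the span of those vectors `b (φ i (r + 1))`, `r < m i`, whose
index satisfies `p i r`. -/
def projY (p : Fin n → ℕ → Prop) : Y →L[𝕜] Y :=
  ∑ i, ∑ r ∈ Finset.range (C.m i), if p i r then C.qTerm i (r + 1) else 0

/-- Indices of the root vectors of order `s` in the chains of length `s + 1`. -/
def lastIdx (s : ℕ) (i : Fin n) (r : ℕ) : Prop := r = s ∧ C.m i = s + 1

/-- Indices of the root vectors of order `s` in the chains longer than `s + 1`. -/
def wedgeIdx (s : ℕ) (i : Fin n) (r : ℕ) : Prop := r = s ∧ s + 2 ≤ C.m i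

open Classical in
lemma projD_apply (p : Fin n → ℕ → Prop) (x : D) :
    C.projD p x = ∑ i, ∑ r ∈ Finset.range (C.m i),
      if p i r then C.q i (r + 1) (b x) • C.φ i (r + 1) else 0 := by
  simp only [projD, LinearMap.sum_apply]
  refine Finset.sum_congr rfl fun i _ => Finset.sum_congr rfl fun r _ => ?_
  split_ifs <;> simp [pTerm]

open Classical in
lemma projY_apply (p : Fin n → ℕ → Prop) (y : Y) :
    C.projY p y = ∑ i, ∑ r ∈ Finset.range (C.m i),
      if p i r then C.q i (r + 1) y • b (C.φ i (r + 1)) else 0 := by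
  simp only [projY, sum_apply]
  refine Finset.sum_congr rfl fun i _ => Finset.sum_congr rfl fun r _ => ?_
  split_ifs <;> simp [qTerm]

open Classical in
lemma q_projY (p : Fin n → ℕ → Prop) (y : Y) {k : Fin n} {l : ℕ} (hl : l < C.m k) :
    C.q k (l + 1) (C.projY p y) = if p k l then C.q k (l + 1) y else 0 := by
  rw [projY_apply, map_sum, Finset.sum_eq_single k, map_sum, Finset.sum_eq_single l]
  · split_ifs
    · rw [map_smul, C.biorthogonal k (l + 1) k (l + 1) (by omega) (by omega) (by omega) (by omega)]
      simp
    · simp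
  · intro r hr hrl
    split_ifs
    · rw [map_smul, C.biorthogonal k (r + 1) k (l + 1) (by omega)
        (by have := Finset.mem_range.1 hr; omega) (by omega) (by omega), if_neg (by omega)]
      simp
    · simp
  · intro h; exact absurd (Finset.mem_range.2 hl) h
  · intro i _ hik
    rw [map_sum]
    refine Finset.sum_eq_zero fun r hr => ?_
    split_ifs
    · rw [map_smul, C.biorthogonal i (r + 1) k (l + 1) (by omega)
        (by have := Finset.mem_range.1 hr; omega) (by omega) (by omega), if_neg (by tauto)]
      simp
    · simp
  · simp

lemma b_projD (p : Fin n → ℕ → Prop) (x : D) : b (C.projD p x) = C.projY p (b x) := by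
  classical
  rw [projD_apply, projY_apply]
  simp only [map_sum]
  refine Finset.sum_congr rfl fun i _ => Finset.sum_congr rfl fun r _ => ?_
  split_ifs <;> simp

lemma projD_projD (p p' : Fin n → ℕ → Prop) (x : D) :
    C.projD p (C.projD p' x) = C.projD (fun i r => p i r ∧ p' i r) x := by
  classical
  rw [projD_apply C p, projD_apply C (fun i r => p i r ∧ p' i r)]
  refine Finset.sum_congr rfl fun i _ => Finset.sum_congr rfl fun r hr => ?_
  rw [b_projD, q_projY C p' (b x) (Finset.mem_range.1 hr)]
  by_cases h : p i r <;> by_cases h' : p' i r <;> simp [h, h']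

lemma projY_projY (p p' : Fin n → ℕ → Prop) (y : Y) :
    C.projY p (C.projY p' y) = C.projY (fun i r => p i r ∧ p' i r) y := by
  classical
  rw [projY_apply C p, projY_apply C (fun i r => p i r ∧ p' i r)]
  refine Finset.sum_congr rfl fun i _ => Finset.sum_congr rfl fun r hr => ?_
  rw [q_projY C p' y (Finset.mem_range.1 hr)]
  by_cases h : p i r <;> by_cases h' : p' i r <;> simp [h, h']

lemma projD_congr {p p' : Fin n → ℕ → Prop} (h : ∀ i r, r < C.m i → (p i r ↔ p' i r)) :
    C.projD p = C.projD p' := by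
  classical
  refine Finset.sum_congr rfl fun i _ => Finset.sum_congr rfl fun r hr => ?_
  simp only [h i r (Finset.mem_range.1 hr)]

lemma projY_congr {p p' : Fin n → ℕ → Prop} (h : ∀ i r, r < C.m i → (p i r ↔ p' i r)) :
    C.projY p = C.projY p' := by
  classical
  refine Finset.sum_congr rfl fun i _ => Finset.sum_congr rfl fun r hr => ?_
  simp only [h i r (Finset.mem_range.1 hr)]

lemma projD_eq_zero {p : Fin n → ℕ → Prop} (h : ∀ i r, r < C.m i → ¬ p i r) :
    C.projD p = 0 := by
  classical
  refine Finset.sum_eq_zero fun i _ => Finset.sum_eq_zero fun r hr => ?_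
  exact if_neg (h i r (Finset.mem_range.1 hr))

lemma projY_eq_zero {p : Fin n → ℕ → Prop} (h : ∀ i r, r < C.m i → ¬ p i r) :
    C.projY p = 0 := by
  classical
  refine Finset.sum_eq_zero fun i _ => Finset.sum_eq_zero fun r hr => ?_
  exact if_neg (h i r (Finset.mem_range.1 hr))

lemma projD_or {p p' : Fin n → ℕ → Prop} (h : ∀ i r, r < C.m i → ¬ (p i r ∧ p' i r)) :
    C.projD (fun i r => p i r ∨ p' i r) = C.projD p + C.projD p' := by
  classical
  rw [projD, projD, projD, ← Finset.sum_add_distrib]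
  refine Finset.sum_congr rfl fun i _ => ?_
  rw [← Finset.sum_add_distrib]
  refine Finset.sum_congr rfl fun r hr => ?_
  have := h i r (Finset.mem_range.1 hr)
  by_cases h1 : p i r <;> by_cases h2 : p' i r <;> simp_all

lemma projY_or {p p' : Fin n → ℕ → Prop} (h : ∀ i r, r < C.m i → ¬ (p i r ∧ p' i r)) :
    C.projY (fun i r => p i r ∨ p' i r) = C.projY p + C.projY p' := by
  classical
  rw [projY, projY, projY, ← Finset.sum_add_distrib]
  refine Finset.sum_congr rfl fun i _ => ?_
  rw [← Finset.sum_add_distrib]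
  refine Finset.sum_congr rfl fun r hr => ?_
  have := h i r (Finset.mem_range.1 hr)
  by_cases h1 : p i r <;> by_cases h2 : p' i r <;> simp_all

lemma sum_projD {ι : Type*} (S : Finset ι) (p : ι → Fin n → ℕ → Prop)
    (h : ∀ i r, r < C.m i → ∀ k ∈ S, ∀ l ∈ S, p k i r → p l i r → k = l) :
    ∑ k ∈ S, C.projD (p k) = C.projD (fun i r => ∃ k ∈ S, p k i r) := by
  classical
  induction S using Finset.induction_on with
  | empty => rw [Finset.sum_empty, projD_eq_zero]; simp
  | insert k S hk ih =>
    rw [Finset.sum_insert hk, ih, ← projD_or]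
    · exact congrArg C.projD (by ext i r; simp)
    · rintro i r hr ⟨h1, l, hl, h2⟩
      have := h i r hr k (by simp) l (by simp [hl]) h1 h2
      exact hk (this ▸ hl)
    · intro i r hr k' hk' l' hl'
      exact h i r hr k' (Finset.mem_insert_of_mem hk') l' (Finset.mem_insert_of_mem hl')

lemma sum_projY {ι : Type*} (S : Finset ι) (p : ι → Fin n → ℕ → Prop)
    (h : ∀ i r, r < C.m i → ∀ k ∈ S, ∀ l ∈ S, p k i r → p l i r → k = l) :
    ∑ k ∈ S, C.projY (p k) = C.projY (fun i r => ∃ k ∈ S, p k i r) := by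
  classical
  induction S using Finset.induction_on with
  | empty => rw [Finset.sum_empty, projY_eq_zero]; simp
  | insert k S hk ih =>
    rw [Finset.sum_insert hk, ih, ← projY_or]
    · exact congrArg C.projY (by ext i r; simp)
    · rintro i r hr ⟨h1, l, hl, h2⟩
      have := h i r hr k (by simp) l (by simp [hl]) h1 h2
      exact hk (this ▸ hl)
    · intro i r hr k' hk' l' hl'
      exact h i r hr k' (Finset.mem_insert_of_mem hk') l' (Finset.mem_insert_of_mem hl')

lemma a_eigenvector (i : Fin n) : a (C.φ i 1) = 0 := by
  have : C.φ i 1 ∈ LinearMap.ker a :=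
    C.span_eigenvectors ▸ Submodule.subset_span ⟨i, rfl⟩
  exact this

/-- The operator `a` lowers the order of root vectors by one. -/
lemma projY_a {p p' : Fin n → ℕ → Prop}
    (h : ∀ i r, r + 1 < C.m i → (p' i (r + 1) ↔ p i r)) (x : D) :
    C.projY p (a x) = a (C.projD p' x) := by
  classical
  rw [projD_apply, projY_apply]
  simp only [map_sum]
  refine Finset.sum_congr rfl fun i _ => ?_
  obtain ⟨m, hm⟩ : ∃ m, C.m i = m + 1 := ⟨C.m i - 1, by have := C.one_le_m i; omega⟩
  rw [hm, Finset.sum_range_succ, Finset.sum_range_succ', ← hm, C.dual_eigen]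
  simp only [zero_add, zero_smul, ite_self, add_zero]
  rw [apply_ite a, map_smul, a_eigenvector, smul_zero, map_zero, ite_self, add_zero]
  refine Finset.sum_congr rfl fun r hr => ?_
  have hr' := Finset.mem_range.1 hr
  rw [apply_ite a, map_zero, map_smul]
  have h1 := C.dual_chain i (r + 1) (by omega) (by omega) x
  have h2 := C.chain i (r + 1 + 1) (by omega) (by omega)
  simp only [h i r (by omega)]
  rw [h1, h2]
  simp

lemma P2j_eq {s j : ℕ} (h : s < j) :
    C.P2j s j = C.projD (fun i r => r = s ∧ C.m i = j) := by
  classical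
  rw [P2j, projD, Finset.sum_filter]
  refine Finset.sum_congr rfl fun i _ => ?_
  by_cases hm : C.m i = j
  · rw [if_pos hm, Finset.sum_eq_single s]
    · simp [hm]
    · intro r _ hr; simp [hr]
    · intro h'; exact absurd (Finset.mem_range.2 (hm ▸ h)) h'
  · rw [if_neg hm]; simp [hm]

lemma Q2j_eq {s j : ℕ} (h : s < j) :
    C.Q2j s j = C.projY (fun i r => r = s ∧ C.m i = j) := by
  classical
  rw [Q2j, projY, Finset.sum_filter]
  refine Finset.sum_congr rfl fun i _ => ?_
  by_cases hm : C.m i = j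
  · rw [if_pos hm, Finset.sum_eq_single s]
    · simp [hm]
    · intro r _ hr; simp [hr]
    · intro h'; exact absurd (Finset.mem_range.2 (hm ▸ h)) h'
  · rw [if_neg hm]; simp [hm]

lemma P2j_last (s : ℕ) : C.P2j s (s + 1) = C.projD (C.lastIdx s) := C.P2j_eq (by omega)

lemma Q2j_last (s : ℕ) : C.Q2j s (s + 1) = C.projY (C.lastIdx s) := C.Q2j_eq (by omega)

lemma PWedge_eq (s : ℕ) : C.PWedge s = C.projD (C.wedgeIdx s) := by
  rw [PWedge, Finset.sum_congr rfl fun j hj => C.P2j_eq (s := s) (j := j)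
    (by have := Finset.mem_Icc.1 hj; omega), sum_projD]
  · refine C.projD_congr fun i r hr => ?_
    have := C.m_le i
    simp only [Finset.mem_Icc, wedgeIdx]
    constructor
    · rintro ⟨j, hj, h1, h2⟩; omega
    · rintro ⟨h1, h2⟩; exact ⟨C.m i, by omega, h1, rfl⟩
  · intros; omega

lemma QSigma_eq (s : ℕ) : C.QSigma s = C.projY (C.wedgeIdx s) := by
  rw [QSigma, Finset.sum_congr rfl fun j hj => C.Q2j_eq (s := s) (j := j)
    (by have := Finset.mem_Icc.1 hj; omega), sum_projY]
  · refine C.projY_congr fun i r hr => ?_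
    have := C.m_le i
    simp only [Finset.mem_Icc, wedgeIdx]
    constructor
    · rintro ⟨j, hj, h1, h2⟩; omega
    · rintro ⟨h1, h2⟩; exact ⟨C.m i, by omega, h1, rfl⟩
  · intros; omega

lemma P2_eq (s : ℕ) : C.P2 s = C.projD (fun _ r => r = s) := by
  rw [P2, Finset.sum_congr rfl fun j hj => C.P2j_eq (s := s) (j := j)
    (by have := Finset.mem_Icc.1 hj; omega), sum_projD]
  · refine C.projD_congr fun i r hr => ?_
    have := C.m_le i
    simp only [Finset.mem_Icc]
    constructor
    · rintro ⟨j, hj, h1, h2⟩; omega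
    · rintro rfl; exact ⟨C.m i, by omega, rfl, rfl⟩
  · intros; omega

lemma Q2_eq (s : ℕ) : C.Q2 s = C.projY (fun _ r => r = s) := by
  rw [Q2, Finset.sum_congr rfl fun j hj => C.Q2j_eq (s := s) (j := j)
    (by have := Finset.mem_Icc.1 hj; omega), sum_projY]
  · refine C.projY_congr fun i r hr => ?_
    have := C.m_le i
    simp only [Finset.mem_Icc]
    constructor
    · rintro ⟨j, hj, h1, h2⟩; omega
    · rintro rfl; exact ⟨C.m i, by omega, rfl, rfl⟩
  · intros; omega

lemma PSigma_eq : C.PSigma = C.projD (fun _ r => 1 ≤ r) := by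
  rw [PSigma, Finset.sum_congr rfl fun j _ => C.P2_eq j, sum_projD]
  · refine C.projD_congr fun i r hr => ?_
    have := C.m_le i
    simp only [Finset.mem_Icc]
    constructor
    · rintro ⟨j, hj, h1⟩; omega
    · intro h; exact ⟨r, by omega, rfl⟩
  · intros; omega

lemma sum_Icc_one_eq_range {M : Type*} [AddCommMonoid M] (g : ℕ → M) (m : ℕ) :
    ∑ j ∈ Finset.Icc 1 m, g j = ∑ r ∈ Finset.range m, g (r + 1) := by
  rw [Finset.range_eq_Ico, Finset.sum_Ico_add' g 0 m 1]
  rfl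

lemma P1_eq : C.P1 = LinearMap.id - C.projD (fun _ _ => True) := by
  simp only [P1, projD, if_true, sum_Icc_one_eq_range]

lemma Q1_eq : C.Q1 = ContinuousLinearMap.id 𝕜 Y - C.projY (fun _ _ => True) := by
  simp only [Q1, projY, if_true, sum_Icc_one_eq_range]

lemma P1_apply (x : D) : C.P1 x = x - C.projD (fun _ _ => True) x := by simp [P1_eq]

lemma Q1_apply (y : Y) : C.Q1 y = y - C.projY (fun _ _ => True) y := by simp [Q1_eq]

lemma P1_projD (p : Fin n → ℕ → Prop) (x : D) : C.P1 (C.projD p x) = 0 := by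
  rw [P1_apply, projD_projD]; simp

lemma projD_P1 (p : Fin n → ℕ → Prop) (x : D) : C.projD p (C.P1 x) = 0 := by
  rw [P1_apply, map_sub, projD_projD]; simp

lemma projY_Q1 (p : Fin n → ℕ → Prop) (y : Y) : C.projY p (C.Q1 y) = 0 := by
  rw [Q1_apply, map_sub, projY_projY]; simp

lemma P1_P1 (x : D) : C.P1 (C.P1 x) = C.P1 x := by
  rw [P1_apply, projD_P1, sub_zero]

lemma Q1_Q1 (y : Y) : C.Q1 (C.Q1 y) = C.Q1 y := by
  rw [Q1_apply, projY_Q1, sub_zero]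

lemma b_P1 (x : D) : b (C.P1 x) = C.Q1 (b x) := by
  rw [P1_apply, Q1_apply, map_sub, b_projD]

lemma Q1_a (x : D) : C.Q1 (a x) = a (C.P1 x) := by
  rw [P1_apply, Q1_apply, map_sub, C.projY_a (p' := fun _ _ => True)]
  simp

lemma mem_range_projD {p : Fin n → ℕ → Prop} {x : D} :
    x ∈ LinearMap.range (C.projD p) ↔ C.projD p x = x := by
  constructor
  · rintro ⟨y, rfl⟩; rw [projD_projD]; simp
  · exact fun h => ⟨x, h⟩

lemma mem_DLast {s : ℕ} {x : D} : x ∈ C.DLast s ↔ C.projD (C.lastIdx s) x = x := by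
  rw [DLast, P2j_last, mem_range_projD]

lemma mem_DWedge {s : ℕ} {x : D} : x ∈ C.DWedge s ↔ C.projD (C.wedgeIdx s) x = x := by
  rw [DWedge, PWedge_eq, mem_range_projD]

lemma mem_D20 {x : D} : x ∈ C.D20 ↔ C.projD (fun _ r => r = 0) x = x := by
  rw [D20, P2_eq, mem_range_projD]

lemma mem_DSigma {x : D} : x ∈ C.DSigma ↔ C.projD (fun _ r => 1 ≤ r) x = x := by
  rw [DSigma, PSigma_eq, mem_range_projD]

lemma mem_D1 {x : D} : x ∈ C.D1 ↔ C.P1 x = x :=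
  ⟨by rintro ⟨y, rfl⟩; exact C.P1_P1 y, fun h => ⟨x, h⟩⟩

lemma mem_Y1 {y : Y} : y ∈ C.Y1 ↔ C.Q1 y = y :=
  ⟨by rintro ⟨y, rfl⟩; exact C.Q1_Q1 y, fun h => ⟨y, h⟩⟩

lemma projD_of_imp {p p' : Fin n → ℕ → Prop} {x : D} (hx : C.projD p x = x)
    (h : ∀ i r, r < C.m i → p i r → p' i r) : C.projD p' x = x := by
  rw [← hx, projD_projD, C.projD_congr fun i r hr => and_iff_right_of_imp (h i r hr)]

lemma projD_of_disjoint {p p' : Fin n → ℕ → Prop} {x : D} (hx : C.projD p x = x)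
    (h : ∀ i r, r < C.m i → p i r → ¬ p' i r) : C.projD p' x = 0 := by
  rw [← hx, projD_projD, C.projD_eq_zero fun i r hr h' => h i r hr h'.2 h'.1]; rfl

lemma projY_projY_of_disjoint {p p' : Fin n → ℕ → Prop}
    (h : ∀ i r, r < C.m i → p i r → ¬ p' i r) (y : Y) : C.projY p (C.projY p' y) = 0 := by
  rw [projY_projY, C.projY_eq_zero fun i r hr h' => h i r hr h'.1 h'.2]; rfl

/-- The span of all root vectors. -/
abbrev rootSpace : Submodule 𝕜 D := LinearMap.range (C.projD fun _ _ => True)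

lemma range_projD_le (p : Fin n → ℕ → Prop) : LinearMap.range (C.projD p) ≤ C.rootSpace := by
  intro x hx
  rw [mem_range_projD] at *
  exact C.projD_of_imp hx fun _ _ _ _ => trivial

instance finiteDimensional_range_projD (p : Fin n → ℕ → Prop) :
    FiniteDimensional 𝕜 (LinearMap.range (C.projD p)) := by
  classical
  let S : Submodule 𝕜 D := Submodule.span 𝕜
    (Set.range fun k : (i : Fin n) × Fin (C.m i) => C.φ k.1 (k.2 + 1))
  have : FiniteDimensional 𝕜 S := FiniteDimensional.span_of_finite 𝕜 (Set.finite_range _)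
  refine Submodule.finiteDimensional_of_le (S₂ := S) ?_
  rintro _ ⟨x, rfl⟩
  rw [projD_apply]
  refine Submodule.sum_mem _ fun i _ => Submodule.sum_mem _ fun r hr => ?_
  split_ifs
  · exact Submodule.smul_mem _ _
      (Submodule.subset_span ⟨⟨i, ⟨r, Finset.mem_range.1 hr⟩⟩, rfl⟩)
  · exact Submodule.zero_mem _

instance (s : ℕ) : FiniteDimensional 𝕜 (C.DLast s) := by
  rw [DLast, P2j_last]; infer_instance

instance (s : ℕ) : FiniteDimensional 𝕜 (C.DWedge s) := by
  rw [DWedge, PWedge_eq]; infer_instance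

instance : FiniteDimensional 𝕜 C.D20 := by
  rw [D20, P2_eq]; infer_instance

lemma DLast_le (s : ℕ) : C.DLast s ≤ C.rootSpace := by
  rw [DLast, P2j_last]; exact C.range_projD_le _

lemma DWedge_le (s : ℕ) : C.DWedge s ≤ C.rootSpace := by
  rw [DWedge, PWedge_eq]; exact C.range_projD_le _

instance (r s : ℕ) : FiniteDimensional 𝕜 (C.spaceSum r s) :=
  Submodule.finiteDimensional_of_le (S₂ := C.rootSpace) <|
    sup_le (iSup₂_le fun j _ => C.DLast_le j) (iSup₂_le fun j _ => C.DWedge_le j)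

/-- There are no chains longer than `ν`. -/
lemma DLast_eq_zero {s : ℕ} (hs : ν ≤ s) (x : C.DLast s) : x = 0 := by
  have h := C.mem_DLast.1 x.2
  rw [C.projD_eq_zero fun i r _ h => by have := C.m_le i; have := h.2; omega] at h
  exact Subtype.ext h.symm

lemma DWedge_eq_zero {s : ℕ} (hs : ν ≤ s + 1) (x : C.DWedge s) : x = 0 := by
  have h := C.mem_DWedge.1 x.2
  rw [C.projD_eq_zero fun i r _ h => by have := C.m_le i; have := h.2; omega] at h
  exact Subtype.ext h.symm

end Algebra

end ADAE.CanonicalSystem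

namespace ADAE

/-! ### Implicit functions -/

section Implicit

variable {E W : Type*} [NormedAddCommGroup E] [NormedSpace ℝ E]
  [NormedAddCommGroup W] [NormedSpace ℝ W]

/-- If `F` deviates from the isomorphism `Z` by a Lipschitz map with a constant
`c < ‖Z⁻¹‖⁻¹`, then distances of arguments are controlled by distances of values. -/
lemma norm_sub_le_of_approx (Z : E ≃L[ℝ] W) {c : ℝ} {F : E → W} {y z : E}
    (h : ‖F y - F z - Z (y - z)‖ ≤ c * ‖y - z‖) :
    (1 - c * ‖(Z.symm : W →L[ℝ] E)‖) * ‖y - z‖ ≤ ‖(Z.symm : W →L[ℝ] E)‖ * ‖F y - F z‖ := by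
  set ζ := ‖(Z.symm : W →L[ℝ] E)‖
  have h1 : y - z = Z.symm (F y - F z) - Z.symm (F y - F z - Z (y - z)) := by
    rw [map_sub Z.symm (F y - F z), Z.symm_apply_apply]; abel
  have h2 : ‖y - z‖ ≤ ζ * ‖F y - F z‖ + ζ * (c * ‖y - z‖) := by
    calc ‖y - z‖ = ‖Z.symm (F y - F z) - Z.symm (F y - F z - Z (y - z))‖ := by rw [← h1]
      _ ≤ ‖Z.symm (F y - F z)‖ + ‖Z.symm (F y - F z - Z (y - z))‖ := norm_sub_le _ _
      _ ≤ ζ * ‖F y - F z‖ + ζ * ‖F y - F z - Z (y - z)‖ :=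
        add_le_add ((Z.symm : W →L[ℝ] E).le_opNorm _) ((Z.symm : W →L[ℝ] E).le_opNorm _)
      _ ≤ _ := by gcongr
  linarith

/-- A quantitative zero theorem by the contraction `y ↦ y - Z⁻¹ (F y)`. -/
lemma exists_zero_of_approx [CompleteSpace E] (Z : E ≃L[ℝ] W) {c : ℝ} (hc0 : 0 ≤ c)
    (hc : c * ‖(Z.symm : W →L[ℝ] E)‖ < 1) {F : E → W} {z₀ : E} {r : ℝ} (hr : 0 ≤ r)
    (h : ∀ y ∈ Metric.closedBall z₀ r, ∀ z ∈ Metric.closedBall z₀ r,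
      ‖F y - F z - Z (y - z)‖ ≤ c * ‖y - z‖)
    (hF : ‖(Z.symm : W →L[ℝ] E)‖ * ‖F z₀‖ ≤ (1 - c * ‖(Z.symm : W →L[ℝ] E)‖) * r) :
    ∃ z ∈ Metric.closedBall z₀ r, F z = 0 := by
  set ζ := ‖(Z.symm : W →L[ℝ] E)‖ with hζ
  have hζ0 : 0 ≤ ζ := norm_nonneg _
  let T : E → E := fun y => y - Z.symm (F y)
  have hT : ∀ y z, T y - T z = -Z.symm (F y - F z - Z (y - z)) := by
    intro y z
    simp only [T, map_sub, Z.symm_apply_apply]; abel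
  have hTn : ∀ y ∈ Metric.closedBall z₀ r, ∀ z ∈ Metric.closedBall z₀ r,
      ‖T y - T z‖ ≤ c * ζ * ‖y - z‖ := by
    intro y hy z hz
    rw [hT, norm_neg]
    calc _ ≤ ζ * ‖F y - F z - Z (y - z)‖ := (Z.symm : W →L[ℝ] E).le_opNorm _
      _ ≤ ζ * (c * ‖y - z‖) := by gcongr; exact h y hy z hz
      _ = _ := by ring
  have h0 : z₀ ∈ Metric.closedBall z₀ r := Metric.mem_closedBall_self hr
  have hmaps : MapsTo T (Metric.closedBall z₀ r) (Metric.closedBall z₀ r) := by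
    intro y hy
    have h1 := hTn y hy z₀ h0
    rw [mem_closedBall_iff_norm] at hy ⊢
    have h2 : T y - z₀ = (T y - T z₀) - Z.symm (F z₀) := by simp only [T]; abel
    rw [h2]
    have h3 : ‖Z.symm (F z₀)‖ ≤ ζ * ‖F z₀‖ := (Z.symm : W →L[ℝ] E).le_opNorm _
    have h4 : c * ζ * ‖y - z₀‖ ≤ c * ζ * r := by gcongr
    have := norm_sub_le (T y - T z₀) (Z.symm (F z₀))
    linarith
  let K : NNReal := NNReal.mk (c * ζ) (by positivity)
  have hcontr : ContractingWith K
      (hmaps.restrict T (Metric.closedBall z₀ r) (Metric.closedBall z₀ r)) := by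
    refine ⟨NNReal.coe_lt_coe.1 hc, LipschitzWith.of_dist_le_mul ?_⟩
    rintro ⟨y, hy⟩ ⟨z, hz⟩
    simp only [Subtype.dist_eq, MapsTo.val_restrict_apply, dist_eq_norm]
    exact hTn y hy z hz
  obtain ⟨z, hz, hfix, -⟩ := hcontr.exists_fixedPoint'
    (Metric.isClosed_closedBall.isComplete) hmaps h0 (edist_ne_top _ _)
  refine ⟨z, hz, ?_⟩
  have h5 : Z.symm (F z) = 0 := by
    have : z - Z.symm (F z) = z := hfix
    simpa using this
  simpa using congrArg Z h5

/-- Continuity of an implicitly defined function under a contractivity condition that is uniform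
in the parameter: the distance from `ψ p₀` is controlled by the residual `F p (ψ p₀)`. -/
lemma eventually_norm_implicit_sub_le [CompleteSpace E] {P : Type*} [TopologicalSpace P] {Ω : Set P}
    {S : Set E} (hS : IsOpen S) {F : P → E → W} {ψ : P → E}
    (hψ : ∀ p ∈ Ω, ψ p ∈ S ∧ F p (ψ p) = 0) (huniq : ∀ p ∈ Ω, ∀ y ∈ S, F p y = 0 → y = ψ p)
    {p₀ : P} (hp₀ : p₀ ∈ Ω) (Z : E ≃L[ℝ] W) {c ε : ℝ} (hc0 : 0 ≤ c)
    (hc : c * ‖(Z.symm : W →L[ℝ] E)‖ < 1) (hε : 0 < ε)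
    (happ : ∀ᶠ p in 𝓝[Ω] p₀, ∀ y ∈ Metric.ball (ψ p₀) ε, ∀ z ∈ Metric.ball (ψ p₀) ε,
      ‖F p y - F p z - Z (y - z)‖ ≤ c * ‖y - z‖)
    (hcont : ContinuousWithinAt (fun p => F p (ψ p₀)) Ω p₀) :
    ∃ C : ℝ, ∀ᶠ p in 𝓝[Ω] p₀, ‖ψ p - ψ p₀‖ ≤ C * ‖F p (ψ p₀)‖ := by
  set ζ := ‖(Z.symm : W →L[ℝ] E)‖
  have h1 : 0 < 1 - c * ζ := by linarith
  obtain ⟨ρ, hρ, hρS⟩ := Metric.isOpen_iff.1 hS _ (hψ p₀ hp₀).1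
  -- the radius at which the zero theorem applies to `F p`; it tends to `0` as `p → p₀`
  let r : P → ℝ := fun p => ζ / (1 - c * ζ) * ‖F p (ψ p₀)‖
  have hr : ∀ᶠ p in 𝓝[Ω] p₀, r p < min ε ρ := by
    refine (hcont.norm.const_mul (ζ / (1 - c * ζ))).eventually_lt continuousWithinAt_const ?_
    simpa [(hψ p₀ hp₀).2] using ⟨hε, hρ⟩
  refine ⟨ζ / (1 - c * ζ), ?_⟩
  filter_upwards [happ, hr, self_mem_nhdsWithin] with p hp hrp hpΩ
  have hsub : Metric.closedBall (ψ p₀) (r p) ⊆ Metric.ball (ψ p₀) ε :=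
    Metric.closedBall_subset_ball (hrp.trans_le (min_le_left _ _))
  obtain ⟨y, hy, hy0⟩ := exists_zero_of_approx Z hc0 hc (F := F p) (z₀ := ψ p₀) (r := r p)
    (by positivity) (fun y hy z hz => hp y (hsub hy) z (hsub hz)) (by
      simp only [r]
      rw [← mul_assoc, mul_div_cancel₀ _ h1.ne'])
  have hyS : y ∈ S := hρS (Metric.closedBall_subset_ball (hrp.trans_le (min_le_right _ _)) hy)
  rw [← huniq p hpΩ y hyS hy0]
  exact mem_closedBall_iff_norm.1 hy

/-- The partial derivative with respect to the second variable. -/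
def partialSnd (G : ℝ × E → W) (Ω : Set (ℝ × E)) (p : ℝ × E) : E →L[ℝ] W :=
  (fderivWithin ℝ G Ω p).comp (ContinuousLinearMap.inr ℝ ℝ E)

variable {S : Set E} {G : ℝ × E → W}

lemma hasFDerivAt_partialSnd (hS : IsOpen S) (hG : DifferentiableOn ℝ G (Ici 0 ×ˢ S))
    {t : ℝ} (ht : 0 ≤ t) {y : E} (hy : y ∈ S) :
    HasFDerivAt (fun y => G (t, y)) (partialSnd G (Ici 0 ×ˢ S) (t, y)) y := by
  have h1 : HasFDerivWithinAt G (fderivWithin ℝ G (Ici 0 ×ˢ S) (t, y)) (Ici 0 ×ˢ S) (t, y) :=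
    (hG (t, y) ⟨ht, hy⟩).hasFDerivWithinAt
  have h2 : HasFDerivWithinAt (fun y : E => (t, y)) (ContinuousLinearMap.inr ℝ ℝ E) S y :=
    (hasFDerivAt_prodMk_right t y).hasFDerivWithinAt
  exact (h1.comp y h2 fun z hz => ⟨ht, hz⟩).hasFDerivAt (hS.mem_nhds hy)

variable [CompleteSpace E]

/-- Near a regular zero of a `C¹` function, the distance of the curve of zeros from it is
controlled by the residual. -/
lemma eventually_norm_sub_le (hS : IsOpen S) (hG : ContDiffOn ℝ 1 G (Ici 0 ×ˢ S))
    {z : ℝ → E} (hz : ∀ t, 0 ≤ t → z t ∈ S ∧ G (t, z t) = 0)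
    (huniq : ∀ t, 0 ≤ t → ∀ y ∈ S, G (t, y) = 0 → y = z t)
    {t₀ : ℝ} (ht₀ : 0 ≤ t₀) (Z : E ≃L[ℝ] W)
    (hZ : HasFDerivAt (fun y => G (t₀, y)) (Z : E →L[ℝ] W) (z t₀)) :
    ∃ c : ℝ, ∀ᶠ t in 𝓝[Ici 0] t₀, ‖z t - z t₀‖ ≤ c * ‖G (t, z t₀)‖ := by
  set ζ := ‖(Z.symm : W →L[ℝ] E)‖ with hζ
  have hζ0 : 0 ≤ ζ := norm_nonneg _
  -- the derivative stays this close to `Z` near the zero, and `c * ‖Z⁻¹‖ ≤ 1 / 2`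
  set c : ℝ := 1 / (2 * (ζ + 1)) with hc
  have hc0 : 0 < c := by positivity
  have hcζ : c * ζ ≤ 1 / 2 := by
    rw [hc, div_mul_eq_mul_div, div_le_div_iff₀ (by positivity) (by norm_num)]; linarith
  have hmem : (t₀, z t₀) ∈ Ici (0 : ℝ) ×ˢ S := ⟨ht₀, (hz t₀ ht₀).1⟩
  have hud : UniqueDiffOn ℝ (Ici (0 : ℝ) ×ˢ S) := (uniqueDiffOn_Ici 0).prod hS.uniqueDiffOn
  have hA : ContinuousOn (partialSnd G (Ici 0 ×ˢ S)) (Ici 0 ×ˢ S) :=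
    (hG.continuousOn_fderivWithin hud le_rfl).clm_comp continuousOn_const
  have hAZ : partialSnd G (Ici 0 ×ˢ S) (t₀, z t₀) = Z :=
    (hasFDerivAt_partialSnd hS (hG.differentiableOn (by norm_num)) ht₀ (hz t₀ ht₀).1).unique hZ
  have hev : ∀ᶠ p in 𝓝[Ici 0 ×ˢ S] (t₀, z t₀), ‖partialSnd G (Ici 0 ×ˢ S) p - Z‖ < c := by
    refine ((hA (t₀, z t₀) hmem).sub_const (Z : E →L[ℝ] W)).norm.eventually_lt
      continuousWithinAt_const ?_
    simpa [hAZ] using hc0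
  rw [nhdsWithin_prod_eq, hS.nhdsWithin_eq (hz t₀ ht₀).1] at hev
  obtain ⟨pa, hpa, pb, hpb, hab⟩ := Filter.eventually_prod_iff.1 hev
  obtain ⟨ε, hε, hball⟩ := Metric.eventually_nhds_iff_ball.1
    (hpb.and (hS.mem_nhds (hz t₀ ht₀).1))
  refine eventually_norm_implicit_sub_le hS (F := fun t y => G (t, y)) hz huniq ht₀ Z hc0.le
    (by linarith) hε ?_ ?_
  · filter_upwards [hpa, self_mem_nhdsWithin] with t hpat ht y hy y' hy'
    exact Convex.norm_image_sub_le_of_norm_hasFDerivWithin_le'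
      (f := fun y => G (t, y)) (φ := (Z : E →L[ℝ] W))
      (fun x hx => (hasFDerivAt_partialSnd hS (hG.differentiableOn (by norm_num)) ht
        (hball x hx).2).hasFDerivWithinAt)
      (fun x hx => (hab hpat (hball x hx).1).le) (convex_ball _ _) hy' hy
  · exact (hG.continuousOn (t₀, z t₀) hmem).comp (f := fun t : ℝ => (t, z t₀)) (by fun_prop)
      fun t ht => ⟨ht, (hz t₀ ht₀).1⟩

/-- The derivative of an implicitly defined curve, one-sided at `t = 0`. -/
lemma hasDerivWithinAt_implicit (hS : IsOpen S) (hG : ContDiffOn ℝ 1 G (Ici 0 ×ˢ S))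
    {z : ℝ → E} (hz : ∀ t, 0 ≤ t → z t ∈ S ∧ G (t, z t) = 0)
    (huniq : ∀ t, 0 ≤ t → ∀ y ∈ S, G (t, y) = 0 → y = z t)
    {t₀ : ℝ} (ht₀ : 0 ≤ t₀) (Z : E ≃L[ℝ] W)
    (hZ : HasFDerivAt (fun y => G (t₀, y)) (Z : E →L[ℝ] W) (z t₀)) :
    HasDerivWithinAt z (-Z.symm (fderivWithin ℝ G (Ici 0 ×ˢ S) (t₀, z t₀) (1, 0)))
      (Ici 0) t₀ := by
  set Ω : Set (ℝ × E) := Ici 0 ×ˢ S with hΩ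
  set G' := fderivWithin ℝ G Ω (t₀, z t₀) with hG'
  have hmem : (t₀, z t₀) ∈ Ω := ⟨ht₀, (hz t₀ ht₀).1⟩
  have hdiff : HasFDerivWithinAt G G' Ω (t₀, z t₀) :=
    (hG.differentiableOn (by norm_num) _ hmem).hasFDerivWithinAt
  have hAZ : partialSnd G Ω (t₀, z t₀) = Z :=
    (hasFDerivAt_partialSnd hS (hG.differentiableOn (by norm_num)) ht₀ (hz t₀ ht₀).1).unique hZ
  have hG0 : ∀ τ : ℝ, ∀ y : E, G' (τ, y) = τ • G' (1, 0) + Z y := by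
    intro τ y
    have h1 : (τ, y) = τ • ((1 : ℝ), (0 : E)) + (0, y) := by simp
    have h2 : (Z : E →L[ℝ] W) y = G' (0, y) := by rw [← hAZ]; simp [partialSnd, hG']
    rw [h1, map_add, map_smul, ← h2]; rfl
  obtain ⟨c, hc⟩ := eventually_norm_sub_le hS hG hz huniq ht₀ Z hZ
  -- the residual is of first order in time, hence so is the increment of `z`
  have hres : (fun t => G (t, z t₀)) =O[𝓝[Ici 0] t₀] fun t => t - t₀ := by
    have h1 : HasFDerivWithinAt (fun t : ℝ => (t, z t₀)) (ContinuousLinearMap.inl ℝ ℝ E)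
      (Ici 0) t₀ := (hasFDerivAt_prodMk_left t₀ (z t₀)).hasFDerivWithinAt
    have hmaps : MapsTo (fun t : ℝ => (t, z t₀)) (Ici 0) Ω := fun t ht => ⟨ht, (hz t₀ ht₀).1⟩
    have h2 := (hdiff.comp t₀ h1 hmaps).isBigO_sub
    simpa [Function.comp_def, (hz t₀ ht₀).2] using h2
  have hbig : (fun t => z t - z t₀) =O[𝓝[Ici 0] t₀] fun t => t - t₀ :=
    (Asymptotics.IsBigO.of_bound c hc).trans hres
  have hcont : Tendsto z (𝓝[Ici 0] t₀) (𝓝 (z t₀)) := by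
    have h1 : Tendsto (fun t => t - t₀) (𝓝[Ici 0] t₀) (𝓝 0) := by
      have : Continuous fun t : ℝ => t - t₀ := by fun_prop
      simpa using (this.tendsto t₀).mono_left nhdsWithin_le_nhds
    have h2 := hbig.trans_tendsto h1
    simpa using h2.add_const (z t₀)
  have htend : Tendsto (fun t => (t, z t)) (𝓝[Ici 0] t₀) (𝓝[Ω] (t₀, z t₀)) := by
    refine tendsto_nhdsWithin_iff.2
      ⟨(tendsto_id.mono_left nhdsWithin_le_nhds).prodMk_nhds hcont, ?_⟩
    filter_upwards [self_mem_nhdsWithin] with t ht using ⟨ht, (hz t ht).1⟩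
  -- linearization of `G (t, z t) = 0`
  have hlo : (fun t => (t - t₀) • G' (1, 0) + Z (z t - z t₀)) =o[𝓝[Ici 0] t₀]
      fun t => t - t₀ := by
    have h1 := hdiff.isLittleO.comp_tendsto htend
    have h2 : (fun t : ℝ => ((t, z t) : ℝ × E) - (t₀, z t₀)) =O[𝓝[Ici 0] t₀]
        fun t => t - t₀ := by
      simp only [Prod.mk_sub_mk]
      exact (Asymptotics.isBigO_refl _ _).prod_left hbig
    have h3 := (h1.trans_isBigO h2).neg_left
    refine h3.congr' ?_ EventuallyEq.rfl
    filter_upwards [self_mem_nhdsWithin] with t ht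
    simp only [Function.comp, (hz t ht).2, (hz t₀ ht₀).2, Prod.mk_sub_mk]
    rw [hG0 (t - t₀)]
    simp
  rw [hasDerivWithinAt_iff_isLittleO]
  have h4 := ((Z.symm : W →L[ℝ] E).isBigO_comp
    (fun t => (t - t₀) • G' (1, 0) + Z (z t - z t₀)) (𝓝[Ici 0] t₀)).trans_isLittleO hlo
  refine h4.congr (fun t => ?_) fun t => rfl
  rw [ContinuousLinearEquiv.coe_coe, map_add, map_smul, Z.symm_apply_apply, smul_neg,
    sub_neg_eq_add, add_comm]

/-- **Implicit function theorem** for a curve over the half line `[0, ∞)`. -/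
theorem contDiffOn_implicit {k : ℕ} (hk : 1 ≤ k) (hS : IsOpen S)
    (hG : ContDiffOn ℝ k G (Ici 0 ×ˢ S))
    {z : ℝ → E} (hz : ∀ t, 0 ≤ t → z t ∈ S ∧ G (t, z t) = 0)
    (huniq : ∀ t, 0 ≤ t → ∀ y ∈ S, G (t, y) = 0 → y = z t)
    (hinv : ∀ t, 0 ≤ t → ∃ Z : E ≃L[ℝ] W,
      HasFDerivAt (fun y => G (t, y)) (Z : E →L[ℝ] W) (z t)) :
    ContDiffOn ℝ k z (Ici 0) := by
  set Ω : Set (ℝ × E) := Ici 0 ×ˢ S with hΩ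
  have hud : UniqueDiffOn ℝ Ω := (uniqueDiffOn_Ici 0).prod hS.uniqueDiffOn
  have hG1 : ContDiffOn ℝ 1 G Ω := hG.of_le (by exact_mod_cast hk)
  have hpart : ∀ t, 0 ≤ t → ∀ Z : E ≃L[ℝ] W,
      HasFDerivAt (fun y => G (t, y)) (Z : E →L[ℝ] W) (z t) →
      partialSnd G Ω (t, z t) = Z := fun t ht Z hZ =>
    (hasFDerivAt_partialSnd hS (hG1.differentiableOn (by norm_num)) ht (hz t ht).1).unique hZ
  have hder : ∀ t ∈ Ici (0 : ℝ), HasDerivWithinAt z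
      (-(partialSnd G Ω (t, z t)).inverse (fderivWithin ℝ G Ω (t, z t) (1, 0))) (Ici 0) t := by
    intro t ht
    obtain ⟨Z, hZ⟩ := hinv t ht
    rw [hpart t ht Z hZ, ContinuousLinearMap.inverse_equiv]
    exact hasDerivWithinAt_implicit hS hG1 hz huniq ht Z hZ
  have hdiffz : DifferentiableOn ℝ z (Ici 0) := fun t ht =>
    (hder t ht).differentiableWithinAt
  -- bootstrap: if `z` is `C^j`, the formula for its derivative shows that this is `C^j` as well
  have key : ∀ j : ℕ, j ≤ k → ContDiffOn ℝ j z (Ici 0) := by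
    intro j
    induction j with
    | zero => intro _; exact contDiffOn_zero.2 hdiffz.continuousOn
    | succ j ih =>
      intro hj
      have hzj := ih (by omega)
      rw [Nat.cast_add, Nat.cast_one, contDiffOn_succ_iff_derivWithin (uniqueDiffOn_Ici 0)]
      refine ⟨hdiffz, by simp, ?_⟩
      have hpath : ContDiffOn ℝ j (fun t : ℝ => (t, z t)) (Ici 0) := contDiffOn_id.prodMk hzj
      have hfd : ContDiffOn ℝ j (fun t => fderivWithin ℝ G Ω (t, z t)) (Ici 0) :=
        (hG.fderivWithin hud (m := j) (by exact_mod_cast hj)).comp hpath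
          fun t ht => ⟨ht, (hz t ht).1⟩
      have hA : ContDiffOn ℝ j (fun t => partialSnd G Ω (t, z t)) (Ici 0) :=
        hfd.clm_comp contDiffOn_const
      have hB : ContDiffOn ℝ j (fun t => (partialSnd G Ω (t, z t)).inverse) (Ici 0) := by
        intro t ht
        obtain ⟨Z, hZ⟩ := hinv t ht
        have hinvZ : ContDiffAt ℝ j (ContinuousLinearMap.inverse (R := ℝ) (M := E) (M₂ := W))
            (partialSnd G Ω (t, z t)) := by
          rw [hpart t ht Z hZ]
          exact contDiffAt_map_inverse Z
        exact hinvZ.comp_contDiffWithinAt t (hA t ht)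
      have hT : ContDiffOn ℝ j (fun t => fderivWithin ℝ G Ω (t, z t) (1, 0)) (Ici 0) :=
        hfd.clm_apply (contDiffOn_const (c := ((1 : ℝ), (0 : E))))
      refine ContDiffOn.congr (hB.clm_apply hT).neg fun t ht => ?_
      exact (hder t ht).derivWithin (uniqueDiffOn_Ici 0 t ht)
  exact key k le_rfl

end Implicit

end ADAE

namespace ADAE

/-! ### Ordinary differential equations on open sets -/

section ODE

variable {F : Type*} [NormedAddCommGroup F] [NormedSpace ℝ F]

/-- `w` solves `w' = g(t, w)` on `J` and stays in `N`; derivatives are taken within `J`. -/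
def SolvesODE (g : ℝ → F → F) (N : Set F) (J : Set ℝ) (w : ℝ → F) : Prop :=
  ∀ t ∈ J, w t ∈ N ∧ HasDerivWithinAt w (g t (w t)) J t

/-- `g` is locally Lipschitz in the second variable on `[0, ∞) × N`. -/
def LocallyLipschitzSnd {G : Type*} [NormedAddCommGroup G] (g : ℝ → F → G) (N : Set F) : Prop :=
  ∀ t₀, 0 ≤ t₀ → ∀ w₀ ∈ N, ∃ r > (0 : ℝ), ∃ L ≥ (0 : ℝ), ∀ t, 0 ≤ t → |t - t₀| < r →
    ∀ w ∈ N, ∀ w' ∈ N, ‖w - w₀‖ < r → ‖w' - w₀‖ < r → ‖g t w - g t w'‖ ≤ L * ‖w - w'‖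

variable {g : ℝ → F → F} {N : Set F} {J J' : Set ℝ} {v w : ℝ → F}

lemma SolvesODE.mono (h : SolvesODE g N J w) (hJ : J' ⊆ J) : SolvesODE g N J' w :=
  fun t ht => ⟨(h t (hJ ht)).1, (h t (hJ ht)).2.mono hJ⟩

lemma SolvesODE.continuousOn (h : SolvesODE g N J w) : ContinuousOn w J :=
  fun t ht => (h t ht).2.continuousWithinAt

lemma SolvesODE.eqOn_Icc (hlip : LocallyLipschitzSnd g N) {α β : ℝ} (hα : 0 ≤ α)
    (hv : SolvesODE g N (Icc α β) v) (hw : SolvesODE g N (Icc α β) w) (h : v α = w α) :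
    EqOn v w (Icc α β) := by
  -- the set of coincidence is closed, and by Grönwall's inequality it extends to the right of
  -- each of its points
  have hsub : Icc α β ⊆ {t | v t = w t} := by
    refine IsClosed.Icc_subset_of_forall_mem_nhdsWithin ?_ h ?_
    · have h1 : ContinuousOn (fun t => v t - w t) (Icc α β) :=
        hv.continuousOn.sub hw.continuousOn
      have h2 := h1.preimage_isClosed_of_isClosed isClosed_Icc (isClosed_singleton (x := (0 : F)))
      convert h2 using 1
      ext t
      simp only [mem_inter_iff, mem_ofPred_eq, mem_preimage, mem_singleton_iff, sub_eq_zero]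
      exact and_comm
    · rintro t₀ ⟨heq, ht₀⟩
      have heq : v t₀ = w t₀ := heq
      have htI : t₀ ∈ Icc α β := Ico_subset_Icc_self ht₀
      obtain ⟨r, hr, L, hL, hrL⟩ := hlip t₀ (hα.trans ht₀.1) (v t₀) (hv t₀ htI).1
      have hIcc : Icc α β ∈ 𝓝[≥] t₀ := Icc_mem_nhdsGE_of_mem ht₀
      have hev : ∀ {u : ℝ → F}, SolvesODE g N (Icc α β) u → u t₀ = v t₀ →
          ∀ᶠ t in 𝓝[≥] t₀, ‖u t - v t₀‖ < r := by
        intro u hu hu0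
        have h1 : ContinuousWithinAt u (Ici t₀) t₀ :=
          (hu.continuousOn t₀ htI).mono_of_mem_nhdsWithin hIcc
        refine (h1.sub_const (v t₀)).norm.eventually_lt continuousWithinAt_const ?_
        simpa [hu0] using hr
      have hev2 : ∀ᶠ t in 𝓝[≥] t₀, |t - t₀| < r := by
        have h1 : ContinuousWithinAt (fun t : ℝ => |t - t₀|) (Ici t₀) t₀ := by fun_prop
        exact h1.eventually_lt continuousWithinAt_const (by simpa using hr)
      obtain ⟨τ, hτ, hτsub⟩ := mem_nhdsGE_iff_exists_Icc_subset.1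
        (inter_mem hIcc (inter_mem hev2 (inter_mem (hev hv rfl) (hev hw heq.symm))))
      have hE : EqOn v w (Icc t₀ τ) := by
        have hJ : Icc t₀ τ ⊆ Icc α β := fun t ht => (hτsub ht).1
        have hder : ∀ {u : ℝ → F}, SolvesODE g N (Icc α β) u → ∀ t ∈ Ico t₀ τ,
            HasDerivWithinAt u (g t (u t)) (Ici t) t := by
          intro u hu t ht
          exact ((hu.mono hJ) t (Ico_subset_Icc_self ht)).2.mono_of_mem_nhdsWithin
            (Icc_mem_nhdsGE_of_mem ht)
        refine ODE_solution_unique_of_mem_Icc_right (v := g) (K := L.toNNReal)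
          (s := fun _ => N ∩ {y | ‖y - v t₀‖ < r}) ?_
          (hv.continuousOn.mono hJ) (hder hv) ?_ (hw.continuousOn.mono hJ) (hder hw) ?_ heq
        · intro t ht
          have hh := hτsub (Ico_subset_Icc_self ht)
          refine LipschitzOnWith.of_dist_le_mul fun x hx y hy => ?_
          rw [dist_eq_norm, dist_eq_norm, Real.coe_toNNReal L hL]
          exact hrL t (hα.trans hh.1.1) hh.2.1 x hx.1 y hy.1 hx.2 hy.2
        · intro t ht
          have hh := hτsub (Ico_subset_Icc_self ht)
          exact ⟨(hv t hh.1).1, hh.2.2.1⟩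
        · intro t ht
          have hh := hτsub (Ico_subset_Icc_self ht)
          exact ⟨(hw t hh.1).1, hh.2.2.2⟩
      filter_upwards [Icc_mem_nhdsGT hτ] with t ht using hE ht
  exact fun t ht => hsub ht

/-- Two solutions are glued at the end point `β` of the first interval. -/
lemma SolvesODE.glue {α β γ : ℝ} (hαβ : α ≤ β) (hβγ : β < γ)
    (hv : SolvesODE g N (Icc α β) v) (hw : SolvesODE g N (Icc β γ) w) (h : w β = v β) :
    SolvesODE g N (Icc α γ) (fun t => if t ≤ β then v t else w t) := by
  set u : ℝ → F := fun t => if t ≤ β then v t else w t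
  have hu1 : EqOn u v (Icc α β) := fun t ht => if_pos ht.2
  have hu2 : EqOn u w (Icc β γ) := by
    intro t ht
    rcases eq_or_lt_of_le ht.1 with rfl | h'
    · simp [u, h]
    · exact if_neg (not_le.2 h')
  have hd1 : ∀ t ∈ Icc α β, HasDerivWithinAt u (g t (u t)) (Icc α β) t := fun t ht => by
    rw [hu1 ht]; exact (hv t ht).2.congr hu1 (hu1 ht)
  have hd2 : ∀ t ∈ Icc β γ, HasDerivWithinAt u (g t (u t)) (Icc β γ) t := fun t ht => by
    rw [hu2 ht]; exact (hw t ht).2.congr hu2 (hu2 ht)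
  intro t ht
  rcases lt_trichotomy t β with h' | h' | h'
  · have htI : t ∈ Icc α β := ⟨ht.1, h'.le⟩
    refine ⟨by rw [hu1 htI]; exact (hv t htI).1, (hd1 t htI).mono_of_mem_nhdsWithin ?_⟩
    filter_upwards [self_mem_nhdsWithin, mem_nhdsWithin_of_mem_nhds (Iio_mem_nhds h')] with s h1 h2
      using ⟨h1.1, le_of_lt h2⟩
  · subst h'
    refine ⟨by rw [hu1 ⟨hαβ, le_rfl⟩]; exact (hv t ⟨hαβ, le_rfl⟩).1, ?_⟩
    rw [← Icc_union_Icc_eq_Icc hαβ hβγ.le]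
    exact (hd1 t ⟨hαβ, le_rfl⟩).union (hd2 t ⟨le_rfl, hβγ.le⟩)
  · have htI : t ∈ Icc β γ := ⟨h'.le, ht.2⟩
    refine ⟨by rw [hu2 htI]; exact (hw t htI).1, (hd2 t htI).mono_of_mem_nhdsWithin ?_⟩
    filter_upwards [self_mem_nhdsWithin, mem_nhdsWithin_of_mem_nhds (Ioi_mem_nhds h')] with s h1 h2
      using ⟨le_of_lt h2, h1.2⟩

variable [CompleteSpace F]

lemma exists_local_solution (hN : IsOpen N)
    (hg : ContinuousOn (fun p : ℝ × F => g p.1 p.2) (Ici 0 ×ˢ N))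
    (hlip : LocallyLipschitzSnd g N) {t₀ : ℝ} (ht₀ : 0 ≤ t₀) {w₀ : F} (hw₀ : w₀ ∈ N) :
    ∃ γ > t₀, ∃ w, SolvesODE g N (Icc t₀ γ) w ∧ w t₀ = w₀ := by
  obtain ⟨r, hr, L, hL, hrL⟩ := hlip t₀ ht₀ w₀ hw₀
  obtain ⟨ρ, hρ, hρN⟩ := Metric.isOpen_iff.1 hN w₀ hw₀
  have hbd : ∀ᶠ p in 𝓝[Ici 0 ×ˢ N] (t₀, w₀), ‖g p.1 p.2‖ < ‖g t₀ w₀‖ + 1 :=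
    (hg (t₀, w₀) ⟨ht₀, hw₀⟩).norm.eventually_lt continuousWithinAt_const (by simp)
  obtain ⟨κ, hκ, hκb⟩ := Metric.mem_nhdsWithin_iff.1 hbd
  -- on a closed ball of radius `a` about `w₀`, and for times within `a` of `t₀`, the field is
  -- bounded by `B` and Lipschitz; `ε ≤ a / B` keeps the solution in that ball
  set B : ℝ := ‖g t₀ w₀‖ + 1 with hB
  have hB0 : 0 < B := by positivity
  set a : ℝ := min (r / 2) (min (ρ / 2) (κ / 2)) with ha
  have ha0 : 0 < a := by positivity
  have har : a < r := (min_le_left _ _).trans_lt (by linarith)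
  have haρ : a < ρ := ((min_le_right _ _).trans (min_le_left _ _)).trans_lt (by linarith)
  have haκ : a < κ := ((min_le_right _ _).trans (min_le_right _ _)).trans_lt (by linarith)
  set ε : ℝ := min a (a / B) with hε
  have hε0 : 0 < ε := by positivity
  have hball : Metric.closedBall w₀ a ⊆ N :=
    (Metric.closedBall_subset_ball haρ).trans hρN
  have htime : ∀ t ∈ Icc t₀ (t₀ + ε), 0 ≤ t ∧ |t - t₀| ≤ a := fun t ht =>
    ⟨ht₀.trans ht.1, by
      rw [abs_of_nonneg (by linarith [ht.1])]; linarith [ht.2, min_le_left a (a / B)]⟩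
  have hPL : IsPicardLindelof g (tmin := t₀) (tmax := t₀ + ε) ⟨t₀, le_rfl, by linarith⟩ w₀
      a.toNNReal 0 B.toNNReal L.toNNReal := by
    constructor
    · intro t ht
      refine LipschitzOnWith.of_dist_le_mul fun x hx y hy => ?_
      rw [Real.coe_toNNReal a ha0.le] at hx hy
      rw [dist_eq_norm, dist_eq_norm, Real.coe_toNNReal L hL]
      exact hrL t (htime t ht).1 ((htime t ht).2.trans_lt har) x (hball hx) y (hball hy)
        ((mem_closedBall_iff_norm.1 hx).trans_lt har) ((mem_closedBall_iff_norm.1 hy).trans_lt har)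
    · intro x hx
      rw [Real.coe_toNNReal a ha0.le] at hx
      exact hg.comp (f := fun t : ℝ => (t, x)) (by fun_prop) fun t ht =>
        ⟨(htime t ht).1, hball hx⟩
    · intro t ht x hx
      rw [Real.coe_toNNReal a ha0.le] at hx
      rw [Real.coe_toNNReal B hB0.le]
      have : (t, x) ∈ Metric.ball (t₀, w₀) κ := by
        rw [← ball_prod_same]
        exact ⟨by rw [Metric.mem_ball, Real.dist_eq]; exact (htime t ht).2.trans_lt haκ,
          Metric.closedBall_subset_ball haκ hx⟩
      exact le_of_lt (hκb ⟨this, (htime t ht).1, hball hx⟩)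
    · rw [Real.coe_toNNReal a ha0.le, Real.coe_toNNReal B hB0.le]
      simp only [add_sub_cancel_left, sub_self, NNReal.coe_zero, sub_zero]
      rw [max_eq_left hε0.le]
      calc B * ε ≤ B * (a / B) := by gcongr; exact min_le_right _ _
        _ = a := by field_simp
  obtain ⟨w, hw0, hw⟩ := hPL.exists_eq_forall_mem_Icc_hasDerivWithinAt₀
  have hw0 : w t₀ = w₀ := hw0
  have hcont : ContinuousWithinAt w (Icc t₀ (t₀ + ε)) t₀ :=
    (hw t₀ ⟨le_rfl, by linarith⟩).continuousWithinAt
  have hin : ∀ᶠ t in 𝓝[≥] t₀, w t ∈ N := by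
    have h1 := hcont.mono_of_mem_nhdsWithin
      (Icc_mem_nhdsGE (lt_add_of_pos_right t₀ hε0))
    exact h1.eventually_mem (hN.mem_nhds (hw0 ▸ hw₀))
  obtain ⟨γ, hγ, hγsub⟩ := mem_nhdsGE_iff_exists_Icc_subset.1
    (inter_mem hin (Icc_mem_nhdsGE (lt_add_of_pos_right t₀ hε0)))
  exact ⟨γ, hγ, w, fun t ht => ⟨(hγsub ht).1,
    (hw t (hγsub ht).2).mono fun s hs => (hγsub hs).2⟩, hw0⟩

/-- The union of all solutions of an initial value problem is the maximal solution. -/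
theorem exists_maximal_solution (hN : IsOpen N)
    (hg : ContinuousOn (fun p : ℝ × F => g p.1 p.2) (Ici 0 ×ˢ N))
    (hlip : LocallyLipschitzSnd g N) {t₀ : ℝ} (ht₀ : 0 ≤ t₀) {w₀ : F} (hw₀ : w₀ ∈ N) :
    ∃ (T : EReal) (w : ℝ → F), (t₀ : EReal) < T ∧ SolvesODE g N (rightInterval t₀ T) w ∧
      w t₀ = w₀ ∧ ∀ J : Set ℝ, J.OrdConnected → IsLeast J t₀ → ∀ v, SolvesODE g N J v →
        v t₀ = w₀ → J ⊆ rightInterval t₀ T ∧ EqOn v w J := by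
  -- the times up to which some solution exists
  let 𝒯 : Set ℝ := {T | ∃ w, SolvesODE g N (Icc t₀ T) w ∧ w t₀ = w₀}
  let T : EReal := sSup ((↑) '' 𝒯)
  have hlt : ∀ t : ℝ, (t : EReal) < T → ∃ τ ∈ 𝒯, t < τ := by
    intro t ht
    obtain ⟨_, ⟨τ, hτ, rfl⟩, h⟩ := lt_sSup_iff.1 ht
    exact ⟨τ, hτ, EReal.coe_lt_coe_iff.1 h⟩
  have hlt' : ∀ t : ℝ, ∀ τ ∈ 𝒯, t < τ → (t : EReal) < T := fun t τ hτ h =>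
    lt_sSup_iff.2 ⟨_, ⟨τ, hτ, rfl⟩, EReal.coe_lt_coe_iff.2 h⟩
  have ht₀T : (t₀ : EReal) < T := by
    obtain ⟨γ, hγ, w, hw, hw0⟩ := exists_local_solution hN hg hlip ht₀ hw₀
    exact hlt' t₀ γ ⟨w, hw, hw0⟩ hγ
  have hex : ∀ t : ℝ, ∃ τ : ℝ, ∃ w : ℝ → F, (t : EReal) < T →
      t < τ ∧ SolvesODE g N (Icc t₀ τ) w ∧ w t₀ = w₀ := by
    intro t
    by_cases h : (t : EReal) < T
    · obtain ⟨τ, ⟨w, hw⟩, hτ⟩ := hlt t h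
      exact ⟨τ, w, fun _ => ⟨hτ, hw⟩⟩
    · exact ⟨0, 0, fun h' => absurd h' h⟩
  choose τ u hu using hex
  let w : ℝ → F := fun t => u t t
  have hagree : ∀ J : Set ℝ, J.OrdConnected → IsLeast J t₀ → ∀ v, SolvesODE g N J v →
      v t₀ = w₀ → ∀ t ∈ J, (t : EReal) < T → v t = w t := by
    intro J hJ hJ0 v hv hv0 t ht htT
    obtain ⟨h1, h2, h3⟩ := hu t htT
    exact SolvesODE.eqOn_Icc hlip ht₀ (hv.mono (hJ.out hJ0.1 ht))
      (h2.mono (Icc_subset_Icc_right h1.le)) (hv0.trans h3.symm) ⟨hJ0.2 ht, le_rfl⟩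
  refine ⟨T, w, ht₀T, ?_, (hu t₀ ht₀T).2.2, ?_⟩
  · rintro t ⟨ht, htT⟩
    obtain ⟨h1, h2, h3⟩ := hu t htT
    have hτmem : τ t ∈ 𝒯 := ⟨u t, h2, h3⟩
    have heq : ∀ s ∈ Ico t₀ (τ t), w s = u t s := fun s hs =>
      (hagree (Icc t₀ (τ t)) ordConnected_Icc (isLeast_Icc (ht.trans h1.le)) (u t) h2 h3 s
        (Ico_subset_Icc_self hs) (hlt' s _ hτmem hs.2)).symm
    have htm : t ∈ Icc t₀ (τ t) := ⟨ht, h1.le⟩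
    refine ⟨(h2 t htm).1, ?_⟩
    have h4 : HasDerivWithinAt w (g t (w t)) (Ico t₀ (τ t)) t :=
      ((h2 t htm).2.mono Ico_subset_Icc_self).congr heq rfl
    refine h4.mono_of_mem_nhdsWithin ?_
    filter_upwards [self_mem_nhdsWithin, mem_nhdsWithin_of_mem_nhds (Iio_mem_nhds h1)]
      with s hs1 hs2 using ⟨hs1.1, hs2⟩
  · intro J hJ hJ0 v hv hv0
    have hsub : J ⊆ rightInterval t₀ T := by
      intro t ht
      have htt : t₀ ≤ t := hJ0.2 ht
      -- a solution on `[t₀, t]` continues beyond `t`, so that `t < T`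
      obtain ⟨γ, hγ, y, hy, hy0⟩ := exists_local_solution hN hg hlip (ht₀.trans htt) (hv t ht).1
      refine ⟨htt, hlt' t γ ⟨_, (hv.mono (hJ.out hJ0.1 ht)).glue htt hγ hy hy0, ?_⟩ hγ⟩
      simpa [htt] using hv0
    exact ⟨hsub, fun t ht => hagree J hJ hJ0 v hv hv0 t ht (hsub ht).2⟩

/-- A solution on `(0, ∞)` of a linear equation with a bounded operator and a forcing term that is
continuous up to `0` has a limit at `0`; the factor `exp (t K)` turns the equation into an
integration. -/
lemma exists_tendsto_of_linear (K : F →L[ℝ] F) {h w : ℝ → F} (hh : ContinuousOn h (Ici 0))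
    (hw : ∀ t, 0 < t → HasDerivAt w (h t - K (w t)) t) :
    ∃ w₀, Tendsto w (𝓝[>] 0) (𝓝 w₀) := by
  let E : ℝ → F →L[ℝ] F := fun t => NormedSpace.exp (t • K)
  have hE : ∀ t, HasDerivAt E (E t * K) t := fun t => hasDerivAt_exp_smul_const K t
  have hEc : Continuous E := continuous_iff_continuousAt.2 fun t => (hE t).continuousAt
  let h' : ℝ → F := fun t => h (max t 0)
  have hh' : Continuous h' := hh.comp_continuous (by fun_prop) fun t => le_max_right t 0
  let H : ℝ → F := fun t => ∫ s in (0 : ℝ)..t, E s (h' s)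
  have hH : ∀ t, HasDerivAt H (E t (h' t)) t := fun t =>
    intervalIntegral.integral_hasDerivAt_right
      ((hEc.clm_apply hh').intervalIntegrable _ _)
      ((hEc.clm_apply hh').stronglyMeasurableAtFilter _ _) (hEc.clm_apply hh').continuousAt
  -- `(exp (t K) w)' = exp (t K) h`
  have hconst : ∀ t ∈ Ioi (0 : ℝ), E t (w t) - H t = E 1 (w 1) - H 1 := by
    intro t ht
    have hd : ∀ s ∈ Ioi (0 : ℝ), HasDerivAt (fun s => E s (w s) - H s) 0 s := by
      intro s hs
      have hs : 0 < s := hs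
      have h1 := ((hE s).clm_apply (hw s hs)).sub (hH s)
      have h2 : (E s * K) (w s) + E s (h s - K (w s)) - E s (h' s) = 0 := by
        simp [h', max_eq_left hs.le]
      rwa [h2] at h1
    refine isOpen_Ioi.is_const_of_deriv_eq_zero (convex_Ioi 0).isPreconnected
      (fun s hs => (hd s hs).differentiableAt.differentiableWithinAt)
      (fun s hs => (hd s hs).deriv) ht (mem_Ioi.2 one_pos)
  let E' : ℝ → F →L[ℝ] F := fun t => NormedSpace.exp (-(t • K))
  have hE'c : Continuous E' := by
    have : E' = fun t => E (-t) := by ext t; simp [E', E]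
    rw [this]; exact hEc.comp continuous_neg
  have hinv : ∀ t x, E' t (E t x) = x := by
    intro t x
    let : NormedAlgebra ℚ (F →L[ℝ] F) := .restrictScalars ℚ ℝ _
    have h1 : E' t * E t = 1 := by
      simp only [E', E]
      rw [← NormedSpace.exp_add_of_commute, neg_add_cancel, NormedSpace.exp_zero]
      exact (Commute.refl _).neg_left
    exact congrArg (fun A : F →L[ℝ] F => A x) h1
  have hHc : Continuous H := continuous_iff_continuousAt.2 fun t => (hH t).continuousAt
  let k : ℝ → F := fun t => E' t (E 1 (w 1) - H 1 + H t)
  have hk : Continuous k := hE'c.clm_apply (by fun_prop)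
  refine ⟨k 0, ((hk.tendsto 0).mono_left nhdsWithin_le_nhds).congr' ?_⟩
  filter_upwards [self_mem_nhdsWithin] with t ht
  simp only [k]
  rw [← hconst t ht, sub_add_cancel, hinv]

end ODE

end ADAE

namespace ADAE

/-! ### The bounded inverse of `Ã` -/

section Resolvent

variable {𝕜 D Y : Type*} [RCLike 𝕜]
  [NormedAddCommGroup D] [NormedSpace 𝕜 D] [NormedAddCommGroup Y] [NormedSpace 𝕜 Y]
  {a b : D →ₗ[𝕜] Y} {ν n : ℕ}

/-- At real points the complexified resolvent of a real pencil restricts to the real one. -/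
lemma HasResolventGrowth.exists_real_resolvent {k : ℕ} (h : HasResolventGrowth a b k) :
    ∃ r > (0 : ℝ), ∀ s : ℝ, r ≤ s → ∃ R : Y →L[𝕜] D, IsResolvent a b (s : 𝕜) R := by
  by_cases hI : RCLike.I = (0 : 𝕜)
  · obtain ⟨c, -, r, hr, H⟩ := h.1 hI
    refine ⟨r, hr, fun s hs => ?_⟩
    have hs0 : 0 ≤ s := hr.le.trans hs
    obtain ⟨R, ⟨h1, h2⟩, -⟩ := H (s : ℂ) (by simpa [abs_of_nonneg hs0] using hs)
    refine ⟨(ContinuousLinearMap.fst 𝕜 D D).comp (R.comp (ContinuousLinearMap.inl 𝕜 Y Y)),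
      fun y => ?_, fun x => ?_⟩
    · have := congrArg Prod.fst (h1 (y, 0))
      simpa [complexifiedPencil] using this
    · have := congrArg Prod.fst (h2 (x, 0))
      simpa [complexifiedPencil] using this
  · obtain ⟨c, -, r, hr, H⟩ := h.2 hI
    refine ⟨r, hr, fun s hs => ?_⟩
    have hs0 : 0 ≤ s := hr.le.trans hs
    obtain ⟨R, hR, -⟩ := H (s : 𝕜) (by simpa [abs_of_nonneg hs0] using hs)
    exact ⟨R, hR⟩

namespace CanonicalSystem

variable (C : CanonicalSystem a b ν n)

lemma aTilde_apply (x : D) :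
    C.aTilde x = a x + ∑ i, C.q i 1 (b x) • b (C.φ i (C.m i)) := by
  simp [aTilde, LinearMap.sum_apply]

lemma aTilde_P1 (x : D) : C.aTilde (C.P1 x) = a (C.P1 x) := by
  rw [aTilde_apply, Finset.sum_eq_zero, add_zero]
  intro i _
  have h := C.q_projY (fun _ _ => True) (b (C.P1 x)) (k := i) (l := 0) (C.one_le_m i)
  rw [← b_projD, projD_P1] at h
  simp only [map_zero, if_true, zero_add] at h
  rw [← h, zero_smul]

lemma q_last_aTilde (k : Fin n) (x : D) : C.q k (C.m k) (C.aTilde x) = C.q k 1 (b x) := by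
  rw [aTilde_apply, map_add, C.dual_eigen, zero_add, map_sum, Finset.sum_eq_single k]
  · rw [map_smul, C.biorthogonal k _ k _ (C.one_le_m k) le_rfl (C.one_le_m k) le_rfl]
    simp
  · intro i _ hik
    rw [map_smul, C.biorthogonal i _ k _ (C.one_le_m i) le_rfl (C.one_le_m k) le_rfl,
      if_neg (by tauto), smul_zero]
  · simp

lemma q_b_eigenvectors (c : Fin n → 𝕜) (k : Fin n) :
    C.q k 1 (b (∑ i, c i • C.φ i 1)) = c k := by
  simp only [map_sum, map_smul]
  rw [Finset.sum_eq_single k]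
  · rw [C.biorthogonal k 1 k 1 le_rfl (C.one_le_m k) le_rfl (C.one_le_m k)]; simp
  · intro i _ hik
    rw [C.biorthogonal i 1 k 1 le_rfl (C.one_le_m i) le_rfl (C.one_le_m k), if_neg (by tauto),
      smul_zero]
  · simp

lemma aTilde_injective : Function.Injective C.aTilde := by
  rw [← LinearMap.ker_eq_bot, LinearMap.ker_eq_bot']
  intro x hx
  have h1 : ∀ k, C.q k 1 (b x) = 0 := fun k => by rw [← q_last_aTilde, hx, map_zero]
  have h2 : x ∈ LinearMap.ker a := by
    rw [aTilde_apply] at hx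
    simpa [h1] using hx
  rw [← C.span_eigenvectors, Submodule.mem_span_range_iff_exists_fun] at h2
  obtain ⟨c, rfl⟩ := h2
  refine Finset.sum_eq_zero fun i _ => ?_
  rw [← C.q_b_eigenvectors c i, h1, zero_smul]

lemma a_eigenvectors (c : Fin n → 𝕜) : a (∑ i, c i • C.φ i 1) = 0 := by
  simp [map_sum, a_eigenvector]

lemma mem_range_aTilde {y : Y} : y ∈ LinearMap.range C.aTilde ↔
    y - ∑ i, C.q i (C.m i) y • b (C.φ i (C.m i)) ∈ LinearMap.range a := by
  constructor
  · rintro ⟨x, rfl⟩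
    refine ⟨x, ?_⟩
    simp only [q_last_aTilde]
    rw [aTilde_apply, add_sub_cancel_right]
  · rintro ⟨x, hx⟩
    refine ⟨x + ∑ i, (C.q i (C.m i) y - C.q i 1 (b x)) • C.φ i 1, ?_⟩
    rw [aTilde_apply]
    simp only [map_add a, map_add b, map_add (C.q _ _), a_eigenvectors, C.q_b_eigenvectors
      (fun i => C.q i (C.m i) y - C.q i 1 (b x)), add_zero, hx]
    simp

lemma isClosed_range_aTilde (hrange : IsClosed (LinearMap.range a : Set Y)) :
    IsClosed (LinearMap.range C.aTilde : Set Y) := by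
  have h : Continuous fun y : Y => y - ∑ i, C.q i (C.m i) y • b (C.φ i (C.m i)) := by fun_prop
  convert hrange.preimage h using 1
  ext y
  exact C.mem_range_aTilde

lemma aTilde_eigenvector (i : Fin n) : C.aTilde (C.φ i 1) = b (C.φ i (C.m i)) := by
  classical
  rw [aTilde_apply, a_eigenvector, zero_add, Finset.sum_eq_single i]
  · rw [C.biorthogonal i 1 i 1 le_rfl (C.one_le_m i) le_rfl (C.one_le_m i)]; simp
  · intro k _ hik
    rw [C.biorthogonal i 1 k 1 le_rfl (C.one_le_m i) le_rfl (C.one_le_m k),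
      if_neg (by tauto), zero_smul]
  · simp

lemma aTilde_root {i : Fin n} {j : ℕ} (hj : 2 ≤ j) (hjm : j ≤ C.m i) :
    C.aTilde (C.φ i j) = -b (C.φ i (j - 1)) := by
  rw [aTilde_apply, C.chain i j hj hjm, Finset.sum_eq_zero, add_zero]
  intro k _
  rw [C.biorthogonal i j k 1 (by omega) hjm le_rfl (C.one_le_m k), if_neg (by omega), zero_smul]

lemma projY_mem_range_aTilde (p : Fin n → ℕ → Prop) (y : Y) :
    C.projY p y ∈ LinearMap.range C.aTilde := by
  rw [projY_apply]
  refine Submodule.sum_mem _ fun i _ => Submodule.sum_mem _ fun r hr => ?_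
  have hr' := Finset.mem_range.1 hr
  split_ifs
  · refine Submodule.smul_mem _ _ ?_
    by_cases h : r + 1 = C.m i
    · exact ⟨C.φ i 1, by rw [aTilde_eigenvector, h]⟩
    · refine ⟨-C.φ i (r + 2), ?_⟩
      rw [map_neg, C.aTilde_root (by omega) (by omega), neg_neg]
      rfl
  · exact Submodule.zero_mem _

variable [CompleteSpace Y]

/-- `Ã` has a bounded inverse, and `b` is bounded relative to `Ã`. Surjectivity: on `Y₁` the
vectors `s (s a + b)⁻¹ y` are mapped by `a` to approximations of `y` as `s → ∞`, since `b` is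
bounded relative to `Ã`, and the range of `Ã` is closed. -/
theorem exists_aTilde_inverse (hν : IsRegularPencilOfIndex a b ν)
    (hrange : IsClosed (LinearMap.range a : Set Y))
    (hca : ∀ R : Y →L[𝕜] D, Continuous fun y => a (R y))
    (hcb : ∀ R : Y →L[𝕜] D, Continuous fun y => b (R y)) :
    ∃ E : Y →L[𝕜] D, (∀ y, C.aTilde (E y) = y) ∧ ∀ x, E (C.aTilde x) = x := by
  rcases hν with ⟨-, hgrowth, -⟩ | ⟨rfl, R, h1, h2⟩
  · obtain ⟨r, hr, hres⟩ := hgrowth.exists_real_resolvent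
    obtain ⟨R₀, hR₀, hR₀'⟩ := hres r le_rfl
    -- `S = Ã (r a + b)⁻¹` is bounded, injective and has the closed range of `Ã`
    let S : Y →L[𝕜] Y :=
      { toLinearMap := C.aTilde ∘ₗ (R₀ : Y →ₗ[𝕜] D)
        cont := by
          have h1 := hca R₀
          have h2 := hcb R₀
          have : Continuous fun y => C.aTilde (R₀ y) := by
            simp only [aTilde_apply]
            exact h1.add (continuous_finsetSum _ fun i _ =>
              ((C.q i 1).continuous.comp h2).smul continuous_const)
          exact this }
    have hS : ∀ y, S y = C.aTilde (R₀ y) := fun y => rfl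
    let BR : Y →L[𝕜] Y := { toLinearMap := b ∘ₗ (R₀ : Y →ₗ[𝕜] D), cont := hcb R₀ }
    have hBR : ∀ y, BR y = b (R₀ y) := fun y => rfl
    have hSinj : Function.Injective S := by
      intro y y' h
      have h' : R₀ y = R₀ y' := C.aTilde_injective h
      rw [← hR₀ y, ← hR₀ y', h']
    have hSrange : Set.range S = LinearMap.range C.aTilde := by
      ext y
      constructor
      · rintro ⟨z, rfl⟩; exact ⟨R₀ z, rfl⟩
      · rintro ⟨x, rfl⟩; exact ⟨_, by rw [hS, hR₀' x]⟩
    have hclosed : IsClosed (LinearMap.range C.aTilde : Set Y) := C.isClosed_range_aTilde hrange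
    obtain ⟨K, hK⟩ := S.antilipschitz_of_injective_of_isClosed_range hSinj
      (by rw [hSrange]; exact hclosed)
    obtain ⟨c, hc0, hc⟩ : ∃ c : ℝ, 0 ≤ c ∧ ∀ x, ‖b x‖ ≤ c * ‖C.aTilde x‖ := by
      refine ⟨‖BR‖ * K, by positivity, fun x => ?_⟩
      set y := (r : 𝕜) • a x + b x
      have hx : R₀ y = x := hR₀' x
      have h1 : ‖y‖ ≤ K * ‖C.aTilde x‖ := by
        have := hK.le_mul_dist y 0
        simpa [hS, hx] using this
      calc ‖b x‖ = ‖BR y‖ := by rw [hBR, hx]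
        _ ≤ ‖BR‖ * ‖y‖ := BR.le_opNorm y
        _ ≤ ‖BR‖ * (K * ‖C.aTilde x‖) := by gcongr
        _ = _ := by ring
    have hY1 : ∀ y, C.Q1 y ∈ LinearMap.range C.aTilde := by
      intro y'
      set y := C.Q1 y' with hy
      have happrox : ∀ s : ℝ, r ≤ s → 2 * c ≤ s →
          ∃ x, ‖C.aTilde x - y‖ ≤ 2 * c * ‖y‖ / s := by
        intro s hs hcs
        have hs0 : 0 < s := hr.trans_le hs
        obtain ⟨R, hR, hR'⟩ := hres s hs
        -- the resolvent commutes with the projectors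
        have hP : C.P1 (R y) = R y := by
          have h0 : (s : 𝕜) • a (C.projD (fun _ _ => True) (R y))
              + b (C.projD (fun _ _ => True) (R y)) = 0 := by
            rw [← C.projY_a (p := fun _ _ => True) (fun _ _ _ => Iff.rfl), b_projD, ← map_smul,
              ← map_add, hR, hy, projY_Q1]
          have h1 := hR' (C.projD (fun _ _ => True) (R y))
          rw [h0, map_zero] at h1
          rw [P1_apply, ← h1, sub_zero]
        set x := (s : 𝕜) • R y with hx
        have hxa : C.aTilde x = (s : 𝕜) • a (R y) := by
          rw [hx, map_smul, ← hP, aTilde_P1]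
        have hdiff : ‖C.aTilde x - y‖ = s⁻¹ * ‖b x‖ := by
          have h1 : C.aTilde x - y = -b (R y) := by
            rw [hxa]; nth_rw 2 [← hR y]; abel
          rw [h1, norm_neg, hx, map_smul, norm_smul, RCLike.norm_ofReal, abs_of_pos hs0]
          field_simp
        have h3 : ‖C.aTilde x - y‖ ≤ s⁻¹ * (c * ‖C.aTilde x‖) := by
          rw [hdiff]; gcongr; exact hc x
        have h4 : ‖C.aTilde x‖ ≤ ‖y‖ + ‖C.aTilde x - y‖ := by
          have := norm_add_le y (C.aTilde x - y)
          simpa using this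
        have h5 : s⁻¹ * c ≤ 1 / 2 := by
          rw [inv_mul_eq_div, div_le_div_iff₀ hs0 (by norm_num)]; linarith
        have h6 : ‖C.aTilde x‖ ≤ 2 * ‖y‖ := by
          have : s⁻¹ * (c * ‖C.aTilde x‖) ≤ 1 / 2 * ‖C.aTilde x‖ := by
            rw [← mul_assoc]; gcongr
          linarith
        refine ⟨x, h3.trans ?_⟩
        calc s⁻¹ * (c * ‖C.aTilde x‖) ≤ s⁻¹ * (c * (2 * ‖y‖)) := by gcongr
          _ = 2 * c * ‖y‖ / s := by rw [div_eq_inv_mul]; ring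
      have hmem : y ∈ closure (LinearMap.range C.aTilde : Set Y) := by
        rw [Metric.mem_closure_iff]
        intro ε hε
        have hlim : Tendsto (fun s : ℝ => 2 * c * ‖y‖ / s) atTop (𝓝 0) :=
          tendsto_const_nhds.div_atTop tendsto_id
        obtain ⟨s, ⟨h1, h2⟩, h3⟩ := ((eventually_ge_atTop r).and (eventually_ge_atTop (2 * c))).and
          (hlim.eventually_lt_const hε) |>.exists
        obtain ⟨x, hx⟩ := happrox s h1 h2
        exact ⟨C.aTilde x, ⟨x, rfl⟩, by rw [dist_comm, dist_eq_norm]; exact hx.trans_lt h3⟩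
      rwa [hclosed.closure_eq] at hmem
    have hsurj : Function.Surjective C.aTilde := by
      rw [← LinearMap.range_eq_top, eq_top_iff]
      intro y _
      have : y = C.Q1 y + C.projY (fun _ _ => True) y := by rw [Q1_apply, sub_add_cancel]
      rw [this]
      exact Submodule.add_mem _ (hY1 y) (C.projY_mem_range_aTilde _ _)
    have hSsurj : Function.Surjective S := by
      rw [← Set.range_eq_univ, hSrange, LinearMap.range_eq_top.2 hsurj]; rfl
    let e := ContinuousLinearEquiv.ofBijective S (LinearMap.ker_eq_bot.2 hSinj)
      (LinearMap.range_eq_top.2 hSsurj)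
    have he : ∀ y, C.aTilde (R₀ (e.symm y)) = y := fun y =>
      ContinuousLinearEquiv.ofBijective_apply_symm_apply S _ _ y
    exact ⟨R₀.comp (e.symm : Y →L[𝕜] Y), he, fun x => C.aTilde_injective (he _)⟩
  -- for `ν = 0` there are no chains
  · have hn : ∀ i : Fin n, False := fun i => by
      have := C.one_le_m i; have := C.m_le i; omega
    have hA : ∀ x, C.aTilde x = a x := fun x => by
      rw [aTilde_apply, Finset.sum_eq_zero fun i _ => (hn i).elim, add_zero]
    exact ⟨R, fun y => by rw [hA, h1], fun x => by rw [hA, h2]⟩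

end CanonicalSystem

end Resolvent

section ClosedOperators

variable {𝕜 X Y : Type*} [RCLike 𝕜]
  [NormedAddCommGroup X] [NormedSpace 𝕜 X]
  [NormedAddCommGroup Y] [NormedSpace 𝕜 Y] [CompleteSpace Y]

/-- By the closed graph theorem a closed operator composed with a bounded one is bounded. -/
lemma continuous_closed_comp {A : X →ₗ.[𝕜] Y} (hA : A.IsClosed) {S : Submodule 𝕜 X}
    (hS : S ≤ A.domain) (R : Y →L[𝕜] S) :
    Continuous fun y => (A.toFun ∘ₗ Submodule.inclusion hS) (R y) := by
  let g : Y →ₗ[𝕜] Y := (A.toFun ∘ₗ Submodule.inclusion hS) ∘ₗ (R : Y →ₗ[𝕜] S)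
  refine g.continuous_of_seq_closed_graph fun u x y hu hgu => ?_
  have hR : Tendsto (fun k => (R (u k) : X)) atTop (𝓝 (R x : X)) :=
    ((continuous_subtype_val.comp R.continuous).tendsto x).comp hu
  have hmem : ((R x : X), y) ∈ (A.graph : Set (X × Y)) := by
    refine IsClosed.mem_of_tendsto hA (hR.prodMk_nhds hgu) (Eventually.of_forall fun k => ?_)
    exact A.mem_graph (Submodule.inclusion hS (R (u k)))
  exact A.mem_graph_snd_inj hmem (A.mem_graph (Submodule.inclusion hS (R x))) rfl

end ClosedOperators

end ADAE

namespace ADAE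

/-! ### The curves determined by the constraints of positive order -/

section Recursion

/-- Downward recursion in `s = m, …, 1` for a family `u s` that is to satisfy a condition `P s`
depending on the members of higher index. -/
lemma exists_downward_family {α : ℕ → Type*} [∀ j, Nonempty (α j)] (m : ℕ)
    (P : ∀ s, (∀ j, α j) → α s → Prop)
    (hdep : ∀ s, 1 ≤ s → s ≤ m → ∀ u u' : ∀ j, α j, (∀ j, s < j → j ≤ m → u j = u' j) →
      ∀ z, P s u z → P s u' z)
    (hstep : ∀ s, 1 ≤ s → s ≤ m → ∀ u : ∀ j, α j, (∀ j, s < j → j ≤ m → P j u (u j)) →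
      ∃ z, P s u z) :
    ∃ u : ∀ j, α j, ∀ s, 1 ≤ s → s ≤ m → P s u (u s) := by
  have key : ∀ k, ∃ u : ∀ j, α j, ∀ s, 1 ≤ s → s ≤ m → m < s + k → P s u (u s) := by
    intro k
    induction k with
    | zero => exact ⟨fun j => Classical.arbitrary _, fun s _ _ _ => by omega⟩
    | succ k ih =>
      obtain ⟨u, hu⟩ := ih
      by_cases hk : 1 ≤ m - k
      · obtain ⟨z, hz⟩ := hstep (m - k) hk (by omega) u
          fun j hj hjm => hu j (by omega) hjm (by omega)
        refine ⟨Function.update u (m - k) z, fun s hs hsm hsk => ?_⟩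
        rcases eq_or_ne s (m - k) with rfl | hne
        · rw [Function.update_self]
          refine hdep _ hs hsm u _ (fun j hj _ => ?_) z hz
          rw [Function.update_of_ne (by omega)]
        · rw [Function.update_of_ne hne]
          refine hdep _ hs hsm u _ (fun j hj _ => ?_) _ (hu s hs hsm (by omega))
          rw [Function.update_of_ne (by omega)]
      · exact ⟨u, fun s hs hsm hsk => hu s hs hsm (by omega)⟩
  obtain ⟨u, hu⟩ := key m
  exact ⟨u, fun s hs hsm => hu s hs hsm (by omega)⟩

lemma sum_Icc_eq_add {M : Type*} [AddCommMonoid M] (g : ℕ → M) {s m : ℕ} (h : s ≤ m) :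
    ∑ j ∈ Finset.Icc s m, g j = g s + ∑ j ∈ Finset.Icc (s + 1) m, g j := by
  rw [Finset.Icc_eq_cons_Ioc h, Finset.sum_cons]
  congr 2
  ext j
  simp only [Finset.mem_Ioc, Finset.mem_Icc]
  omega

end Recursion

section FiniteDimensional

variable {𝕜 D Y : Type*} [RCLike 𝕜]
  [NormedAddCommGroup D] [NormedSpace 𝕜 D] [NormedAddCommGroup Y] [NormedSpace 𝕜 Y]
  [NormedSpace ℝ D] [IsScalarTower ℝ 𝕜 D] [NormedSpace ℝ Y] [IsScalarTower ℝ 𝕜 Y]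

lemma contDiffOn_of_coe {V : Type*} [NormedAddCommGroup V] [NormedSpace ℝ V]
    (S : Submodule 𝕜 D) [FiniteDimensional 𝕜 S] {k : ℕ} {g : V → S} {s : Set V}
    (h : ContDiffOn ℝ k (fun v => (g v : D)) s) : ContDiffOn ℝ k g s := by
  obtain ⟨p, hp⟩ := Submodule.ClosedComplemented.of_finiteDimensional S
  have h1 : ContDiffOn ℝ k (fun v => (p.restrictScalars ℝ) (g v : D)) s :=
    (p.restrictScalars ℝ).contDiff.comp_contDiffOn h
  exact h1.congr fun v _ => (hp (g v)).symm

lemma contDiffOn_coe {V : Type*} [NormedAddCommGroup V] [NormedSpace ℝ V]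
    {S : Submodule 𝕜 D} {k : ℕ} {g : V → S} {s : Set V} (h : ContDiffOn ℝ k g s) :
    ContDiffOn ℝ k (fun v => (g v : D)) s :=
  (S.subtypeL.restrictScalars ℝ).contDiff.comp_contDiffOn h

/-- If a curve `c` depends smoothly on time and a variable, then so does `g(t, c)`. -/
lemma SmoothOn.comp_coe {Z : Type*} [NormedAddCommGroup Z] [NormedSpace ℝ Z] {k : ℕ}
    {E : Submodule 𝕜 D} [FiniteDimensional 𝕜 E] {S : Set D}
    {g : ℝ → D → Z} (hg : SmoothOn k E S g) {V : Type*} [NormedAddCommGroup V] [NormedSpace ℝ V]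
    {T : Set V} {c : ℝ × V → D} (hc : ContDiffOn ℝ k c (Ici 0 ×ˢ T)) (hcE : ∀ p, c p ∈ E)
    (hcS : ∀ p ∈ Ici (0 : ℝ) ×ˢ T, c p ∈ S) :
    ContDiffOn ℝ k (fun p => g p.1 (c p)) (Ici 0 ×ˢ T) := by
  have h1 : ContDiffOn ℝ k (fun p : ℝ × V => (⟨c p, hcE p⟩ : E)) (Ici 0 ×ˢ T) :=
    contDiffOn_of_coe E hc
  exact ContDiffOn.comp hg (contDiffOn_fst.prodMk h1) fun p hp => ⟨hp.1, hcS p hp⟩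

/-- A linear operator on `D`, restricted to a finite-dimensional subspace. -/
def restrictFinite (T : D →ₗ[𝕜] Y) (S : Submodule 𝕜 D) [FiniteDimensional 𝕜 S] : S →L[ℝ] Y :=
  (LinearMap.toContinuousLinearMap (T ∘ₗ S.subtype)).restrictScalars ℝ

/-- A bounded operator with values in its range. -/
def toRange (Q : Y →L[𝕜] Y) : Y →L[ℝ] LinearMap.range (Q : Y →ₗ[𝕜] Y) :=
  (Q.codRestrict (LinearMap.range (Q : Y →ₗ[𝕜] Y)) fun y => ⟨y, rfl⟩).restrictScalars ℝ

@[simp]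
lemma coe_toRange (Q : Y →L[𝕜] Y) (y : Y) : (toRange Q y : Y) = Q y := rfl

/-- The implicit function theorem for an equation whose values lie in the range of a
projection `Q`. -/
lemma exists_contDiffOn_implicit {E : Submodule 𝕜 D} [FiniteDimensional 𝕜 E] {Q : Y →L[𝕜] Y}
    {S : Set E} (hS : IsOpen S) {G : ℝ × E → Y} {k : ℕ} (hk : 1 ≤ k)
    (hG : ContDiffOn ℝ k G (Ici 0 ×ˢ S)) (hGQ : ∀ p, Q (G p) = G p) (hQ : ∀ y, Q (Q y) = Q y)
    (hex : ∀ t, 0 ≤ t → ∃! z, z ∈ S ∧ G (t, z) = 0)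
    (hinv : ∀ t, 0 ≤ t → ∀ z ∈ S, G (t, z) = 0 →
      HasInvertibleDerivAt E (LinearMap.range (Q : Y →ₗ[𝕜] Y)) (fun y => G (t, y)) z) :
    ∃ z : ℝ → E, (∀ t, 0 ≤ t → z t ∈ S ∧ G (t, z t) = 0) ∧ ContDiffOn ℝ k z (Ici 0) := by
  have : CompleteSpace E := FiniteDimensional.complete 𝕜 E
  have hex' : ∀ t : ℝ, ∃ z : E, 0 ≤ t → (z ∈ S ∧ G (t, z) = 0) ∧
      ∀ y, y ∈ S ∧ G (t, y) = 0 → y = z := by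
    intro t
    by_cases ht : 0 ≤ t
    · obtain ⟨z, hz⟩ := hex t ht
      exact ⟨z, fun _ => hz⟩
    · exact ⟨0, fun h => absurd h ht⟩
  choose z hz using hex'
  refine ⟨z, fun t ht => (hz t ht).1, ?_⟩
  have hG' : ContDiffOn ℝ k (fun p => toRange Q (G p)) (Ici 0 ×ˢ S) :=
    (toRange Q).contDiff.comp_contDiffOn hG
  have hzero : ∀ p, toRange Q (G p) = 0 ↔ G p = 0 := fun p => by
    rw [← Submodule.coe_eq_zero, coe_toRange, hGQ]
  refine contDiffOn_implicit hk hS hG' (fun t ht => ⟨(hz t ht).1.1, (hzero _).2 (hz t ht).1.2⟩)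
    (fun t ht y hy h0 => (hz t ht).2 y ⟨hy, (hzero _).1 h0⟩) fun t ht => ?_
  obtain ⟨L, hL⟩ := hinv t ht (z t) (hz t ht).1.1 (hz t ht).1.2
  refine ⟨L, ?_⟩
  have h1 := (toRange Q).hasFDerivAt.comp (z t) hL
  have h2 : (L : E →L[ℝ] LinearMap.range (Q : Y →ₗ[𝕜] Y)) = (toRange Q).comp
      (((LinearMap.range (Q : Y →ₗ[𝕜] Y)).subtypeL.restrictScalars ℝ).comp
        (L : E →L[ℝ] LinearMap.range (Q : Y →ₗ[𝕜] Y))) := by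
    refine ContinuousLinearMap.ext fun x => Subtype.ext ?_
    obtain ⟨y, hy⟩ := (L x).2
    change (L x : Y) = Q (L x : Y)
    rw [← hy]
    exact (hQ y).symm
  rw [h2]
  exact h1

end FiniteDimensional

namespace CanonicalSystem

section Values

variable {𝕜 D Y : Type*} [RCLike 𝕜]
  [NormedAddCommGroup D] [NormedSpace 𝕜 D] [NormedAddCommGroup Y] [NormedSpace 𝕜 Y]
  {a b : D →ₗ[𝕜] Y} {ν n : ℕ} {C : CanonicalSystem a b ν n} {f : ℝ → D → Y}

lemma FLast_mem (s : ℕ) (t : ℝ) (z : C.DLast s) (u : ∀ j, C.DLast j) :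
    C.Q2j s (s + 1) (C.FLast f s t z u) = C.FLast f s t z u := by
  rw [FLast, map_sub, Q2j_last, projY_projY, ← b_projD, C.mem_DLast.1 z.2]
  simp

lemma DLast_coe_mem_spaceSum {r s j : ℕ} (hj : j ∈ Finset.Icc r (ν - 1)) (x : C.DLast j) :
    (x : D) ∈ C.spaceSum r s :=
  Submodule.mem_sup_left (Submodule.mem_iSup_of_mem j (Submodule.mem_iSup_of_mem hj x.2))

lemma DWedge_coe_mem_spaceSum {r s j : ℕ} (hj : j ∈ Finset.Icc s (ν - 2)) (x : C.DWedge j) :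
    (x : D) ∈ C.spaceSum r s :=
  Submodule.mem_sup_right (Submodule.mem_iSup_of_mem j (Submodule.mem_iSup_of_mem hj x.2))

lemma lastIdx_or_wedgeIdx (s : ℕ) :
    C.projD (fun i r => C.lastIdx s i r ∨ C.wedgeIdx s i r) = C.projD (fun _ r => r = s) := by
  refine C.projD_congr fun i r hr => ?_
  simp only [lastIdx, wedgeIdx]
  omega

lemma projD_add_last_wedge {s : ℕ} (d : C.DLast s) (e : C.DWedge s) :
    C.projD (fun _ r => r = s) ((d : D) + e) = d + e := by
  rw [map_add, C.projD_of_imp (C.mem_DLast.1 d.2) fun i r _ h => h.1,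
    C.projD_of_imp (C.mem_DWedge.1 e.2) fun i r _ h => h.1]

lemma QSigma_a_add (s : ℕ) (d : C.DLast (s + 1)) (e : C.DWedge (s + 1)) :
    C.QSigma s (a ((d : D) + e)) = a ((d : D) + e) := by
  rw [QSigma_eq, C.projY_a (p' := fun _ r => r = s + 1), projD_add_last_wedge]
  intro i r hr
  simp only [wedgeIdx]
  omega

lemma Q20_a_add (d : C.DLast 1) (e : C.DWedge 1) :
    C.Q2 0 (a ((d : D) + e)) = a ((d : D) + e) := by
  rw [Q2_eq, C.projY_a (p' := fun _ r => r = 1), projD_add_last_wedge]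
  intro i r hr
  omega

lemma FSigma_mem (s : ℕ) (t : ℝ) (u : ∀ j, C.DLast j) (z : C.DWedge s) (v : ∀ j, C.DWedge j)
    (d : C.DLast (s + 1)) (e : C.DWedge (s + 1)) :
    C.QSigma s (C.FSigma f s t u z v d e) = C.FSigma f s t u z v d e := by
  rw [FSigma, map_sub, map_sub, QSigma_a_add, QSigma_eq, projY_projY, ← b_projD,
    C.mem_DWedge.1 z.2]
  simp

end Values

variable {𝕜 D Y : Type*} [RCLike 𝕜]
  [NormedAddCommGroup D] [NormedSpace 𝕜 D] [NormedAddCommGroup Y] [NormedSpace 𝕜 Y]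
  [NormedSpace ℝ D] [IsScalarTower ℝ 𝕜 D] [NormedSpace ℝ Y] [IsScalarTower ℝ 𝕜 Y]
  {a b : D →ₗ[𝕜] Y} {ν n : ℕ}

/-- The smoothness, unique solvability, invertibility and contractivity conditions on the
right-hand side `f` relative to the open sets `N`, `M20`, `ML`, `MW`. -/
structure SolvabilityConditions (C : CanonicalSystem a b ν n) (f : ℝ → D → Y) (N : Set C.Y1)
    (M20 : Set C.D20) (ML : ∀ j, Set (C.DLast j)) (MW : ∀ j, Set (C.DWedge j)) : Prop where
  continuousOn : ContinuousOn (fun p : ℝ × D => f p.1 p.2) (Ici 0 ×ˢ univ)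
  triangular : C.HasTriangularStructure f
  isOpen_N : IsOpen N
  isOpen_M20 : IsOpen M20
  isOpen_ML : ∀ j ∈ Finset.Icc 1 (ν - 1), IsOpen (ML j)
  isOpen_MW : ∀ j ∈ Finset.Icc 1 (ν - 2), IsOpen (MW j)
  smoothLast : ∀ s ∈ Finset.Icc 1 (ν - 2),
    SmoothOn (ν - 2) (C.spaceSum s (ν - 1)) (C.setSum ML MW s (ν - 1))
      (fun t x => C.Q2j s (s + 1) (f t x))
  smoothSigma : ∀ s ∈ Finset.Icc 1 (ν - 2),
    SmoothOn s (C.spaceSum 1 s) (C.setSum ML MW 1 s) (fun t x => C.QSigma s (f t x))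
  smoothTop : 2 ≤ ν →
    SmoothOn (ν - 1) (C.spaceSum (ν - 1) (ν - 1)) (C.setSum ML MW (ν - 1) (ν - 1))
      (fun t x => C.Q2 (ν - 1) (f t x))
  solveLast : ∀ s ∈ Finset.Icc 1 (ν - 1), ∀ t, 0 ≤ t → ∀ u : ∀ j, C.DLast j,
    (∀ j ∈ Finset.Icc (s + 1) (ν - 1), u j ∈ ML j) →
    ∃! z, z ∈ ML s ∧ C.FLast f s t z u = 0
  solveSigma : ∀ s ∈ Finset.Icc 1 (ν - 2), ∀ t, 0 ≤ t →
    ∀ (u : ∀ j, C.DLast j) (v : ∀ j, C.DWedge j) (d : C.DLast (s + 1)) (e : C.DWedge (s + 1)),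
    (∀ j ∈ Finset.Icc 1 (ν - 1), u j ∈ ML j) →
    (∀ j ∈ Finset.Icc (s + 1) (ν - 2), v j ∈ MW j) →
    ∃! z, z ∈ MW s ∧ C.FSigma f s t u z v d e = 0
  solve20 : ∀ t, 0 ≤ t → ∀ x1 ∈ C.setM1 N, ∀ xS ∈ C.setMSigma ML MW,
    ∀ (d : C.DLast 1) (e : C.DWedge 1), ∃! x20, x20 ∈ M20 ∧ C.F20 f t x1 x20 xS d e = 0
  invertLast : ∀ s ∈ Finset.Icc 1 (ν - 1), ∀ t, 0 ≤ t → ∀ z ∈ ML s, ∀ u : ∀ j, C.DLast j,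
    (∀ j ∈ Finset.Icc (s + 1) (ν - 1), u j ∈ ML j) → C.FLast f s t z u = 0 →
    HasInvertibleDerivAt (C.DLast s) (C.YLast s) (fun z' => C.FLast f s t z' u) z
  invertSigma : ∀ s ∈ Finset.Icc 1 (ν - 2), ∀ t, 0 ≤ t →
    ∀ (u : ∀ j, C.DLast j), ∀ z ∈ MW s,
    ∀ (v : ∀ j, C.DWedge j) (d : C.DLast (s + 1)) (e : C.DWedge (s + 1)),
    (∀ j ∈ Finset.Icc 1 (ν - 1), u j ∈ ML j) →
    (∀ j ∈ Finset.Icc (s + 1) (ν - 2), v j ∈ MW j) → C.FSigma f s t u z v d e = 0 →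
    HasInvertibleDerivAt (C.DWedge s) (C.YSigma s)
      (fun z' => C.FSigma f s t u z' v d e) z
  lipschitzQ1 : C.LocallyLipschitz120 (C.setM1 N) M20 (C.setMSigma ML MW)
    (fun t x => C.Q1 (f t x))
  lipschitzQ20 : C.LocallyLipschitz120 (C.setM1 N) M20 (C.setMSigma ML MW)
    (fun t x => C.Q2 0 (f t x))
  contractive : ∀ t, 0 ≤ t → ∀ x1 ∈ C.setM1 N, ∀ x20 ∈ M20, ∀ xS ∈ C.setMSigma ML MW,
    ∀ (d : C.DLast 1) (e : C.DWedge 1), C.F20 f t x1 x20 xS d e = 0 →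
    C.ContractiveAt f t x1 x20 xS d e

variable {C : CanonicalSystem a b ν n} {f : ℝ → D → Y} {N : Set C.Y1}
  {M20 : Set C.D20} {ML : ∀ j, Set (C.DLast j)} {MW : ∀ j, Set (C.DWedge j)}

/-- The order of smoothness of the component of order `s` in the chains of length `s + 1`. It is
larger by one for `s = ν - 1`, where that component is the whole component of order `s`. -/
def lastSmoothness (ν s : ℕ) : ℕ := if s = ν - 1 then ν - 1 else ν - 2

lemma SolvabilityConditions.smoothLast' (H : C.SolvabilityConditions f N M20 ML MW) {s : ℕ}
    (hs : s ∈ Finset.Icc 1 (ν - 1)) :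
    SmoothOn (lastSmoothness ν s) (C.spaceSum s (ν - 1)) (C.setSum ML MW s (ν - 1))
      (fun t x => C.Q2j s (s + 1) (f t x)) := by
  rw [Finset.mem_Icc] at hs
  by_cases h : s = ν - 1
  · have h1 := H.smoothTop (by omega)
    have h2 : C.Q2 (ν - 1) = C.Q2j s (s + 1) := by
      rw [Q2_eq, Q2j_last]
      refine C.projY_congr fun i r hr => ?_
      have := C.m_le i
      simp only [lastIdx]
      omega
    subst h
    rw [lastSmoothness, if_pos rfl, ← h2]
    exact h1
  · rw [lastSmoothness, if_neg h]
    exact H.smoothLast s (Finset.mem_Icc.2 ⟨hs.1, by omega⟩)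

/-- Adding the component of order `s` to those of higher order in the chains `DLast`. -/
lemma SolvabilityConditions.exists_last (H : C.SolvabilityConditions f N M20 ML MW) {s : ℕ}
    (hs : s ∈ Finset.Icc 1 (ν - 1)) (u : ∀ j, ℝ → C.DLast j)
    (hu : ∀ j ∈ Finset.Icc (s + 1) (ν - 1), ∀ t, 0 ≤ t → u j t ∈ ML j)
    (hus : ∀ j ∈ Finset.Icc (s + 1) (ν - 1), ContDiffOn ℝ (lastSmoothness ν s) (u j) (Ici 0)) :
    ∃ z : ℝ → C.DLast s,
      (∀ t, 0 ≤ t → z t ∈ ML s ∧ C.FLast f s t (z t) (fun j => u j t) = 0) ∧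
      ContDiffOn ℝ (lastSmoothness ν s) z (Ici 0) := by
  have hs' := Finset.mem_Icc.1 hs
  refine exists_contDiffOn_implicit (Q := C.Q2j s (s + 1)) (H.isOpen_ML s hs)
    (G := fun p => C.FLast f s p.1 p.2 fun j => u j p.1) ?_ ?_
    (fun p => FLast_mem s _ _ _) (fun y => by rw [Q2j_last, projY_projY]; simp)
    (fun t ht => H.solveLast s hs t ht _ fun j hj => hu j hj t ht)
    (fun t ht z hz h0 => H.invertLast s hs t ht z hz _ (fun j hj => hu j hj t ht) h0)
  · rw [lastSmoothness]; split_ifs <;> omega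
  · have hb : ContDiffOn ℝ (lastSmoothness ν s) (fun p : ℝ × C.DLast s => b (p.2 : D))
        (Ici 0 ×ˢ ML s) :=
      ((restrictFinite b (C.DLast s)).contDiff.comp contDiff_snd).contDiffOn
    refine ContDiffOn.sub ?_ hb
    refine SmoothOn.comp_coe (g := fun t x => C.Q2j s (s + 1) (f t x)) (H.smoothLast' hs)
      (c := fun p : ℝ × C.DLast s => (p.2 : D) + ∑ j ∈ Finset.Icc (s + 1) (ν - 1), (u j p.1 : D))
      ?_ ?_ ?_
    · refine (contDiffOn_coe contDiffOn_snd).add (ContDiffOn.sum fun j hj => ?_)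
      exact (contDiffOn_coe (hus j hj)).comp contDiffOn_fst fun p hp => hp.1
    · intro p
      refine Submodule.add_mem _ (DLast_coe_mem_spaceSum (Finset.mem_Icc.2 ⟨le_rfl, hs'.2⟩) _)
        (Submodule.sum_mem _ fun j hj => ?_)
      rw [Finset.mem_Icc] at hj
      exact DLast_coe_mem_spaceSum (Finset.mem_Icc.2 ⟨by omega, hj.2⟩) _
    · rintro ⟨t, y⟩ ⟨ht, hy⟩
      refine ⟨Function.update (fun j => u j t) s y, fun _ => 0, fun j hj => ?_, fun j hj => ?_, ?_⟩
      · rw [Finset.mem_Icc] at hj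
        rcases eq_or_ne j s with rfl | hne
        · rw [Function.update_self]; exact hy
        · rw [Function.update_of_ne hne]
          exact hu j (Finset.mem_Icc.2 ⟨by omega, hj.2⟩) t ht
      · rw [Finset.mem_Icc] at hj; omega
      · rw [sum_Icc_eq_add _ hs'.2, Function.update_self]
        simp only [ZeroMemClass.coe_zero, Finset.sum_const_zero, add_zero]
        congr 1
        refine Finset.sum_congr rfl fun j hj => ?_
        rw [Finset.mem_Icc] at hj
        rw [Function.update_of_ne (by omega)]

/-- Adding the component of order `s` to those of higher order in the chains `DWedge`. -/
lemma SolvabilityConditions.exists_wedge (H : C.SolvabilityConditions f N M20 ML MW) {s : ℕ}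
    (hs : s ∈ Finset.Icc 1 (ν - 2)) (u : ∀ j, ℝ → C.DLast j) (v : ∀ j, ℝ → C.DWedge j)
    (d : ℝ → C.DLast (s + 1)) (e : ℝ → C.DWedge (s + 1))
    (hu : ∀ j ∈ Finset.Icc 1 (ν - 1), ∀ t, 0 ≤ t → u j t ∈ ML j)
    (hv : ∀ j ∈ Finset.Icc (s + 1) (ν - 2), ∀ t, 0 ≤ t → v j t ∈ MW j)
    (hus : ∀ j ∈ Finset.Icc 1 (ν - 1), ContDiffOn ℝ s (u j) (Ici 0))
    (hvs : ∀ j ∈ Finset.Icc (s + 1) (ν - 2), ContDiffOn ℝ s (v j) (Ici 0))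
    (hd : ContDiffOn ℝ s d (Ici 0)) (he : ContDiffOn ℝ s e (Ici 0)) :
    ∃ z : ℝ → C.DWedge s,
      (∀ t, 0 ≤ t → z t ∈ MW s ∧
        C.FSigma f s t (fun j => u j t) (z t) (fun j => v j t) (d t) (e t) = 0) ∧
      ContDiffOn ℝ s z (Ici 0) := by
  have hs' := Finset.mem_Icc.1 hs
  refine exists_contDiffOn_implicit (Q := C.QSigma s) (H.isOpen_MW s hs)
    (G := fun p => C.FSigma f s p.1 (fun j => u j p.1) p.2 (fun j => v j p.1) (d p.1) (e p.1))
    hs'.1 ?_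
    (fun p => FSigma_mem s _ _ _ _ _ _) (fun y => by rw [QSigma_eq, projY_projY]; simp)
    (fun t ht => H.solveSigma s hs t ht (fun j => u j t) (fun j => v j t) (d t) (e t)
      (fun j hj => hu j hj t ht) fun j hj => hv j hj t ht)
    (fun t ht z hz h0 => H.invertSigma s hs t ht (fun j => u j t) z hz
      (fun j => v j t) (d t) (e t) (fun j hj => hu j hj t ht)
      (fun j hj => hv j hj t ht) h0)
  have hb : ContDiffOn ℝ s (fun p : ℝ × C.DWedge s => b (p.2 : D)) (Ici 0 ×ˢ MW s) :=
    ((restrictFinite b (C.DWedge s)).contDiff.comp contDiff_snd).contDiffOn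
  have ha : ContDiffOn ℝ s (fun p : ℝ × C.DWedge s => a ((d p.1 : D) + e p.1)) (Ici 0 ×ˢ MW s) := by
    have h1 : ContDiffOn ℝ s (fun t => a (d t : D)) (Ici 0) :=
      (restrictFinite a (C.DLast (s + 1))).contDiff.comp_contDiffOn hd
    have h2 : ContDiffOn ℝ s (fun t => a (e t : D)) (Ici 0) :=
      (restrictFinite a (C.DWedge (s + 1))).contDiff.comp_contDiffOn he
    simp only [map_add]
    exact ContDiffOn.comp (h1.add h2) contDiffOn_fst fun p hp => hp.1
  refine (ContDiffOn.sub ?_ hb).sub ha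
  refine SmoothOn.comp_coe (g := fun t x => C.QSigma s (f t x)) (H.smoothSigma s hs)
    (c := fun p : ℝ × C.DWedge s => ∑ j ∈ Finset.Icc 1 (ν - 1), (u j p.1 : D)
      + ((p.2 : D) + ∑ j ∈ Finset.Icc (s + 1) (ν - 2), (v j p.1 : D))) ?_ ?_ ?_
  · refine (ContDiffOn.sum fun j hj => ?_).add ((contDiffOn_coe contDiffOn_snd).add
      (ContDiffOn.sum fun j hj => ?_))
    · exact (contDiffOn_coe (hus j hj)).comp contDiffOn_fst fun p hp => hp.1
    · exact (contDiffOn_coe (hvs j hj)).comp contDiffOn_fst fun p hp => hp.1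
  · intro p
    refine Submodule.add_mem _ (Submodule.sum_mem _ fun j hj => DLast_coe_mem_spaceSum hj _)
      (Submodule.add_mem _ (DWedge_coe_mem_spaceSum (Finset.mem_Icc.2 ⟨le_rfl, hs'.2⟩) _)
        (Submodule.sum_mem _ fun j hj => ?_))
    rw [Finset.mem_Icc] at hj
    exact DWedge_coe_mem_spaceSum (Finset.mem_Icc.2 ⟨by omega, hj.2⟩) _
  · rintro ⟨t, y⟩ ⟨ht, hy⟩
    refine ⟨fun j => u j t, Function.update (fun j => v j t) s y, fun j hj => hu j hj t ht,
      fun j hj => ?_, ?_⟩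
    · rw [Finset.mem_Icc] at hj
      rcases eq_or_ne j s with rfl | hne
      · rw [Function.update_self]; exact hy
      · rw [Function.update_of_ne hne]
        exact hv j (Finset.mem_Icc.2 ⟨by omega, hj.2⟩) t ht
    · rw [sum_Icc_eq_add _ hs'.2, Function.update_self]
      congr 2
      refine Finset.sum_congr rfl fun j hj => ?_
      rw [Finset.mem_Icc] at hj
      rw [Function.update_of_ne (by omega)]

/-- Curves `U j` in `DLast j` and `V j` in `DWedge j` that satisfy all constraints of positive
order. The time derivatives that enter the constraints are those of the curves. -/
structure IsConstraintCurve (C : CanonicalSystem a b ν n) (f : ℝ → D → Y)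
    (ML : ∀ j, Set (C.DLast j)) (MW : ∀ j, Set (C.DWedge j))
    (U : ∀ j, ℝ → C.DLast j) (V : ∀ j, ℝ → C.DWedge j) : Prop where
  last : ∀ s ∈ Finset.Icc 1 (ν - 1), ∀ t, 0 ≤ t →
    U s t ∈ ML s ∧ C.FLast f s t (U s t) (fun j => U j t) = 0
  wedge : ∀ s ∈ Finset.Icc 1 (ν - 2), ∀ t, 0 ≤ t → V s t ∈ MW s ∧
    C.FSigma f s t (fun j => U j t) (V s t) (fun j => V j t)
      (derivWithin (U (s + 1)) (Ici 0) t) (derivWithin (V (s + 1)) (Ici 0) t) = 0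
  contDiff_last : ∀ s, 1 ≤ s → ContDiffOn ℝ 1 (U s) (Ici 0)
  contDiff_wedge : ∀ s, 1 ≤ s → ContDiffOn ℝ 1 (V s) (Ici 0)

/-- The constraints of positive order determine a curve: first the components in the chains
`DLast`, then those in `DWedge`, both by downward recursion on the order. In the
second recursion every order costs one derivative, because the constraint of order `s` contains
the time derivatives of the components of order `s + 1`. -/
theorem SolvabilityConditions.exists_constraintCurve
    (H : C.SolvabilityConditions f N M20 ML MW) :
    ∃ U V, C.IsConstraintCurve f ML MW U V := by
  obtain ⟨U, hU⟩ := exists_downward_family (α := fun j => ℝ → C.DLast j) (ν - 1)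
    (fun s u z => (∀ t, 0 ≤ t → z t ∈ ML s ∧ C.FLast f s t (z t) (fun j => u j t) = 0) ∧
      ContDiffOn ℝ (lastSmoothness ν s) z (Ici 0))
    (by
      rintro s hs hsm u u' huu z ⟨h1, h2⟩
      refine ⟨fun t ht => ⟨(h1 t ht).1, ?_⟩, h2⟩
      rw [← (h1 t ht).2, FLast, FLast]
      congr 4
      refine Finset.sum_congr rfl fun j hj => ?_
      rw [Finset.mem_Icc] at hj
      rw [huu j (by omega) hj.2])
    (by
      intro s hs hsm u hu
      refine H.exists_last (Finset.mem_Icc.2 ⟨hs, hsm⟩) u (fun j hj t ht => ?_) fun j hj => ?_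
      · rw [Finset.mem_Icc] at hj
        exact ((hu j (by omega) hj.2).1 t ht).1
      · rw [Finset.mem_Icc] at hj
        refine (hu j (by omega) hj.2).2.of_le ?_
        norm_cast
        simp only [lastSmoothness]
        split_ifs <;> omega)
  have hU1 : ∀ s, 1 ≤ s → s ≤ ν - 1 → ContDiffOn ℝ ((ν - 2 : ℕ) : WithTop ℕ∞) (U s) (Ici 0) := by
    intro s hs hsm
    refine (hU s hs hsm).2.of_le ?_
    norm_cast
    simp only [lastSmoothness]
    split_ifs <;> omega
  have hUd : ∀ s, 1 ≤ s → s ≤ ν - 2 →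
      ContDiffOn ℝ s (fun t => derivWithin (U (s + 1)) (Ici 0) t) (Ici 0) := by
    intro s hs hsm
    refine ((contDiffOn_succ_iff_derivWithin (uniqueDiffOn_Ici 0)).1
      ((hU (s + 1) (by omega) (by omega)).2.of_le ?_)).2.2
    norm_cast
    simp only [lastSmoothness]
    split_ifs <;> omega
  have hV0 : ∀ s, ν ≤ s + 1 → ∀ v v' : ℝ → C.DWedge s, v = v' := fun s hs v v' =>
    funext fun t => (C.DWedge_eq_zero hs _).trans (C.DWedge_eq_zero hs _).symm
  obtain ⟨V, hV⟩ := exists_downward_family (α := fun j => ℝ → C.DWedge j) (ν - 2)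
    (fun s v z => (∀ t, 0 ≤ t → z t ∈ MW s ∧
      C.FSigma f s t (fun j => U j t) (z t) (fun j => v j t)
      (derivWithin (U (s + 1)) (Ici 0) t) (derivWithin (v (s + 1)) (Ici 0) t) = 0) ∧
      ContDiffOn ℝ s z (Ici 0))
    (by
      rintro s hs hsm v v' hvv z ⟨h1, h2⟩
      have hv1 : v' (s + 1) = v (s + 1) := by
        by_cases h : s + 1 ≤ ν - 2
        · exact (hvv _ (by omega) h).symm
        · exact hV0 _ (by omega) _ _
      refine ⟨fun t ht => ⟨(h1 t ht).1, ?_⟩, h2⟩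
      have hsum : ∑ j ∈ Finset.Icc (s + 1) (ν - 2), (v' j t : D)
          = ∑ j ∈ Finset.Icc (s + 1) (ν - 2), (v j t : D) := by
        refine Finset.sum_congr rfl fun j hj => ?_
        rw [Finset.mem_Icc] at hj
        rw [hvv j (by omega) hj.2]
      rw [← (h1 t ht).2, FSigma, FSigma, hv1, hsum])
    (by
      intro s hs hsm v hv
      refine H.exists_wedge (Finset.mem_Icc.2 ⟨hs, hsm⟩) U v _ _ ?_ ?_ ?_ ?_ (hUd s hs hsm) ?_
      · intro j hj t ht
        rw [Finset.mem_Icc] at hj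
        exact ((hU j hj.1 hj.2).1 t ht).1
      · intro j hj t ht
        rw [Finset.mem_Icc] at hj
        exact ((hv j (by omega) hj.2).1 t ht).1
      · intro j hj
        rw [Finset.mem_Icc] at hj
        exact (hU1 j hj.1 hj.2).of_le (by exact_mod_cast hsm)
      · intro j hj
        rw [Finset.mem_Icc] at hj
        exact (hv j (by omega) hj.2).2.of_le (by norm_cast; omega)
      · by_cases h : s + 1 ≤ ν - 2
        · refine ((contDiffOn_succ_iff_derivWithin (uniqueDiffOn_Ici 0)).1
            ((hv (s + 1) (by omega) h).2.of_le ?_)).2.2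
          norm_cast
        · rw [hV0 (s + 1) (by omega) (derivWithin (v (s + 1)) (Ici 0)) fun _ => 0]
          exact contDiffOn_const)
  refine ⟨U, V, ⟨fun s hs t ht => ?_, fun s hs t ht => ?_, fun s hs => ?_, fun s hs => ?_⟩⟩
  · rw [Finset.mem_Icc] at hs
    exact (hU s hs.1 hs.2).1 t ht
  · rw [Finset.mem_Icc] at hs
    exact (hV s hs.1 hs.2).1 t ht
  · by_cases h : s ≤ ν - 1
    · refine (hU s hs h).2.of_le ?_
      norm_cast
      simp only [lastSmoothness]
      split_ifs <;> omega
    · have : U s = fun _ => 0 := funext fun t => C.DLast_eq_zero (by omega) _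
      rw [this]
      exact contDiffOn_const
  · by_cases h : s ≤ ν - 2
    · exact (hV s hs h).2.of_le (by exact_mod_cast hs)
    · rw [hV0 s (by omega) (V s) fun _ => 0]
      exact contDiffOn_const

end CanonicalSystem

end ADAE

namespace ADAE.CanonicalSystem

/-! ### The reduced differential equation -/

section Decomposition

variable {𝕜 D Y : Type*} [RCLike 𝕜]
  [NormedAddCommGroup D] [NormedSpace 𝕜 D] [NormedAddCommGroup Y] [NormedSpace 𝕜 Y]
  {a b : D →ₗ[𝕜] Y} {ν n : ℕ} (C : CanonicalSystem a b ν n)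

/-- The component in `D1`. -/
def comp1 (x : D) : C.D1 := C.P1.rangeRestrict x

/-- The component in `D20`. -/
def comp20 (x : D) : C.D20 := (C.P2 0).rangeRestrict x

/-- The component in `DLast s`. -/
def compLast (s : ℕ) (x : D) : C.DLast s := (C.P2j s (s + 1)).rangeRestrict x

/-- The component in `DWedge s`. -/
def compWedge (s : ℕ) (x : D) : C.DWedge s := (C.PWedge s).rangeRestrict x

lemma coe_comp1 (x : D) : (C.comp1 x : D) = C.P1 x := rfl

lemma coe_comp20 (x : D) : (C.comp20 x : D) = C.projD (fun _ r => r = 0) x := by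
  rw [← P2_eq]; rfl

lemma coe_compLast (s : ℕ) (x : D) : (C.compLast s x : D) = C.projD (C.lastIdx s) x := by
  rw [← P2j_last]; rfl

lemma coe_compWedge (s : ℕ) (x : D) : (C.compWedge s x : D) = C.projD (C.wedgeIdx s) x := by
  rw [← PWedge_eq]; rfl

/-- The sum of the components of positive order. -/
def sigmaSum (u : ∀ j, C.DLast j) (v : ∀ j, C.DWedge j) : D :=
  ∑ j ∈ Finset.Icc 1 (ν - 1), (u j : D) + ∑ j ∈ Finset.Icc 1 (ν - 2), (v j : D)

lemma projD_one_le (x : D) : C.projD (fun _ r => 1 ≤ r) x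
    = C.sigmaSum (fun j => C.compLast j x) fun j => C.compWedge j x := by
  simp only [sigmaSum, coe_compLast, coe_compWedge]
  rw [← LinearMap.sum_apply, ← LinearMap.sum_apply, sum_projD, sum_projD, ← LinearMap.add_apply,
    ← projD_or]
  · refine LinearMap.congr_fun (C.projD_congr fun i r hr => ?_) x
    have := C.m_le i
    simp only [Finset.mem_Icc, lastIdx, wedgeIdx]
    constructor
    · intro h
      by_cases h' : C.m i = r + 1
      · exact Or.inl ⟨r, by omega, rfl, h'⟩
      · exact Or.inr ⟨r, by omega, rfl, by omega⟩
    · rintro (⟨k, hk⟩ | ⟨k, hk⟩) <;> omega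
  · rintro i r hr ⟨⟨k, hk⟩, l, hl⟩
    simp only [lastIdx, wedgeIdx] at hk hl
    omega
  · intro i r hr k hk l hl h1 h2
    exact h1.1.symm.trans h2.1
  · intro i r hr k hk l hl h1 h2
    exact h1.1.symm.trans h2.1

lemma decomposition (x : D) : x = (C.comp1 x : D) + C.comp20 x
    + C.sigmaSum (fun j => C.compLast j x) fun j => C.compWedge j x := by
  have h : C.projD (fun _ r => r = 0 ∨ 1 ≤ r) = C.projD fun _ _ => True :=
    C.projD_congr fun i r _ => iff_true_intro (by omega)
  rw [coe_comp1, coe_comp20, ← projD_one_le, add_assoc, ← LinearMap.add_apply, ← projD_or, h,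
    P1_apply, sub_add_cancel]
  intro i r _ h
  omega

section Components

variable (x1 : C.D1) (x20 : C.D20) (u : ∀ j, C.DLast j) (v : ∀ j, C.DWedge j)

lemma projD_one_le_sigmaSum : C.projD (fun _ r => 1 ≤ r) (C.sigmaSum u v) = C.sigmaSum u v := by
  simp only [sigmaSum, map_add, map_sum]
  congr 1
  · refine Finset.sum_congr rfl fun j hj => ?_
    rw [Finset.mem_Icc] at hj
    exact C.projD_of_imp (C.mem_DLast.1 (u j).2) fun i r _ h => by rw [h.1]; exact hj.1
  · refine Finset.sum_congr rfl fun j hj => ?_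
    rw [Finset.mem_Icc] at hj
    exact C.projD_of_imp (C.mem_DWedge.1 (v j).2) fun i r _ h => by rw [h.1]; exact hj.1

lemma sigmaSum_mem_DSigma : C.sigmaSum u v ∈ C.DSigma :=
  C.mem_DSigma.2 (C.projD_one_le_sigmaSum u v)

lemma comp1_add : C.comp1 ((x1 : D) + x20 + C.sigmaSum u v) = x1 := by
  refine Subtype.ext ?_
  rw [coe_comp1, map_add, map_add, C.mem_D1.1 x1.2, ← C.mem_D20.1 x20.2, P1_projD,
    ← projD_one_le_sigmaSum, P1_projD, add_zero, add_zero]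

lemma comp20_add : C.comp20 ((x1 : D) + x20 + C.sigmaSum u v) = x20 := by
  refine Subtype.ext ?_
  rw [coe_comp20, map_add, map_add, ← C.mem_D1.1 x1.2, projD_P1, C.mem_D20.1 x20.2,
    C.projD_of_disjoint (C.projD_one_le_sigmaSum u v) (by intro i r _ h; omega), zero_add, add_zero]

lemma compLast_add {s : ℕ} (hs : s ∈ Finset.Icc 1 (ν - 1)) :
    C.compLast s ((x1 : D) + x20 + C.sigmaSum u v) = u s := by
  refine Subtype.ext ?_
  have hs' := Finset.mem_Icc.1 hs
  rw [coe_compLast, map_add, map_add, ← C.mem_D1.1 x1.2, projD_P1,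
    C.projD_of_disjoint (C.mem_D20.1 x20.2) (by intro i r _ h h'; have := h'.1; omega), zero_add,
    zero_add, sigmaSum, map_add, map_sum, map_sum, Finset.sum_eq_single s,
    Finset.sum_eq_zero, add_zero, C.mem_DLast.1 (u s).2]
  · intro j _
    refine C.projD_of_disjoint (C.mem_DWedge.1 (v j).2) ?_
    rintro i r - ⟨h1, h2⟩ ⟨h3, h4⟩
    omega
  · intro j _ hj
    refine C.projD_of_disjoint (C.mem_DLast.1 (u j).2) ?_
    rintro i r - ⟨h1, h2⟩ ⟨h3, h4⟩
    omega
  · exact fun h => absurd hs h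

lemma compWedge_add {s : ℕ} (hs : s ∈ Finset.Icc 1 (ν - 2)) :
    C.compWedge s ((x1 : D) + x20 + C.sigmaSum u v) = v s := by
  refine Subtype.ext ?_
  have hs' := Finset.mem_Icc.1 hs
  rw [coe_compWedge, map_add, map_add, ← C.mem_D1.1 x1.2, projD_P1,
    C.projD_of_disjoint (C.mem_D20.1 x20.2) (by intro i r _ h h'; have := h'.1; omega), zero_add,
    zero_add, sigmaSum, map_add, map_sum, map_sum, Finset.sum_eq_zero, zero_add,
    Finset.sum_eq_single s, C.mem_DWedge.1 (v s).2]
  · intro j _ hj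
    refine C.projD_of_disjoint (C.mem_DWedge.1 (v j).2) ?_
    rintro i r - ⟨h1, h2⟩ ⟨h3, h4⟩
    omega
  · exact fun h => absurd hs h
  · intro j _
    refine C.projD_of_disjoint (C.mem_DLast.1 (u j).2) ?_
    rintro i r - ⟨h1, h2⟩ ⟨h3, h4⟩
    omega

end Components

variable {C} {f : ℝ → D → Y}

lemma HasTriangularStructure.eq_add (hf : C.HasTriangularStructure f) {t : ℝ} (ht : 0 ≤ t) (x : D) :
    f t x = C.Q1 (f t x) + C.Q2 0 (f t x)
      + ∑ s ∈ Finset.Icc 1 (ν - 2), C.QSigma s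
          (f t (∑ j ∈ Finset.Icc 1 (ν - 1), (C.compLast j x : D)
            + (C.compWedge s x + ∑ j ∈ Finset.Icc (s + 1) (ν - 2), (C.compWedge j x : D))))
      + ∑ s ∈ Finset.Icc 1 (ν - 1), C.Q2j s (s + 1)
          (f t (C.compLast s x + ∑ j ∈ Finset.Icc (s + 1) (ν - 1), (C.compLast j x : D))) := by
  have h := hf t ht x
  rw [add_apply] at h
  refine h.trans ?_
  congr 1
  · congr 1
    refine Finset.sum_congr rfl fun s hs => ?_
    rw [Finset.mem_Icc] at hs
    rw [sum_Icc_eq_add (fun j => C.PWedge j x) hs.2]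
    rfl
  · refine Finset.sum_congr rfl fun s hs => ?_
    rw [Finset.mem_Icc] at hs
    rw [sum_Icc_eq_add (fun j => C.P2j j (j + 1) x) hs.2]
    rfl

lemma Q2j_triangular (y₁ y₂ : Y) (g h : ℕ → Y) {s : ℕ} (hs : s ∈ Finset.Icc 1 (ν - 1)) :
    C.Q2j s (s + 1) (C.Q1 y₁ + C.Q2 0 y₂ + ∑ j ∈ Finset.Icc 1 (ν - 2), C.QSigma j (g j)
      + ∑ j ∈ Finset.Icc 1 (ν - 1), C.Q2j j (j + 1) (h j)) = C.Q2j s (s + 1) (h s) := by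
  have hs' := Finset.mem_Icc.1 hs
  simp only [Q2j_last, QSigma_eq, Q2_eq, map_add, map_sum, projY_Q1]
  rw [C.projY_projY_of_disjoint, Finset.sum_eq_zero, Finset.sum_eq_single s, projY_projY]
  · simp
  · intro j _ hj
    rw [C.projY_projY_of_disjoint]
    rintro i r - ⟨h1, h2⟩ ⟨h3, h4⟩
    omega
  · exact fun h => absurd hs h
  · intro j _
    rw [C.projY_projY_of_disjoint]
    rintro i r - ⟨h1, h2⟩ ⟨h3, h4⟩
    omega
  · rintro i r - ⟨h1, h2⟩ h3
    omega

lemma QSigma_triangular (y₁ y₂ : Y) (g h : ℕ → Y) {s : ℕ} (hs : s ∈ Finset.Icc 1 (ν - 2)) :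
    C.QSigma s (C.Q1 y₁ + C.Q2 0 y₂ + ∑ j ∈ Finset.Icc 1 (ν - 2), C.QSigma j (g j)
      + ∑ j ∈ Finset.Icc 1 (ν - 1), C.Q2j j (j + 1) (h j)) = C.QSigma s (g s) := by
  have hs' := Finset.mem_Icc.1 hs
  simp only [Q2j_last, QSigma_eq, Q2_eq, map_add, map_sum, projY_Q1]
  rw [C.projY_projY_of_disjoint, Finset.sum_eq_single s, projY_projY,
    Finset.sum_eq_zero (s := Finset.Icc 1 (ν - 1))]
  · simp
  · intro j _
    rw [C.projY_projY_of_disjoint]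
    rintro i r - ⟨h1, h2⟩ ⟨h3, h4⟩
    omega
  · intro j _ hj
    rw [C.projY_projY_of_disjoint]
    rintro i r - ⟨h1, h2⟩ ⟨h3, h4⟩
    omega
  · exact fun h => absurd hs h
  · rintro i r - ⟨h1, h2⟩ h3
    omega

lemma HasTriangularStructure.Q2j_eq (hf : C.HasTriangularStructure f) {t : ℝ} (ht : 0 ≤ t) (x : D)
    {s : ℕ} (hs : s ∈ Finset.Icc 1 (ν - 1)) : C.Q2j s (s + 1) (f t x) = C.Q2j s (s + 1)
      (f t (C.compLast s x + ∑ j ∈ Finset.Icc (s + 1) (ν - 1), (C.compLast j x : D))) :=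
  (congrArg _ (hf.eq_add ht x)).trans (Q2j_triangular _ _ _ _ hs)

lemma HasTriangularStructure.QSigma_eq (hf : C.HasTriangularStructure f) {t : ℝ} (ht : 0 ≤ t)
    (x : D) {s : ℕ} (hs : s ∈ Finset.Icc 1 (ν - 2)) : C.QSigma s (f t x) = C.QSigma s
      (f t (∑ j ∈ Finset.Icc 1 (ν - 1), (C.compLast j x : D)
        + (C.compWedge s x + ∑ j ∈ Finset.Icc (s + 1) (ν - 2), (C.compWedge j x : D)))) :=
  (congrArg _ (hf.eq_add ht x)).trans (QSigma_triangular _ _ _ _ hs)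

lemma F20_mem (t : ℝ) (x1 : C.D1) (x20 : C.D20) (xS : C.DSigma) (d : C.DLast 1)
    (e : C.DWedge 1) : C.Q2 0 (C.F20 f t x1 x20 xS d e) = C.F20 f t x1 x20 xS d e := by
  simp only [F20, map_sub, Q2_eq, projY_projY, ← b_projD, C.mem_D20.1 x20.2, and_self]

lemma a_D20 (x : C.D20) : a (x : D) = 0 := by
  rw [← C.mem_D20.1 x.2, ← C.projY_a (p := fun _ _ => False), C.projY_eq_zero]
  · rfl
  · simp
  · simp

lemma mem_setM_components {N : Set C.Y1} {M20 : Set C.D20} {ML : ∀ j, Set (C.DLast j)}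
    {MW : ∀ j, Set (C.DWedge j)} {x : D} (hx : x ∈ C.setM N M20 ML MW) :
    C.comp1 x ∈ C.setM1 N ∧ C.comp20 x ∈ M20 ∧
      (∀ s ∈ Finset.Icc 1 (ν - 1), C.compLast s x ∈ ML s) ∧
      ∀ s ∈ Finset.Icc 1 (ν - 2), C.compWedge s x ∈ MW s := by
  obtain ⟨x1, h1, x20, h20, xS, ⟨u, v, hu, hv, hS⟩, rfl⟩ := hx
  have hS : (xS : D) = C.sigmaSum u v := hS
  rw [hS]
  refine ⟨by rwa [comp1_add], by rwa [comp20_add], fun s hs => ?_, fun s hs => ?_⟩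
  · rw [compLast_add _ _ _ _ _ hs]; exact hu s hs
  · rw [compWedge_add _ _ _ _ _ hs]; exact hv s hs

end Decomposition

section Reduced

variable {𝕜 D Y : Type*} [RCLike 𝕜]
  [NormedAddCommGroup D] [NormedSpace 𝕜 D] [NormedAddCommGroup Y] [NormedSpace 𝕜 Y]
  [NormedSpace ℝ D] [IsScalarTower ℝ 𝕜 D] [NormedSpace ℝ Y] [IsScalarTower ℝ 𝕜 Y]
  {a b : D →ₗ[𝕜] Y} {ν n : ℕ}

/-- The bounded inverse of `Ã : D1 → Y1`, together with the bounded operator `b Ã⁻¹`. -/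
structure BoundedInverse (C : CanonicalSystem a b ν n) where
  inv : C.Y1 →L[ℝ] C.D1
  aTilde_inv : ∀ w, C.aTilde (inv w : D) = w
  bInv : C.Y1 →L[ℝ] Y
  bInv_apply : ∀ w, bInv w = b (inv w : D)

variable {C : CanonicalSystem a b ν n} {f : ℝ → D → Y} {N : Set C.Y1}
  {M20 : Set C.D20} {ML : ∀ j, Set (C.DLast j)} {MW : ∀ j, Set (C.DWedge j)}
  {U : ∀ j, ℝ → C.DLast j} {V : ∀ j, ℝ → C.DWedge j}

lemma BoundedInverse.a_inv (I : C.BoundedInverse) (w : C.Y1) : a (I.inv w : D) = w := by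
  have h := I.aTilde_inv w
  rwa [← C.mem_D1.1 (I.inv w).2, aTilde_P1, C.mem_D1.1 (I.inv w).2] at h

lemma BoundedInverse.inv_mem (I : C.BoundedInverse) {w : C.Y1} (hw : w ∈ N) :
    I.inv w ∈ C.setM1 N := ⟨w, hw, I.aTilde_inv w⟩

/-- The component in `DSigma` that is prescribed by the curves `U`, `V`. -/
def sigmaCurve (U : ∀ j, ℝ → C.DLast j) (V : ∀ j, ℝ → C.DWedge j) (t : ℝ) : C.DSigma :=
  ⟨C.sigmaSum (fun j => U j t) fun j => V j t, C.sigmaSum_mem_DSigma _ _⟩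

omit [NormedSpace ℝ D] [IsScalarTower ℝ 𝕜 D] [NormedSpace ℝ Y] [IsScalarTower ℝ 𝕜 Y] in
lemma coe_sigmaCurve (t : ℝ) :
    (sigmaCurve U V t : D) = C.sigmaSum (fun j => U j t) fun j => V j t := rfl

namespace IsConstraintCurve

omit [NormedSpace ℝ Y] [IsScalarTower ℝ 𝕜 Y] in
lemma sigmaCurve_mem (hUV : C.IsConstraintCurve f ML MW U V) {t : ℝ} (ht : 0 ≤ t) :
    sigmaCurve U V t ∈ C.setMSigma ML MW :=
  ⟨fun j => U j t, fun j => V j t, fun j hj => (hUV.last j hj t ht).1,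
    fun j hj => (hUV.wedge j hj t ht).1, rfl⟩

omit [NormedSpace ℝ Y] [IsScalarTower ℝ 𝕜 Y] in
lemma continuousOn_sigmaCurve (hUV : C.IsConstraintCurve f ML MW U V) :
    ContinuousOn (sigmaCurve U V) (Ici 0) := by
  rw [Topology.IsInducing.subtypeVal.continuousOn_iff]
  refine ContinuousOn.add (continuousOn_finsetSum _ fun j hj => ?_)
    (continuousOn_finsetSum _ fun j hj => ?_)
  · exact continuous_subtype_val.comp_continuousOn
      (hUV.contDiff_last j (Finset.mem_Icc.1 hj).1).continuousOn
  · exact continuous_subtype_val.comp_continuousOn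
      (hUV.contDiff_wedge j (Finset.mem_Icc.1 hj).1).continuousOn

omit [NormedSpace ℝ Y] [IsScalarTower ℝ 𝕜 Y] in
lemma continuousOn_deriv_last (hUV : C.IsConstraintCurve f ML MW U V) {s : ℕ} (hs : 1 ≤ s) :
    ContinuousOn (derivWithin (U s) (Ici 0)) (Ici 0) :=
  ((contDiffOn_one_iff_derivWithin (uniqueDiffOn_Ici 0)).1 (hUV.contDiff_last s hs)).2

omit [NormedSpace ℝ Y] [IsScalarTower ℝ 𝕜 Y] in
lemma continuousOn_deriv_wedge (hUV : C.IsConstraintCurve f ML MW U V) {s : ℕ} (hs : 1 ≤ s) :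
    ContinuousOn (derivWithin (V s) (Ici 0)) (Ici 0) :=
  ((contDiffOn_one_iff_derivWithin (uniqueDiffOn_Ici 0)).1 (hUV.contDiff_wedge s hs)).2

lemma hasDerivWithinAt_a_last (hUV : C.IsConstraintCurve f ML MW U V) {s : ℕ} (hs : 1 ≤ s)
    {t : ℝ} (ht : 0 ≤ t) {J : Set ℝ} (hJ : J ⊆ Ici 0) :
    HasDerivWithinAt (fun τ => a (U s τ : D)) (a ((derivWithin (U s) (Ici 0) t : C.DLast s) : D))
      J t := by
  have h : HasDerivWithinAt (U s) (derivWithin (U s) (Ici 0) t) J t :=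
    ((hUV.contDiff_last s hs).differentiableOn one_ne_zero t ht).hasDerivWithinAt.mono hJ
  exact (restrictFinite a (C.DLast s)).hasFDerivAt.comp_hasDerivWithinAt t h

lemma hasDerivWithinAt_a_wedge (hUV : C.IsConstraintCurve f ML MW U V) {s : ℕ} (hs : 1 ≤ s)
    {t : ℝ} (ht : 0 ≤ t) {J : Set ℝ} (hJ : J ⊆ Ici 0) :
    HasDerivWithinAt (fun τ => a (V s τ : D)) (a ((derivWithin (V s) (Ici 0) t : C.DWedge s) : D))
      J t := by
  have h : HasDerivWithinAt (V s) (derivWithin (V s) (Ici 0) t) J t :=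
    ((hUV.contDiff_wedge s hs).differentiableOn one_ne_zero t ht).hasDerivWithinAt.mono hJ
  exact (restrictFinite a (C.DWedge s)).hasFDerivAt.comp_hasDerivWithinAt t h

end IsConstraintCurve

/-- `ψ t w` is the component in `D20` that the constraint of order zero determines from the time
and from `w = Ã x₁`. -/
structure IsZeroOrderPart (I : C.BoundedInverse) (f : ℝ → D → Y) (N : Set C.Y1) (M20 : Set C.D20)
    (U : ∀ j, ℝ → C.DLast j) (V : ∀ j, ℝ → C.DWedge j) (ψ : ℝ → C.Y1 → C.D20) : Prop where
  mem : ∀ t, 0 ≤ t → ∀ w ∈ N, ψ t w ∈ M20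
  eq_zero : ∀ t, 0 ≤ t → ∀ w ∈ N, C.F20 f t (I.inv w) (ψ t w) (sigmaCurve U V t)
    (derivWithin (U 1) (Ici 0) t) (derivWithin (V 1) (Ici 0) t) = 0
  continuousOn : ContinuousOn (fun p : ℝ × C.Y1 => ψ p.1 p.2) (Ici 0 ×ˢ N)
  lipschitz : LocallyLipschitzSnd ψ N

/-- The contractivity condition determines the component in `D20` as a continuous function of
`(t, w)` that is locally Lipschitz in `w`. -/
theorem SolvabilityConditions.exists_zeroOrderPart (H : C.SolvabilityConditions f N M20 ML MW)
    (hUV : C.IsConstraintCurve f ML MW U V) (I : C.BoundedInverse) :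
    ∃ ψ, IsZeroOrderPart I f N M20 U V ψ := by
  have hcomplete : CompleteSpace C.D20 := FiniteDimensional.complete 𝕜 C.D20
  set d : ℝ → C.DLast 1 := derivWithin (U 1) (Ici 0) with hd
  set e : ℝ → C.DWedge 1 := derivWithin (V 1) (Ici 0) with he
  have hdc : ContinuousOn d (Ici 0) := hUV.continuousOn_deriv_last le_rfl
  have hec : ContinuousOn e (Ici 0) := hUV.continuousOn_deriv_wedge le_rfl
  have hSc := hUV.continuousOn_sigmaCurve
  let F : ℝ × C.Y1 → C.D20 → Y := fun p y =>
    C.F20 f p.1 (I.inv p.2) y (sigmaCurve U V p.1) (d p.1) (e p.1)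
  let F' : ℝ × C.Y1 → C.D20 → C.Y20 := fun p y => toRange (C.Q2 0) (F p y)
  have hF' : ∀ p y, (F' p y : Y) = F p y := fun p y => F20_mem _ _ _ _ _ _
  have hF0 : ∀ p y, F' p y = 0 ↔ F p y = 0 := fun p y => by
    rw [← Submodule.coe_eq_zero, hF']
  have hex : ∀ p : ℝ × C.Y1, ∃ y, p ∈ Ici (0 : ℝ) ×ˢ N → (y ∈ M20 ∧ F p y = 0) ∧
      ∀ z, z ∈ M20 ∧ F p z = 0 → z = y := by
    intro p
    by_cases hp : p ∈ Ici (0 : ℝ) ×ˢ N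
    · obtain ⟨y, hy⟩ := H.solve20 p.1 hp.1 (I.inv p.2) (I.inv_mem hp.2) (sigmaCurve U V p.1)
        (hUV.sigmaCurve_mem hp.1) (d p.1) (e p.1)
      exact ⟨y, fun _ => hy⟩
    · exact ⟨0, fun h => absurd h hp⟩
  choose ψ hψ using hex
  set Ω : Set (ℝ × C.Y1) := Ici 0 ×ˢ N with hΩ
  -- continuity of the arguments of `F20`
  have hS2 : ContinuousOn (fun p : ℝ × C.Y1 => sigmaCurve U V p.1) Ω :=
    hSc.comp continuousOn_fst fun p hp => hp.1
  have hd2 : ContinuousOn (fun p : ℝ × C.Y1 => d p.1) Ω :=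
    hdc.comp continuousOn_fst fun p hp => hp.1
  have he2 : ContinuousOn (fun p : ℝ × C.Y1 => e p.1) Ω :=
    hec.comp continuousOn_fst fun p hp => hp.1
  have hFc : ∀ y, ContinuousOn (fun p => F' p y) Ω := by
    intro y
    refine (toRange (C.Q2 0)).continuous.comp_continuousOn ?_
    refine ContinuousOn.sub (ContinuousOn.sub ?_ continuousOn_const) ?_
    · refine (C.Q2 0).continuous.comp_continuousOn ?_
      refine H.continuousOn.comp (f := fun p : ℝ × C.Y1 =>
        (p.1, (I.inv p.2 : D) + y + sigmaCurve U V p.1)) ?_ fun p hp => ⟨hp.1, mem_univ _⟩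
      refine continuousOn_fst.prodMk (ContinuousOn.add ?_
        (continuous_subtype_val.comp_continuousOn hS2))
      have : Continuous fun p : ℝ × C.Y1 => (I.inv p.2 : D) + y := by fun_prop
      exact this.continuousOn
    · refine (C.Q2 0).continuous.comp_continuousOn ?_
      simp only [map_add]
      exact ((restrictFinite a (C.DLast 1)).continuous.comp_continuousOn hd2).add
        ((restrictFinite a (C.DWedge 1)).continuous.comp_continuousOn he2)
  -- the contraction near a point of the graph of `ψ`
  have hloc : ∀ p₀ ∈ Ω, ∃ (Z : C.D20 ≃L[ℝ] C.Y20) (c ε : ℝ), 0 ≤ c ∧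
      c * ‖(Z.symm : C.Y20 →L[ℝ] C.D20)‖ < 1 ∧ 0 < ε ∧
      ∀ᶠ p in 𝓝[Ω] p₀, ∀ y ∈ Metric.ball (ψ p₀) ε, ∀ z ∈ Metric.ball (ψ p₀) ε,
        ‖F' p y - F' p z - Z (y - z)‖ ≤ c * ‖y - z‖ := by
    intro p₀ hp₀
    obtain ⟨Z, k, l, hk, hl, δ₀, hδ₀, ε₀, hε₀, hbound⟩ := H.contractive p₀.1 hp₀.1 (I.inv p₀.2)
      (I.inv_mem hp₀.2) (ψ p₀) (hψ p₀ hp₀).1.1 (sigmaCurve U V p₀.1) (hUV.sigmaCurve_mem hp₀.1)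
      (d p₀.1) (e p₀.1) (hψ p₀ hp₀).1.2
    have hev1 := (hk.mul_const ‖(Z.symm : C.Y20 →L[ℝ] C.D20)‖).eventually_lt_const hl
    have hev2 : ∀ᶠ p in (𝓝[>] (0 : ℝ)) ×ˢ (𝓝[>] (0 : ℝ)),
        (0 < p.1 ∧ p.1 < δ₀) ∧ (0 < p.2 ∧ p.2 < ε₀) :=
      Filter.prod_mem_prod (Ioo_mem_nhdsGT hδ₀) (Ioo_mem_nhdsGT hε₀)
    obtain ⟨⟨δ, ε⟩, hkl, ⟨hδ, hδ'⟩, hε, hε'⟩ := (hev1.and hev2).exists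
    refine ⟨Z, max (k δ ε) 0, ε, le_max_right _ _, ?_, hε, ?_⟩
    · rw [max_mul_of_nonneg _ _ (norm_nonneg _), zero_mul]
      exact max_lt hkl one_pos
    · have hc1 : ∀ᶠ p in 𝓝[Ω] p₀, I.inv p.2 ∈ Metric.ball (I.inv p₀.2) δ := by
        have : Continuous fun p : ℝ × C.Y1 => I.inv p.2 := by fun_prop
        exact this.continuousWithinAt.eventually_mem (Metric.ball_mem_nhds _ hδ)
      have hc2 : ∀ᶠ p in 𝓝[Ω] p₀, |p.1 - p₀.1| < δ := by
        have : ContinuousWithinAt (fun p : ℝ × C.Y1 => p.1) Ω p₀ := continuousWithinAt_fst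
        simpa [Real.dist_eq] using this.eventually_mem (Metric.ball_mem_nhds _ hδ)
      filter_upwards [hc1, hc2, (hS2 p₀ hp₀).eventually_mem (Metric.ball_mem_nhds _ hδ),
        (hd2 p₀ hp₀).eventually_mem (Metric.ball_mem_nhds _ hδ),
        (he2 p₀ hp₀).eventually_mem (Metric.ball_mem_nhds _ hδ), self_mem_nhdsWithin]
        with p h1 h2 h3 h4 h5 hp y hy z hz
      have h6 := hbound δ hδ hδ'.le ε hε hε'.le p.1 hp.1 h2 (I.inv p.2) h1 (sigmaCurve U V p.1) h3
        (d p.1) h4 (e p.1) h5 y hy z hz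
      have h7 : ‖F' p y - F' p z - Z (y - z)‖ ≤ k δ ε * ‖y - z‖ := by
        change ‖((F' p y : Y) - F' p z - Z (y - z))‖ ≤ _
        rw [hF', hF']
        exact h6
      exact h7.trans (mul_le_mul_of_nonneg_right (le_max_left _ _) (norm_nonneg _))
  have hcont : ContinuousOn ψ Ω := by
    intro p₀ hp₀
    obtain ⟨Z, c, ε, hc0, hc, hε, happ⟩ := hloc p₀ hp₀
    obtain ⟨κ, hκ⟩ := eventually_norm_implicit_sub_le (Ω := Ω) H.isOpen_M20 (F := F')
      (fun p hp => ⟨(hψ p hp).1.1, (hF0 _ _).2 (hψ p hp).1.2⟩)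
      (fun p hp y hy h0 => (hψ p hp).2 y ⟨hy, (hF0 _ _).1 h0⟩) hp₀ Z hc0 hc hε happ
      (hFc _ p₀ hp₀)
    have h1 : Tendsto (fun p => κ * ‖F' p (ψ p₀)‖) (𝓝[Ω] p₀) (𝓝 0) := by
      have h2 := ((hFc (ψ p₀) p₀ hp₀).norm.const_mul κ).tendsto
      simpa [(hF0 _ _).2 (hψ p₀ hp₀).1.2] using h2
    have h3 := squeeze_zero_norm' hκ h1
    have h4 := h3.add_const (ψ p₀)
    simpa [ContinuousWithinAt] using h4
  refine ⟨fun t w => ψ (t, w), ⟨fun t ht w hw => (hψ (t, w) ⟨ht, hw⟩).1.1,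
    fun t ht w hw => (hψ (t, w) ⟨ht, hw⟩).1.2, hcont, ?_⟩⟩
  intro t₀ ht₀ w₀ hw₀
  have hp₀ : (t₀, w₀) ∈ Ω := ⟨ht₀, hw₀⟩
  obtain ⟨Z, c, ε, hc0, hc, hε, happ⟩ := hloc _ hp₀
  set ζ := ‖(Z.symm : C.Y20 →L[ℝ] C.D20)‖ with hζ
  have h1c : 0 < 1 - c * ζ := by linarith
  obtain ⟨r, hr, L, hL, hlip⟩ := H.lipschitzQ20 t₀ ht₀ (I.inv w₀) (I.inv_mem hw₀) (ψ (t₀, w₀))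
    (hψ _ hp₀).1.1 (sigmaCurve U V t₀) (hUV.sigmaCurve_mem ht₀)
  have hev : ∀ᶠ p in 𝓝[Ω] (t₀, w₀),
      (∀ y ∈ Metric.ball (ψ (t₀, w₀)) ε, ∀ z ∈ Metric.ball (ψ (t₀, w₀)) ε,
        ‖F' p y - F' p z - Z (y - z)‖ ≤ c * ‖y - z‖) ∧
      ψ p ∈ Metric.ball (ψ (t₀, w₀)) ε ∧ ψ p ∈ Metric.ball (ψ (t₀, w₀)) r ∧
      sigmaCurve U V p.1 ∈ Metric.ball (sigmaCurve U V t₀) r ∧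
      I.inv p.2 ∈ Metric.ball (I.inv w₀) r ∧ |p.1 - t₀| < r := by
    have hc1 : ∀ᶠ p in 𝓝[Ω] (t₀, w₀), I.inv p.2 ∈ Metric.ball (I.inv w₀) r := by
      have : Continuous fun p : ℝ × C.Y1 => I.inv p.2 := by fun_prop
      exact this.continuousWithinAt.eventually_mem (Metric.ball_mem_nhds _ hr)
    have hc2 : ∀ᶠ p in 𝓝[Ω] (t₀, w₀), |p.1 - t₀| < r := by
      have : ContinuousWithinAt (fun p : ℝ × C.Y1 => p.1) Ω (t₀, w₀) := continuousWithinAt_fst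
      simpa [Real.dist_eq] using this.eventually_mem (Metric.ball_mem_nhds _ hr)
    exact happ.and (((hcont _ hp₀).eventually_mem (Metric.ball_mem_nhds _ hε)).and
      (((hcont _ hp₀).eventually_mem (Metric.ball_mem_nhds _ hr)).and
      (((hS2 _ hp₀).eventually_mem (Metric.ball_mem_nhds _ hr)).and (hc1.and hc2))))
  obtain ⟨ρ, hρ, hρb⟩ := Metric.mem_nhdsWithin_iff.1 hev
  refine ⟨ρ, hρ, ζ / (1 - c * ζ) * (L * ‖I.inv‖), by positivity, ?_⟩
  intro t ht htρ w hw w' hw' hwρ hwρ'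
  have hmem : ∀ y ∈ N, ‖y - w₀‖ < ρ → (t, y) ∈ Metric.ball (t₀, w₀) ρ ∩ Ω := fun y hy hyρ => by
    refine ⟨?_, ht, hy⟩
    rw [← ball_prod_same]
    exact ⟨by rwa [Metric.mem_ball, Real.dist_eq], by rwa [Metric.mem_ball, dist_eq_norm]⟩
  obtain ⟨h1, h2, h3, h4, h5, h6⟩ := hρb (hmem w hw hwρ)
  obtain ⟨-, h2', h3', -, h5', -⟩ := hρb (hmem w' hw' hwρ')
  have hmul := norm_sub_le_of_approx Z (h1 (ψ (t, w)) h2 (ψ (t, w')) h2')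
  have hres : ‖F' (t, w) (ψ (t, w)) - F' (t, w) (ψ (t, w'))‖ ≤ L * ‖I.inv‖ * ‖w - w'‖ := by
    have hz : F' (t, w) (ψ (t, w)) = F' (t, w') (ψ (t, w')) := by
      rw [(hF0 _ _).2 (hψ (t, w) ⟨ht, hw⟩).1.2, (hF0 _ _).2 (hψ (t, w') ⟨ht, hw'⟩).1.2]
    rw [hz]
    change ‖((F' (t, w') (ψ (t, w')) : Y) - F' (t, w) (ψ (t, w')))‖ ≤ _
    rw [hF', hF']
    have h8 : F (t, w') (ψ (t, w')) - F (t, w) (ψ (t, w'))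
        = C.Q2 0 (f t ((I.inv w' : D) + ψ (t, w') + sigmaCurve U V t))
          - C.Q2 0 (f t ((I.inv w : D) + ψ (t, w') + sigmaCurve U V t)) := by
      simp only [F, F20]; abel
    rw [h8]
    refine (hlip t ht h6 (sigmaCurve U V t) (hUV.sigmaCurve_mem ht) (mem_ball_iff_norm.1 h4)
      (I.inv w') (I.inv_mem hw') (I.inv w) (I.inv_mem hw) (mem_ball_iff_norm.1 h5')
      (mem_ball_iff_norm.1 h5) (ψ (t, w')) (hψ (t, w') ⟨ht, hw'⟩).1.1 (ψ (t, w'))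
      (hψ (t, w') ⟨ht, hw'⟩).1.1 (mem_ball_iff_norm.1 h3') (mem_ball_iff_norm.1 h3')).trans ?_
    rw [sub_self, norm_zero, add_zero, ← map_sub, mul_assoc, norm_sub_rev w w']
    exact mul_le_mul_of_nonneg_left (I.inv.le_opNorm _) hL
  have h9 : (1 - c * ζ) * ‖ψ (t, w) - ψ (t, w')‖ ≤ ζ * (L * ‖I.inv‖ * ‖w - w'‖) :=
    hmul.trans (mul_le_mul_of_nonneg_left hres (norm_nonneg _))
  rw [div_mul_eq_mul_div, div_mul_eq_mul_div, le_div_iff₀ h1c]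
  linarith

end Reduced

end ADAE.CanonicalSystem

namespace ADAE.CanonicalSystem

/-! ### Equivalence of the initial value problem with the reduced equation -/

section Sums

variable {𝕜 D Y : Type*} [RCLike 𝕜]
  [NormedAddCommGroup D] [NormedSpace 𝕜 D] [NormedAddCommGroup Y] [NormedSpace 𝕜 Y]
  {a b : D →ₗ[𝕜] Y} {ν n : ℕ} {C : CanonicalSystem a b ν n}

lemma sum_DWedge (v : ∀ j, C.DWedge j) :
    ∑ j ∈ Finset.Icc 1 (ν - 2), (v j : D) = ∑ j ∈ Finset.Icc 1 (ν - 1), (v j : D) := by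
  refine Finset.sum_subset (Finset.Icc_subset_Icc_right (by omega)) fun j hj hj' => ?_
  rw [Finset.mem_Icc] at hj hj'
  rw [C.DWedge_eq_zero (by omega) (v j), ZeroMemClass.coe_zero]

lemma sigmaSum_eq_sum (u : ∀ j, C.DLast j) (v : ∀ j, C.DWedge j) :
    C.sigmaSum u v = ∑ j ∈ Finset.Icc 1 (ν - 1), ((u j : D) + v j) := by
  rw [sigmaSum, sum_DWedge, Finset.sum_add_distrib]

/-- Shifting the index in a sum of vectors of positive order. -/
lemma sum_add_shift (u : ∀ j, C.DLast j) (v : ∀ j, C.DWedge j) :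
    ((u 1 : D) + v 1) + ∑ j ∈ Finset.Icc 1 (ν - 2), ((u (j + 1) : D) + v (j + 1))
      = ∑ j ∈ Finset.Icc 1 (ν - 1), ((u j : D) + v j) := by
  rcases Nat.lt_or_ge 1 ν with h | h
  · rw [sum_Icc_eq_add (fun j => (u j : D) + v j) (by omega : 1 ≤ ν - 1)]
    congr 1
    obtain ⟨k, rfl⟩ := Nat.exists_eq_add_of_le' h
    exact Finset.sum_Ico_add' (fun j => (u j : D) + v j) 1 (k + 1) 1
  · rw [C.DLast_eq_zero h (u 1), C.DWedge_eq_zero (by omega) (v 1), Finset.Icc_eq_empty (by omega),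
      Finset.Icc_eq_empty (by omega)]
    simp

lemma projD_order_eq (s : ℕ) (x : D) :
    C.projD (fun _ r => r = s) x = C.compLast s x + C.compWedge s x := by
  rw [coe_compLast, coe_compWedge, ← LinearMap.add_apply, ← projD_or, lastIdx_or_wedgeIdx]
  rintro i r - ⟨⟨h1, h2⟩, h3, h4⟩
  omega

end Sums

variable {𝕜 D Y : Type*} [RCLike 𝕜]
  [NormedAddCommGroup D] [NormedSpace 𝕜 D] [NormedAddCommGroup Y] [NormedSpace 𝕜 Y]
  [NormedSpace ℝ D] [IsScalarTower ℝ 𝕜 D] [NormedSpace ℝ Y] [IsScalarTower ℝ 𝕜 Y]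
  {a b : D →ₗ[𝕜] Y} {ν n : ℕ}
  {C : CanonicalSystem a b ν n} {f : ℝ → D → Y} {N : Set C.Y1}
  {M20 : Set C.D20} {ML : ∀ j, Set (C.DLast j)} {MW : ∀ j, Set (C.DWedge j)}
  {U : ∀ j, ℝ → C.DLast j} {V : ∀ j, ℝ → C.DWedge j}
  {I : C.BoundedInverse} {ψ : ℝ → C.Y1 → C.D20}

/-- The state of the system at time `t` that has `Ã x₁ = w` and satisfies the constraints of all
orders. -/
def fullState (I : C.BoundedInverse) (U : ∀ j, ℝ → C.DLast j) (V : ∀ j, ℝ → C.DWedge j)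
    (ψ : ℝ → C.Y1 → C.D20) (t : ℝ) (w : C.Y1) : D :=
  (I.inv w : D) + ψ t w + sigmaCurve U V t

/-- The right-hand side of the equation in `Y1` to which the problem reduces. -/
def reducedField (I : C.BoundedInverse) (f : ℝ → D → Y) (U : ∀ j, ℝ → C.DLast j)
    (V : ∀ j, ℝ → C.DWedge j) (ψ : ℝ → C.Y1 → C.D20) (t : ℝ) (w : C.Y1) : C.Y1 :=
  toRange C.Q1 (f t (fullState I U V ψ t w)) - toRange C.Q1 (I.bInv w)

lemma BoundedInverse.toRange_bInv (w : C.Y1) : (toRange C.Q1 (I.bInv w) : Y) = b (I.inv w : D) := by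
  rw [coe_toRange, I.bInv_apply, ← b_P1, C.mem_D1.1 (I.inv w).2]

lemma IsZeroOrderPart.fullState_mem (hψ : IsZeroOrderPart I f N M20 U V ψ)
    (hUV : C.IsConstraintCurve f ML MW U V) {t : ℝ} (ht : 0 ≤ t) {w : C.Y1} (hw : w ∈ N) :
    fullState I U V ψ t w ∈ C.setM N M20 ML MW :=
  ⟨I.inv w, I.inv_mem hw, ψ t w, hψ.mem t ht w hw, sigmaCurve U V t, hUV.sigmaCurve_mem ht, rfl⟩

lemma IsZeroOrderPart.continuousOn_fullState (hψ : IsZeroOrderPart I f N M20 U V ψ)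
    (hUV : C.IsConstraintCurve f ML MW U V) :
    ContinuousOn (fun p : ℝ × C.Y1 => fullState I U V ψ p.1 p.2) (Ici 0 ×ˢ N) := by
  have h1 : Continuous fun p : ℝ × C.Y1 => (I.inv p.2 : D) := by fun_prop
  refine (h1.continuousOn.add (continuous_subtype_val.comp_continuousOn hψ.continuousOn)).add
    (continuous_subtype_val.comp_continuousOn (hUV.continuousOn_sigmaCurve.comp
      continuousOn_fst fun p hp => hp.1))

lemma SolvabilityConditions.continuousOn_reducedField
    (H : C.SolvabilityConditions f N M20 ML MW) (hUV : C.IsConstraintCurve f ML MW U V)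
    (hψ : IsZeroOrderPart I f N M20 U V ψ) :
    ContinuousOn (fun p : ℝ × C.Y1 => reducedField I f U V ψ p.1 p.2) (Ici 0 ×ˢ N) := by
  refine ContinuousOn.sub ((toRange C.Q1).continuous.comp_continuousOn ?_) ?_
  · exact H.continuousOn.comp (f := fun p : ℝ × C.Y1 => (p.1, fullState I U V ψ p.1 p.2))
      (continuousOn_fst.prodMk (hψ.continuousOn_fullState hUV)) fun p hp => ⟨hp.1, mem_univ _⟩
  · have : Continuous fun p : ℝ × C.Y1 => toRange C.Q1 (I.bInv p.2) := by fun_prop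
    exact this.continuousOn

lemma SolvabilityConditions.lipschitz_reducedField
    (H : C.SolvabilityConditions f N M20 ML MW) (hUV : C.IsConstraintCurve f ML MW U V)
    (hψ : IsZeroOrderPart I f N M20 U V ψ) :
    LocallyLipschitzSnd (reducedField I f U V ψ) N := by
  intro t₀ ht₀ w₀ hw₀
  obtain ⟨r₁, hr₁, L₁, hL₁, h₁⟩ := H.lipschitzQ1 t₀ ht₀ (I.inv w₀) (I.inv_mem hw₀) (ψ t₀ w₀)
    (hψ.mem t₀ ht₀ w₀ hw₀) (sigmaCurve U V t₀) (hUV.sigmaCurve_mem ht₀)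
  obtain ⟨r₂, hr₂, L₂, hL₂, h₂⟩ := hψ.lipschitz t₀ ht₀ w₀ hw₀
  have hev : ∀ᶠ p in 𝓝[Ici 0 ×ˢ N] (t₀, w₀), ψ p.1 p.2 ∈ Metric.ball (ψ t₀ w₀) r₁ ∧
      sigmaCurve U V p.1 ∈ Metric.ball (sigmaCurve U V t₀) r₁ ∧
      I.inv p.2 ∈ Metric.ball (I.inv w₀) r₁ := by
    have hp₀ : (t₀, w₀) ∈ Ici (0 : ℝ) ×ˢ N := ⟨ht₀, hw₀⟩
    have hc1 : Continuous fun p : ℝ × C.Y1 => I.inv p.2 := by fun_prop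
    have hc2 : ContinuousOn (fun p : ℝ × C.Y1 => sigmaCurve U V p.1) (Ici 0 ×ˢ N) :=
      hUV.continuousOn_sigmaCurve.comp continuousOn_fst fun p hp => hp.1
    exact ((hψ.continuousOn _ hp₀).eventually_mem (Metric.ball_mem_nhds _ hr₁)).and
      (((hc2 _ hp₀).eventually_mem (Metric.ball_mem_nhds _ hr₁)).and
        (hc1.continuousWithinAt.eventually_mem (Metric.ball_mem_nhds _ hr₁)))
  obtain ⟨ρ, hρ, hρb⟩ := Metric.mem_nhdsWithin_iff.1 hev
  refine ⟨min (min r₁ r₂) ρ, by positivity,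
    L₁ * (‖I.inv‖ + L₂) + ‖(toRange C.Q1).comp I.bInv‖, by positivity, ?_⟩
  intro t ht htr w hw w' hw' hwr hwr'
  simp only [lt_min_iff] at htr hwr hwr'
  have hmem : ∀ y ∈ N, ‖y - w₀‖ < ρ → (t, y) ∈ Metric.ball (t₀, w₀) ρ ∩ Ici 0 ×ˢ N := by
    intro y hy hyρ
    refine ⟨?_, ht, hy⟩
    rw [← ball_prod_same]
    exact ⟨by rw [Metric.mem_ball, Real.dist_eq]; exact htr.2,
      by rwa [Metric.mem_ball, dist_eq_norm]⟩
  obtain ⟨h3, h4, h5⟩ := hρb (hmem w hw hwr.2)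
  obtain ⟨h3', -, h5'⟩ := hρb (hmem w' hw' hwr'.2)
  have h6 : ‖toRange C.Q1 (f t (fullState I U V ψ t w))
      - toRange C.Q1 (f t (fullState I U V ψ t w'))‖ ≤ L₁ * ((‖I.inv‖ + L₂) * ‖w - w'‖) := by
    refine (h₁ t ht htr.1.1 (sigmaCurve U V t) (hUV.sigmaCurve_mem ht) (mem_ball_iff_norm.1 h4)
      (I.inv w) (I.inv_mem hw) (I.inv w') (I.inv_mem hw') (mem_ball_iff_norm.1 h5)
      (mem_ball_iff_norm.1 h5') (ψ t w) (hψ.mem t ht w hw) (ψ t w') (hψ.mem t ht w' hw')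
      (mem_ball_iff_norm.1 h3) (mem_ball_iff_norm.1 h3')).trans ?_
    refine mul_le_mul_of_nonneg_left ?_ hL₁
    rw [add_mul, ← map_sub]
    exact add_le_add (I.inv.le_opNorm _) (h₂ t ht htr.1.2 w hw w' hw' hwr.1.2 hwr'.1.2)
  have h7 : ‖((toRange C.Q1).comp I.bInv) (w - w')‖ ≤ ‖(toRange C.Q1).comp I.bInv‖ * ‖w - w'‖ :=
    ContinuousLinearMap.le_opNorm _ _
  have h8 : reducedField I f U V ψ t w - reducedField I f U V ψ t w'
      = (toRange C.Q1 (f t (fullState I U V ψ t w)) - toRange C.Q1 (f t (fullState I U V ψ t w')))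
        - ((toRange C.Q1).comp I.bInv) (w - w') := by
    simp only [reducedField, ContinuousLinearMap.comp_apply, map_sub]
    abel
  rw [h8]
  refine (norm_sub_le _ _).trans ?_
  linarith

lemma a_fullState (t : ℝ) (w : C.Y1) : a (fullState I U V ψ t w)
    = w + ∑ j ∈ Finset.Icc 1 (ν - 1), (a (U j t : D) + a (V j t : D)) := by
  rw [fullState, map_add, map_add, I.a_inv, a_D20, add_zero, coe_sigmaCurve, sigmaSum_eq_sum,
    map_sum]
  simp only [map_add]

/-- The constraints give the value of `f` at a full state. -/
lemma SolvabilityConditions.f_fullState (H : C.SolvabilityConditions f N M20 ML MW)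
    (hUV : C.IsConstraintCurve f ML MW U V) (hψ : IsZeroOrderPart I f N M20 U V ψ)
    {t : ℝ} (ht : 0 ≤ t) {w : C.Y1} (hw : w ∈ N) :
    f t (fullState I U V ψ t w) = reducedField I f U V ψ t w + b (fullState I U V ψ t w)
      + ∑ j ∈ Finset.Icc 1 (ν - 1), (a ((derivWithin (U j) (Ici 0) t : C.DLast j) : D)
        + a ((derivWithin (V j) (Ici 0) t : C.DWedge j) : D)) := by
  set x := fullState I U V ψ t w with hx
  set d : ∀ j, C.DLast j := fun j => derivWithin (U j) (Ici 0) t with hd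
  set e : ∀ j, C.DWedge j := fun j => derivWithin (V j) (Ici 0) t with he
  have hL : ∀ s ∈ Finset.Icc 1 (ν - 1), C.compLast s x = U s t := fun s hs =>
    compLast_add C _ _ (fun j => U j t) (fun j => V j t) hs
  have hW : ∀ s ∈ Finset.Icc 1 (ν - 2), C.compWedge s x = V s t := fun s hs =>
    compWedge_add C _ _ (fun j => U j t) (fun j => V j t) hs
  have h0 : C.Q2 0 (f t x) = b (ψ t w : D) + a ((d 1 : D) + e 1) := by
    have h := hψ.eq_zero t ht w hw
    rw [F20, Q20_a_add, sub_sub, sub_eq_zero] at h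
    exact h
  have h1 : ∀ s ∈ Finset.Icc 1 (ν - 2), C.QSigma s
      (f t (∑ j ∈ Finset.Icc 1 (ν - 1), (C.compLast j x : D)
        + (C.compWedge s x + ∑ j ∈ Finset.Icc (s + 1) (ν - 2), (C.compWedge j x : D))))
      = b (V s t : D) + a ((d (s + 1) : D) + e (s + 1)) := by
    intro s hs
    have h := (hUV.wedge s hs t ht).2
    rw [FSigma, sub_sub, sub_eq_zero] at h
    rw [← h, hW s hs]
    congr 3
    · exact Finset.sum_congr rfl fun j hj => by rw [hL j hj]
    · congr 1
      refine Finset.sum_congr rfl fun j hj => ?_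
      rw [Finset.mem_Icc] at hj
      rw [hW j (Finset.mem_Icc.2 ⟨by omega, hj.2⟩)]
  have h2 : ∀ s ∈ Finset.Icc 1 (ν - 1), C.Q2j s (s + 1)
      (f t (C.compLast s x + ∑ j ∈ Finset.Icc (s + 1) (ν - 1), (C.compLast j x : D)))
      = b (U s t : D) := by
    intro s hs
    have h := (hUV.last s hs t ht).2
    rw [FLast, sub_eq_zero] at h
    rw [← h, hL s hs]
    congr 3
    refine Finset.sum_congr rfl fun j hj => ?_
    rw [Finset.mem_Icc] at hj
    rw [hL j (Finset.mem_Icc.2 ⟨by omega, hj.2⟩)]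
  have h3 : (reducedField I f U V ψ t w : Y) = C.Q1 (f t x) - b (I.inv w : D) := by
    rw [reducedField, Submodule.coe_sub, I.toRange_bInv, coe_toRange]
  have h4 : b x = b (I.inv w : D) + b (ψ t w : D)
      + (∑ j ∈ Finset.Icc 1 (ν - 1), b (U j t : D)
        + ∑ j ∈ Finset.Icc 1 (ν - 2), b (V j t : D)) := by
    rw [hx, fullState, coe_sigmaCurve, sigmaSum]
    simp only [map_add, map_sum]
  have h5 := congrArg a (sum_add_shift d e)
  simp only [map_add, map_sum] at h5
  rw [H.triangular.eq_add ht x, Finset.sum_congr rfl h1, Finset.sum_congr rfl h2, h0, h3, h4, ← h5]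
  simp only [map_add, Finset.sum_add_distrib]
  abel

lemma IsConstraintCurve.hasDerivWithinAt_a_sum (hUV : C.IsConstraintCurve f ML MW U V)
    {t : ℝ} (ht : 0 ≤ t) {J : Set ℝ} (hJ : J ⊆ Ici 0) :
    HasDerivWithinAt (fun τ => ∑ j ∈ Finset.Icc 1 (ν - 1), (a (U j τ : D) + a (V j τ : D)))
      (∑ j ∈ Finset.Icc 1 (ν - 1), (a ((derivWithin (U j) (Ici 0) t : C.DLast j) : D)
        + a ((derivWithin (V j) (Ici 0) t : C.DWedge j) : D))) J t :=
  HasDerivWithinAt.fun_sum fun _ hj =>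
    (hUV.hasDerivWithinAt_a_last (Finset.mem_Icc.1 hj).1 ht hJ).add
      (hUV.hasDerivWithinAt_a_wedge (Finset.mem_Icc.1 hj).1 ht hJ)

/-- Solutions of the reduced equation give solutions of the original one. -/
theorem SolvabilityConditions.isSolutionOn_fullState (H : C.SolvabilityConditions f N M20 ML MW)
    (hUV : C.IsConstraintCurve f ML MW U V) (hψ : IsZeroOrderPart I f N M20 U V ψ)
    {J : Set ℝ} (hJ : J ⊆ Ici 0) {w : ℝ → C.Y1}
    (hw : SolvesODE (reducedField I f U V ψ) N J w) :
    IsSolutionOn a b f J fun t => fullState I U V ψ t (w t) := by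
  have hpair : ContinuousOn (fun t => (t, w t)) J := continuousOn_id.prodMk hw.continuousOn
  have hmaps : MapsTo (fun t => (t, w t)) J (Ici 0 ×ˢ N) := fun t ht => ⟨hJ ht, (hw t ht).1⟩
  refine ⟨(hψ.continuousOn_fullState hUV).comp hpair hmaps, fun t =>
    (reducedField I f U V ψ t (w t) : Y)
      + ∑ j ∈ Finset.Icc 1 (ν - 1), (a ((derivWithin (U j) (Ici 0) t : C.DLast j) : D)
        + a ((derivWithin (V j) (Ici 0) t : C.DWedge j) : D)), ?_, ?_⟩
  · refine ContinuousOn.mono (s := J) (ContinuousOn.add ?_ ?_) fun t ht => ht.1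
    · exact continuous_subtype_val.comp_continuousOn
        ((H.continuousOn_reducedField hUV hψ).comp hpair hmaps)
    · refine continuousOn_finsetSum _ fun j hj => ?_
      have hj1 := (Finset.mem_Icc.1 hj).1
      exact ((restrictFinite a (C.DLast j)).continuous.comp_continuousOn
          ((hUV.continuousOn_deriv_last hj1).mono hJ)).add
        ((restrictFinite a (C.DWedge j)).continuous.comp_continuousOn
          ((hUV.continuousOn_deriv_wedge hj1).mono hJ))
  · rintro t ⟨ht, -⟩
    refine ⟨?_, ?_⟩
    · simp only [a_fullState]
      exact ((C.Y1.subtypeL.restrictScalars ℝ).hasFDerivAt.comp_hasDerivWithinAt t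
        (hw t ht).2).add (hUV.hasDerivWithinAt_a_sum (hJ ht) hJ)
    · rw [H.f_fullState hUV hψ (hJ ht) (hw t ht).1]
      exact add_right_comm _ _ _

end ADAE.CanonicalSystem

namespace ADAE.CanonicalSystem

/-! ### Reduction of a given solution -/

section Reduction

variable {𝕜 D Y : Type*} [RCLike 𝕜]
  [NormedAddCommGroup D] [NormedSpace 𝕜 D] [NormedAddCommGroup Y] [NormedSpace 𝕜 Y]
  [NormedSpace ℝ D] [IsScalarTower ℝ 𝕜 D] [NormedSpace ℝ Y] [IsScalarTower ℝ 𝕜 Y]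
  {a b : D →ₗ[𝕜] Y} {ν n : ℕ}
  {C : CanonicalSystem a b ν n} {f : ℝ → D → Y} {N : Set C.Y1}
  {M20 : Set C.D20} {ML : ∀ j, Set (C.DLast j)} {MW : ∀ j, Set (C.DWedge j)}
  {U : ∀ j, ℝ → C.DLast j} {V : ∀ j, ℝ → C.DWedge j}
  {I : C.BoundedInverse} {ψ : ℝ → C.Y1 → C.D20} {J : Set ℝ} {x : ℝ → D} {v : ℝ → Y}

omit [NormedSpace ℝ D] [IsScalarTower ℝ 𝕜 D] in
lemma toRange_a_mem {y : D} (hy : y ∈ C.setM N M20 ML MW) : toRange C.Q1 (a y) ∈ N := by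
  obtain ⟨w, hw, h⟩ := (mem_setM_components hy).1
  have h1 : toRange C.Q1 (a y) = w := by
    refine Subtype.ext ?_
    rw [coe_toRange, Q1_a, ← h, coe_comp1, aTilde_P1]
  rwa [h1]

lemma BoundedInverse.inv_toRange_a (y : D) : I.inv (toRange C.Q1 (a y)) = C.comp1 y := by
  refine Subtype.ext (C.aTilde_injective ?_)
  rw [I.aTilde_inv, coe_toRange, Q1_a, coe_comp1, aTilde_P1]

omit [NormedSpace ℝ D] [IsScalarTower ℝ 𝕜 D] in
/-- The projections of `v = (a x)'` onto the vectors of order `s` of the chains of length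
`s + 1` vanish, as those of `a x` do. -/
lemma Q2j_deriv_eq_zero (hJ : UniqueDiffOn ℝ J)
    (hv : ∀ t ∈ J, HasDerivWithinAt (fun τ => a (x τ)) (v t) J t) (s : ℕ) {t : ℝ} (ht : t ∈ J) :
    C.Q2j s (s + 1) (v t) = 0 := by
  have h1 := ((C.Q2j s (s + 1)).restrictScalars ℝ).hasFDerivAt.comp_hasDerivWithinAt t (hv t ht)
  have h2 : ∀ y, C.Q2j s (s + 1) (a y) = 0 := fun y => by
    rw [Q2j_last, C.projY_a (p' := fun _ _ => False), C.projD_eq_zero (fun _ _ _ h => h)]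
    · simp
    · rintro i r hr
      exact iff_of_false id fun h => by have := h.1; have := h.2; omega
  have h3 : HasDerivWithinAt (fun _ => (0 : Y)) (C.Q2j s (s + 1) (v t)) J t :=
    h1.congr (fun τ _ => (h2 (x τ)).symm) (h2 (x t)).symm
  exact (hJ t ht).eq_deriv _ h3 (hasDerivWithinAt_const t J 0)

/-- The projection of `v = (a x)'` onto the vectors of order `s` is determined by the components of
`x` of order `s + 1`. -/
lemma projY_deriv_eq (hUV : C.IsConstraintCurve f ML MW U V) (hJ : UniqueDiffOn ℝ J)
    (hJ0 : J ⊆ Ici 0) (hv : ∀ t ∈ J, HasDerivWithinAt (fun τ => a (x τ)) (v t) J t) (s : ℕ)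
    (hL : ∀ t ∈ J, C.compLast (s + 1) (x t) = U (s + 1) t)
    (hW : ∀ t ∈ J, C.compWedge (s + 1) (x t) = V (s + 1) t) {p : Fin n → ℕ → Prop}
    (hp : ∀ i r, r + 1 < C.m i → (r + 1 = s + 1 ↔ p i r)) {t : ℝ} (ht : t ∈ J) :
    C.projY p (v t) = a (((derivWithin (U (s + 1)) (Ici 0) t : C.DLast (s + 1)) : D)
      + (derivWithin (V (s + 1)) (Ici 0) t : C.DWedge (s + 1))) := by
  have h1 := ((C.projY p).restrictScalars ℝ).hasFDerivAt.comp_hasDerivWithinAt t (hv t ht)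
  have h2 : ∀ τ ∈ J, C.projY p (a (x τ)) = a (U (s + 1) τ : D) + a (V (s + 1) τ : D) := by
    intro τ hτ
    rw [C.projY_a (p' := fun _ r => r = s + 1) hp, projD_order_eq, hL τ hτ, hW τ hτ, map_add]
  have h3 := h1.congr (fun τ hτ => (h2 τ hτ).symm) (h2 t ht).symm
  rw [map_add]
  exact (hJ t ht).eq_deriv _ h3 ((hUV.hasDerivWithinAt_a_last (by omega) (hJ0 ht) hJ0).add
    (hUV.hasDerivWithinAt_a_wedge (by omega) (hJ0 ht) hJ0))

/-- Along a solution, the components in the chains `DLast` are those of the constraint curve. -/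
lemma SolvabilityConditions.compLast_eq (H : C.SolvabilityConditions f N M20 ML MW)
    (hUV : C.IsConstraintCurve f ML MW U V) (hJ : UniqueDiffOn ℝ J) (hJ0 : J ⊆ Ici 0)
    (hv : ∀ t ∈ J, HasDerivWithinAt (fun τ => a (x τ)) (v t) J t)
    (heq : ∀ t ∈ J, v t + b (x t) = f t (x t)) (hx : ∀ t ∈ J, x t ∈ C.setM N M20 ML MW)
    {t : ℝ} (ht : t ∈ J) {s : ℕ} (hs : 1 ≤ s) : C.compLast s (x t) = U s t := by
  induction h : ν - s using Nat.strong_induction_on generalizing s with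
  | _ k ih =>
  by_cases hsν : ν ≤ s
  · rw [C.DLast_eq_zero hsν (U s t), C.DLast_eq_zero hsν (C.compLast s (x t))]
  have hs' : s ∈ Finset.Icc 1 (ν - 1) := Finset.mem_Icc.2 ⟨hs, by omega⟩
  refine (H.solveLast s hs' t (hJ0 ht) (fun j => U j t) fun j hj => ?_).unique
    ⟨(mem_setM_components (hx t ht)).2.2.1 s hs', ?_⟩ (hUV.last s hs' t (hJ0 ht))
  · rw [Finset.mem_Icc] at hj
    exact (hUV.last j (Finset.mem_Icc.2 ⟨by omega, hj.2⟩) t (hJ0 ht)).1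
  · have h1 := congrArg (C.Q2j s (s + 1)) (heq t ht)
    rw [map_add, Q2j_deriv_eq_zero hJ hv s ht, zero_add, H.triangular.Q2j_eq (hJ0 ht) _ hs'] at h1
    have h2 : C.Q2j s (s + 1) (b (x t)) = b (C.compLast s (x t) : D) := by
      rw [Q2j_last, coe_compLast, b_projD]
    rw [FLast, sub_eq_zero, ← h2, h1]
    congr 3
    refine Finset.sum_congr rfl fun j hj => ?_
    rw [Finset.mem_Icc] at hj
    rw [ih (ν - j) (by omega) (by omega) rfl]

/-- Along a solution, the components in the chains `DWedge` are those of the constraint curve. -/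
lemma SolvabilityConditions.compWedge_eq (H : C.SolvabilityConditions f N M20 ML MW)
    (hUV : C.IsConstraintCurve f ML MW U V) (hJ : UniqueDiffOn ℝ J) (hJ0 : J ⊆ Ici 0)
    (hv : ∀ t ∈ J, HasDerivWithinAt (fun τ => a (x τ)) (v t) J t)
    (heq : ∀ t ∈ J, v t + b (x t) = f t (x t)) (hx : ∀ t ∈ J, x t ∈ C.setM N M20 ML MW)
    {t : ℝ} (ht : t ∈ J) {s : ℕ} (hs : 1 ≤ s) : C.compWedge s (x t) = V s t := by
  induction h : ν - s using Nat.strong_induction_on generalizing s t with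
  | _ k ih =>
  by_cases hsν : ν ≤ s + 1
  · rw [C.DWedge_eq_zero hsν (V s t), C.DWedge_eq_zero hsν (C.compWedge s (x t))]
  have hs' : s ∈ Finset.Icc 1 (ν - 2) := Finset.mem_Icc.2 ⟨hs, by omega⟩
  have hL : ∀ τ ∈ J, ∀ j, 1 ≤ j → C.compLast j (x τ) = U j τ :=
    fun τ hτ j hj => H.compLast_eq hUV hJ hJ0 hv heq hx hτ hj
  have hd := projY_deriv_eq hUV hJ hJ0 hv s (fun τ hτ => hL τ hτ _ (by omega))
    (fun τ hτ => ih (ν - (s + 1)) (by omega) hτ (by omega) rfl) (p := C.wedgeIdx s)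
    (fun i r _ => by simp only [wedgeIdx]; omega) ht
  refine (H.solveSigma s hs' t (hJ0 ht) (fun j => U j t) (fun j => V j t)
    (derivWithin (U (s + 1)) (Ici 0) t) (derivWithin (V (s + 1)) (Ici 0) t)
    (fun j hj => (hUV.last j hj t (hJ0 ht)).1) fun j hj => ?_).unique
    ⟨(mem_setM_components (hx t ht)).2.2.2 s hs', ?_⟩ (hUV.wedge s hs' t (hJ0 ht))
  · rw [Finset.mem_Icc] at hj
    exact (hUV.wedge j (Finset.mem_Icc.2 ⟨by omega, hj.2⟩) t (hJ0 ht)).1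
  · have h1 := congrArg (C.QSigma s) (heq t ht)
    rw [map_add, H.triangular.QSigma_eq (hJ0 ht) _ hs', CanonicalSystem.QSigma_eq, hd,
      ← b_projD, ← coe_compWedge, ← CanonicalSystem.QSigma_eq] at h1
    rw [FSigma, sub_sub, sub_eq_zero, add_comm (b _), h1]
    congr 3
    · refine Finset.sum_congr rfl fun j hj => ?_
      rw [hL t ht j (Finset.mem_Icc.1 hj).1]
    · congr 1
      refine Finset.sum_congr rfl fun j hj => ?_
      rw [Finset.mem_Icc] at hj
      rw [ih (ν - j) (by omega) ht (by omega) rfl]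

/-- A solution with values in `M` is determined by its component in `Y1`, which solves the reduced
equation. -/
theorem SolvabilityConditions.solvesODE_of_solution (H : C.SolvabilityConditions f N M20 ML MW)
    (hUV : C.IsConstraintCurve f ML MW U V) (hψ : IsZeroOrderPart I f N M20 U V ψ)
    (hJ : UniqueDiffOn ℝ J) (hJ0 : J ⊆ Ici 0)
    (hv : ∀ t ∈ J, HasDerivWithinAt (fun τ => a (x τ)) (v t) J t)
    (heq : ∀ t ∈ J, v t + b (x t) = f t (x t)) (hx : ∀ t ∈ J, x t ∈ C.setM N M20 ML MW) :
    SolvesODE (reducedField I f U V ψ) N J (fun t => toRange C.Q1 (a (x t))) ∧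
      ∀ t ∈ J, x t = fullState I U V ψ t (toRange C.Q1 (a (x t))) := by
  have hL : ∀ t ∈ J, ∀ j, 1 ≤ j → C.compLast j (x t) = U j t :=
    fun t ht j hj => H.compLast_eq hUV hJ hJ0 hv heq hx ht hj
  have hW : ∀ t ∈ J, ∀ j, 1 ≤ j → C.compWedge j (x t) = V j t :=
    fun t ht j hj => H.compWedge_eq hUV hJ hJ0 hv heq hx ht hj
  have hdec : ∀ t ∈ J, x t = (C.comp1 (x t) : D) + C.comp20 (x t) + sigmaCurve U V t := by
    intro t ht
    have h : C.sigmaSum (fun j => C.compLast j (x t)) (fun j => C.compWedge j (x t))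
        = sigmaCurve U V t := by
      rw [coe_sigmaCurve, sigmaSum, sigmaSum]
      congr 1
      · exact Finset.sum_congr rfl fun j hj => by rw [hL t ht j (Finset.mem_Icc.1 hj).1]
      · exact Finset.sum_congr rfl fun j hj => by rw [hW t ht j (Finset.mem_Icc.1 hj).1]
    rw [← h]
    exact C.decomposition (x t)
  have hstate : ∀ t ∈ J, x t = fullState I U V ψ t (toRange C.Q1 (a (x t))) := by
    intro t ht
    have hd := projY_deriv_eq hUV hJ hJ0 hv 0 (fun τ hτ => hL τ hτ _ (by omega))
      (fun τ hτ => hW τ hτ _ (by omega)) (p := fun _ r => r = 0)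
      (fun i r _ => by omega) ht
    have h1 := congrArg (C.Q2 0) (heq t ht)
    rw [map_add, Q2_eq, hd, ← b_projD, ← coe_comp20, ← Q2_eq] at h1
    have hN := toRange_a_mem (hx t ht)
    have h20 : C.comp20 (x t) = ψ t (toRange C.Q1 (a (x t))) := by
      refine (H.solve20 t (hJ0 ht) _ (I.inv_mem hN) (sigmaCurve U V t)
        (hUV.sigmaCurve_mem (hJ0 ht)) (derivWithin (U 1) (Ici 0) t)
        (derivWithin (V 1) (Ici 0) t)).unique
        ⟨(mem_setM_components (hx t ht)).2.1, ?_⟩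
        ⟨hψ.mem t (hJ0 ht) _ hN, hψ.eq_zero t (hJ0 ht) _ hN⟩
      rw [F20, Q20_a_add, I.inv_toRange_a, ← hdec t ht, sub_sub, sub_eq_zero, ← h1]
      exact add_comm _ _
    conv_lhs => rw [hdec t ht]
    rw [fullState, I.inv_toRange_a, h20]
  refine ⟨fun t ht => ⟨toRange_a_mem (hx t ht), ?_⟩, hstate⟩
  have h1 := (toRange C.Q1).hasFDerivAt.comp_hasDerivWithinAt t (hv t ht)
  have h2 : reducedField I f U V ψ t (toRange C.Q1 (a (x t))) = toRange C.Q1 (v t) := by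
    rw [reducedField, ← hstate t ht, ← heq t ht, map_add, add_sub_assoc, add_eq_left, sub_eq_zero]
    refine Subtype.ext ?_
    rw [I.toRange_bInv, coe_toRange, I.inv_toRange_a, coe_comp1, b_P1]
  rw [h2]
  exact h1

end Reduction

end ADAE.CanonicalSystem

namespace ADAE

/-! ### The initial time, and the initial value problem -/

lemma rightInterval_subset_Ici {t₀ : ℝ} (ht₀ : 0 ≤ t₀) (T : EReal) :
    rightInterval t₀ T ⊆ Ici 0 := fun _ ht => ht₀.trans ht.1

lemma IsIntervalFrom.uniqueDiffOn {t₀ : ℝ} {J : Set ℝ} (hJ : IsIntervalFrom t₀ J) :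
    UniqueDiffOn ℝ J := by
  obtain ⟨h1, h2, h3⟩ := hJ
  obtain ⟨t₁, ht₁, hne⟩ := h3.exists_ne t₀
  refine uniqueDiffOn_convex h1.convex ⟨(t₀ + t₁) / 2, ?_⟩
  have hlt : t₀ < t₁ := lt_of_le_of_ne (h2.2 ht₁) hne.symm
  exact interior_mono (h1.out h2.1 ht₁) (by
    rw [interior_Icc]; exact ⟨by linarith, by linarith⟩)

namespace CanonicalSystem

section Closedness

variable {𝕜 D Y : Type*} [RCLike 𝕜]
  [NormedAddCommGroup D] [NormedSpace 𝕜 D] [NormedAddCommGroup Y] [NormedSpace 𝕜 Y]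
  {a b : D →ₗ[𝕜] Y} {ν n : ℕ} {C : CanonicalSystem a b ν n}

/-- `P₁` need not be continuous, but it is sequentially closed, because its kernel is finite
dimensional. -/
lemma comp1_eq_of_tendsto {ι : Type*} {l : Filter ι} [l.NeBot] {u : ι → D} {y : D} {z : ι → C.D1}
    {z₀ : C.D1} (hu : Tendsto u l (𝓝 y)) (hz : Tendsto z l (𝓝 z₀))
    (h : ∀ᶠ k in l, C.comp1 (u k) = z k) : C.comp1 y = z₀ := by
  have hcl : IsClosed (C.rootSpace : Set D) := C.rootSpace.closed_of_finiteDimensional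
  have hmem : y - z₀ ∈ C.rootSpace := by
    refine hcl.mem_of_tendsto
      (hu.sub ((continuous_subtype_val.tendsto z₀).comp hz)) (h.mono fun k hk => ?_)
    change u k - (z k : D) ∈ C.rootSpace
    rw [← hk, coe_comp1, P1_apply, sub_sub_cancel]
    exact ⟨u k, rfl⟩
  obtain ⟨r, hr⟩ := hmem
  refine Subtype.ext ?_
  rw [coe_comp1, ← sub_add_cancel y (z₀ : D), map_add, ← hr, P1_projD, zero_add,
    C.mem_D1.1 z₀.2]

lemma isClosed_Y1 : IsClosed (C.Y1 : Set Y) := by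
  have h : (C.Y1 : Set Y) = {y | C.Q1 y = y} := Set.ext fun y => C.mem_Y1
  rw [h]
  exact isClosed_eq C.Q1.continuous continuous_id

lemma Q1_b_last (i : Fin n) : C.Q1 (b (C.φ i (C.m i))) = 0 := by
  have hm := C.one_le_m i
  rw [Q1_apply, projY_apply, Finset.sum_eq_single i, Finset.sum_eq_single (C.m i - 1)]
  · rw [if_pos trivial, Nat.sub_add_cancel hm,
      C.biorthogonal i _ i _ hm le_rfl hm le_rfl, if_pos ⟨rfl, rfl⟩, one_smul, sub_self]
  · intro r hr hne
    rw [Finset.mem_range] at hr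
    rw [if_pos trivial, C.biorthogonal i _ i _ hm le_rfl (by omega) (by omega),
      if_neg (by omega), zero_smul]
  · intro h
    exact absurd (Finset.mem_range.2 (by omega)) h
  · intro k _ hk
    refine Finset.sum_eq_zero fun r hr => ?_
    rw [Finset.mem_range] at hr
    rw [if_pos trivial, C.biorthogonal i _ k _ hm le_rfl (by omega) (by omega),
      if_neg (fun h => hk h.1.symm), zero_smul]
  · simp

end Closedness

section InitialTime

variable {𝕜 D Y : Type*} [RCLike 𝕜]
  [NormedAddCommGroup D] [NormedSpace 𝕜 D] [NormedAddCommGroup Y] [NormedSpace 𝕜 Y]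
  [NormedSpace ℝ D] [IsScalarTower ℝ 𝕜 D] [NormedSpace ℝ Y] [IsScalarTower ℝ 𝕜 Y]
  {a b : D →ₗ[𝕜] Y} {ν n : ℕ}
  {C : CanonicalSystem a b ν n} {f : ℝ → D → Y} {N : Set C.Y1}
  {M20 : Set C.D20} {ML : ∀ j, Set (C.DLast j)} {MW : ∀ j, Set (C.DWedge j)}
  {U : ∀ j, ℝ → C.DLast j} {V : ∀ j, ℝ → C.DWedge j}
  {I : C.BoundedInverse} {ψ : ℝ → C.Y1 → C.D20} {x : ℝ → D} {v : ℝ → Y}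

/-- The reduction for solutions on `[0, ∞)` for which differentiability at `0` is not
required: the linear part of the reduced equation forces the component in `Y1` to have a limit
at `0`, and the equation extends to `0`. -/
lemma SolvabilityConditions.solvesODE_of_solution_Ioi [CompleteSpace Y]
    (H : C.SolvabilityConditions f N M20 ML MW)
    (hUV : C.IsConstraintCurve f ML MW U V) (hψ : IsZeroOrderPart I f N M20 U V ψ)
    (hxc : ContinuousOn x (Ici 0))
    (hv : ∀ t ∈ Ioi (0 : ℝ), HasDerivWithinAt (fun τ => a (x τ)) (v t) (Ioi 0) t)
    (heq : ∀ t ∈ Ioi (0 : ℝ), v t + b (x t) = f t (x t))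
    (hx : ∀ t ∈ Ici (0 : ℝ), x t ∈ C.setM N M20 ML MW) :
    SolvesODE (reducedField I f U V ψ) N (Ici 0) (fun t => toRange C.Q1 (a (x t))) ∧
      ∀ t ∈ Ici (0 : ℝ), x t = fullState I U V ψ t (toRange C.Q1 (a (x t))) := by
  set w : ℝ → C.Y1 := fun t => toRange C.Q1 (a (x t)) with hwdef
  have : CompleteSpace C.Y1 := isClosed_Y1.completeSpace_coe
  obtain ⟨hode, hstate⟩ := H.solvesODE_of_solution hUV hψ isOpen_Ioi.uniqueDiffOn
    Ioi_subset_Ici_self hv heq fun t ht => hx t (Ioi_subset_Ici_self ht)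
  have hw' : ∀ t, 0 < t → HasDerivAt w (reducedField I f U V ψ t (w t)) t := fun t ht =>
    (hode t ht).2.hasDerivAt (Ioi_mem_nhds ht)
  have hfc : ContinuousOn (fun t => toRange C.Q1 (f t (x t))) (Ici 0) :=
    (toRange C.Q1).continuous.comp_continuousOn (H.continuousOn.comp
      (f := fun t => (t, x t)) (continuousOn_id.prodMk hxc) fun t ht => ⟨ht, mem_univ _⟩)
  obtain ⟨w₀, hw₀⟩ := exists_tendsto_of_linear ((toRange C.Q1).comp I.bInv) hfc (w := w)
    fun t ht => by
      have h := hw' t ht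
      rw [reducedField, ← hstate t ht] at h
      exact h
  have hx0 : Tendsto x (𝓝[>] 0) (𝓝 (x 0)) :=
    (hxc 0 self_mem_Ici).mono_left (nhdsWithin_mono _ Ioi_subset_Ici_self)
  have hcomp : C.comp1 (x 0) = I.inv w₀ :=
    comp1_eq_of_tendsto hx0 ((I.inv.continuous.tendsto w₀).comp hw₀)
      (Eventually.of_forall fun t => (I.inv_toRange_a (x t)).symm)
  have hw0 : w 0 = w₀ := by
    refine Subtype.ext ?_
    rw [hwdef, coe_toRange, Q1_a, ← coe_comp1, hcomp, I.a_inv]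
  have hN0 : w 0 ∈ N := toRange_a_mem (hx 0 self_mem_Ici)
  have hwc : ContinuousWithinAt w (Ioi 0) 0 := by
    rw [ContinuousWithinAt, hw0]; exact hw₀
  have hpair : Tendsto (fun t => (t, w t)) (𝓝[>] 0) (𝓝[Ici 0 ×ˢ N] (0, w 0)) := by
    refine tendsto_nhdsWithin_iff.2 ⟨?_, ?_⟩
    · exact (tendsto_id.mono_left nhdsWithin_le_nhds).prodMk_nhds hwc
    · filter_upwards [self_mem_nhdsWithin] with t ht
      exact ⟨Ioi_subset_Ici_self ht, (hode t ht).1⟩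
  have hp0 : ((0 : ℝ), w 0) ∈ Ici (0 : ℝ) ×ˢ N := ⟨self_mem_Ici, hN0⟩
  have hstate0 : x 0 = fullState I U V ψ 0 (w 0) := by
    refine tendsto_nhds_unique hx0 ?_
    refine Tendsto.congr' ?_ ((hψ.continuousOn_fullState hUV _ hp0).tendsto.comp hpair)
    filter_upwards [self_mem_nhdsWithin] with t ht
    exact (hstate t ht).symm
  have hder0 : HasDerivWithinAt w (reducedField I f U V ψ 0 (w 0)) (Ici 0) 0 := by
    refine hasDerivWithinAt_Ici_of_tendsto_deriv (s := Ioi 0)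
      (fun t ht => (hw' t ht).differentiableAt.differentiableWithinAt) hwc self_mem_nhdsWithin ?_
    refine Tendsto.congr' ?_
      ((H.continuousOn_reducedField hUV hψ _ hp0).tendsto.comp hpair)
    filter_upwards [self_mem_nhdsWithin] with t ht
    exact (hw' t ht).deriv.symm
  refine ⟨fun t ht => ?_, fun t ht => ?_⟩
  · rcases eq_or_lt_of_le (mem_Ici.1 ht) with rfl | h
    · exact ⟨hN0, hder0⟩
    · exact ⟨(hode t h).1, (hw' t h).hasDerivWithinAt⟩
  · rcases eq_or_lt_of_le (mem_Ici.1 ht) with rfl | h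
    · exact hstate0
    · exact hstate t h

/-- Every solution with values in `M` comes from a solution of the reduced equation. -/
theorem SolvabilityConditions.solvesODE_of_isSolutionOn [CompleteSpace Y]
    (H : C.SolvabilityConditions f N M20 ML MW)
    (hUV : C.IsConstraintCurve f ML MW U V) (hψ : IsZeroOrderPart I f N M20 U V ψ) {t₀ : ℝ}
    (ht₀ : 0 ≤ t₀) {J : Set ℝ} (hJ : IsIntervalFrom t₀ J) (hsol : IsSolutionOn a b f J x)
    (hx : ∀ t ∈ J, x t ∈ C.setM N M20 ML MW) :
    SolvesODE (reducedField I f U V ψ) N J (fun t => toRange C.Q1 (a (x t))) ∧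
      ∀ t ∈ J, x t = fullState I U V ψ t (toRange C.Q1 (a (x t))) := by
  obtain ⟨hxc, v, -, hv⟩ := hsol
  -- differentiability at `0` is not part of the notion of a solution if `J = [0, ∞)`
  by_cases hJ0 : J = Ici 0
  · subst hJ0
    have hmem : ∀ t ∈ Ioi (0 : ℝ), t ∈ diffPart (Ici 0) :=
      fun t ht => ⟨Ioi_subset_Ici_self ht, fun _ => ht⟩
    exact H.solvesODE_of_solution_Ioi hUV hψ hxc
      (fun t ht => (hv t (hmem t ht)).1.mono Ioi_subset_Ici_self)
      (fun t ht => (hv t (hmem t ht)).2) hx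
  · have hmem : ∀ t ∈ J, t ∈ diffPart J := fun t ht => ⟨ht, fun h => absurd h hJ0⟩
    exact H.solvesODE_of_solution hUV hψ hJ.uniqueDiffOn (fun t ht => ht₀.trans (hJ.2.1.2 ht))
      (fun t ht => (hv t (hmem t ht)).1) (fun t ht => (hv t (hmem t ht)).2) hx

/-- The bounded inverse of `Ã` maps `Y1` into `D1`. -/
lemma exists_boundedInverse (C : CanonicalSystem a b ν n) (E : Y →L[𝕜] D)
    (hE : ∀ y, C.aTilde (E y) = y) (hbE : Continuous fun y => b (E y)) :
    Nonempty C.BoundedInverse := by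
  -- on `Y1 = Q₁ Y` the element `P₁ E w` has the same image under `Ã` as `E w`
  have hmem : ∀ w : C.Y1, E w ∈ C.D1 := by
    intro w
    rw [C.mem_D1]
    refine C.aTilde_injective ?_
    rw [hE, aTilde_P1, ← Q1_a]
    have h := congrArg C.Q1 (hE w)
    rw [aTilde_apply, map_add, map_sum, Finset.sum_eq_zero, add_zero] at h
    · rw [h, C.mem_Y1.1 w.2]
    · intro i _
      rw [map_smul, Q1_b_last, smul_zero]
  let i : C.Y1 →L[𝕜] D := E.comp C.Y1.subtypeL
  let g : C.Y1 →ₗ[𝕜] Y := b ∘ₗ (i : C.Y1 →ₗ[𝕜] D)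
  have hg : Continuous g := hbE.comp continuous_subtype_val
  exact ⟨{
    inv := (i.codRestrict C.D1 hmem).restrictScalars ℝ
    aTilde_inv := fun w => hE w
    bInv := (⟨g, hg⟩ : C.Y1 →L[𝕜] Y).restrictScalars ℝ
    bInv_apply := fun w => rfl }⟩

end InitialTime

end CanonicalSystem

end ADAE

end

theorem mainTheorem7
    {𝕜 X Y : Type*} [RCLike 𝕜]
    [NormedAddCommGroup X] [NormedSpace 𝕜 X] [CompleteSpace X]
    [NormedSpace ℝ X] [IsScalarTower ℝ 𝕜 X]
    [NormedAddCommGroup Y] [NormedSpace 𝕜 Y] [CompleteSpace Y]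
    [NormedSpace ℝ Y] [IsScalarTower ℝ 𝕜 Y]
    -- the operators `A`, `B` and their common domain `D = D_A`
    (A B : X →ₗ.[𝕜] Y) (hA : A.IsClosed) (hB : B.IsClosed)
    (hdense : Dense (A.domain : Set X)) (hrange : IsClosed (LinearMap.range A.toFun : Set Y))
    (hAB : A.domain ≤ B.domain)
    (a b : A.domain →ₗ[𝕜] Y) (ha : a = A.toFun) (hb : b = B.toFun ∘ₗ Submodule.inclusion hAB)
    -- the pencil, `n = dim ker A < ∞`, and the root vectors that define the projectors
    (ν n : ℕ) (hν : ADAE.IsRegularPencilOfIndex a b ν) (C : ADAE.CanonicalSystem a b ν n)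
    -- the right-hand side
    (f : ℝ → A.domain → Y)
    (hf : ContinuousOn (fun p : ℝ × A.domain => f p.1 p.2) (Set.Ici 0 ×ˢ Set.univ))
    (hstr : C.HasTriangularStructure f)
    -- the open sets
    (N : Set C.Y1) (hN : IsOpen N) (M20 : Set C.D20) (hM20 : IsOpen M20)
    (ML : ∀ j, Set (C.DLast j)) (hML : ∀ j ∈ Finset.Icc 1 (ν - 1), IsOpen (ML j))
    (MW : ∀ j, Set (C.DWedge j)) (hMW : ∀ j ∈ Finset.Icc 1 (ν - 2), IsOpen (MW j))
    -- smoothness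
    (hsmoothL : ∀ s ∈ Finset.Icc 1 (ν - 2),
      ADAE.SmoothOn (ν - 2) (C.spaceSum s (ν - 1)) (C.setSum ML MW s (ν - 1))
        (fun t x => C.Q2j s (s + 1) (f t x)))
    (hsmoothS : ∀ s ∈ Finset.Icc 1 (ν - 2),
      ADAE.SmoothOn s (C.spaceSum 1 s) (C.setSum ML MW 1 s) (fun t x => C.QSigma s (f t x)))
    (hsmoothTop : 2 ≤ ν →
      ADAE.SmoothOn (ν - 1) (C.spaceSum (ν - 1) (ν - 1)) (C.setSum ML MW (ν - 1) (ν - 1))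
        (fun t x => C.Q2 (ν - 1) (f t x)))
    -- unique solvability for `x_{2s}^{(s+1)}` (including `x_{2(ν-1)}`, `s = ν - 1`)
    (h1ab : ∀ s ∈ Finset.Icc 1 (ν - 1), ∀ t, 0 ≤ t → ∀ u : ∀ j, C.DLast j,
      (∀ j ∈ Finset.Icc (s + 1) (ν - 1), u j ∈ ML j) →
      ∃! z, z ∈ ML s ∧ C.FLast f s t z u = 0)
    -- unique solvability for `x_{2∧,s}`
    (h1cd : ∀ s ∈ Finset.Icc 1 (ν - 2), ∀ t, 0 ≤ t →
      ∀ (u : ∀ j, C.DLast j) (v : ∀ j, C.DWedge j) (d : C.DLast (s + 1)) (e : C.DWedge (s + 1)),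
      (∀ j ∈ Finset.Icc 1 (ν - 1), u j ∈ ML j) →
      (∀ j ∈ Finset.Icc (s + 1) (ν - 2), v j ∈ MW j) →
      ∃! z, z ∈ MW s ∧ C.FSigma f s t u z v d e = 0)
    -- unique solvability for `x_{20}`
    (h1e : ∀ t, 0 ≤ t → ∀ x1 ∈ C.setM1 N, ∀ xS ∈ C.setMSigma ML MW,
      ∀ (d : C.DLast 1) (e : C.DWedge 1), ∃! x20, x20 ∈ M20 ∧ C.F20 f t x1 x20 xS d e = 0)
    -- invertibility of `∂F_{2s}^{(s+1)}/∂x_{2s}^{(s+1)}`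
    (h2ab : ∀ s ∈ Finset.Icc 1 (ν - 1), ∀ t, 0 ≤ t → ∀ z ∈ ML s, ∀ u : ∀ j, C.DLast j,
      (∀ j ∈ Finset.Icc (s + 1) (ν - 1), u j ∈ ML j) → C.FLast f s t z u = 0 →
      ADAE.HasInvertibleDerivAt (C.DLast s) (C.YLast s) (fun z' => C.FLast f s t z' u) z)
    -- invertibility of `∂F_{2Σ,s}/∂x_{2∧,s}`
    (h2cd : ∀ s ∈ Finset.Icc 1 (ν - 2), ∀ t, 0 ≤ t →
      ∀ (u : ∀ j, C.DLast j), ∀ z ∈ MW s,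
      ∀ (v : ∀ j, C.DWedge j) (d : C.DLast (s + 1)) (e : C.DWedge (s + 1)),
      (∀ j ∈ Finset.Icc 1 (ν - 1), u j ∈ ML j) →
      (∀ j ∈ Finset.Icc (s + 1) (ν - 2), v j ∈ MW j) → C.FSigma f s t u z v d e = 0 →
      ADAE.HasInvertibleDerivAt (C.DWedge s) (C.YSigma s)
        (fun z' => C.FSigma f s t u z' v d e) z)
    -- local Lipschitz condition and local contractivity
    (h2eQ1 : C.LocallyLipschitz120 (C.setM1 N) M20 (C.setMSigma ML MW)
      (fun t x => C.Q1 (f t x)))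
    (h2eQ20 : C.LocallyLipschitz120 (C.setM1 N) M20 (C.setMSigma ML MW)
      (fun t x => C.Q2 0 (f t x)))
    (h2e : ∀ t, 0 ≤ t → ∀ x1 ∈ C.setM1 N, ∀ x20 ∈ M20, ∀ xS ∈ C.setMSigma ML MW,
      ∀ (d : C.DLast 1) (e : C.DWedge 1), C.F20 f t x1 x20 xS d e = 0 →
      C.ContractiveAt f t x1 x20 xS d e) :
    ∀ t₀ : ℝ, 0 ≤ t₀ → ∀ x01 ∈ C.setM1 N,
      ∃ (tmax : EReal) (x : ℝ → A.domain), (t₀ : EReal) < tmax ∧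
        -- `x` is a solution in `M` of the initial value problem on `[t₀, tmax)`
        ADAE.IsSolutionOn a b f (ADAE.rightInterval t₀ tmax) x ∧
        (∀ t ∈ ADAE.rightInterval t₀ tmax, x t ∈ C.setM N M20 ML MW) ∧
        C.P1 (x t₀) = x01 ∧
        -- the interval is maximal: no proper extension is a solution in `M`
        (∀ J : Set ℝ, ADAE.IsIntervalFrom t₀ J → ADAE.rightInterval t₀ tmax ⊂ J →
          ¬ ∃ y : ℝ → A.domain, Set.EqOn y x (ADAE.rightInterval t₀ tmax) ∧
            ADAE.IsSolutionOn a b f J y ∧ ∀ t ∈ J, y t ∈ C.setM N M20 ML MW) ∧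
        -- uniqueness, on `[t₀, tmax)` and on every other interval starting at `t₀`
        (∀ J : Set ℝ, ADAE.IsIntervalFrom t₀ J → ∀ y : ℝ → A.domain,
          ADAE.IsSolutionOn a b f J y → (∀ t ∈ J, y t ∈ C.setM N M20 ML MW) →
          C.P1 (y t₀) = x01 →
          J ⊆ ADAE.rightInterval t₀ tmax ∧ Set.EqOn y x J) := by
  have hcomplete : CompleteSpace C.Y1 :=
    (ADAE.CanonicalSystem.isClosed_Y1 (C := C)).completeSpace_coe
  have H : C.SolvabilityConditions f N M20 ML MW :=
    ⟨hf, hstr, hN, hM20, hML, hMW, hsmoothL, hsmoothS, hsmoothTop, h1ab, h1cd, h1e, h2ab, h2cd,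
      h2eQ1, h2eQ20, h2e⟩
  obtain ⟨E, hE, -⟩ : ∃ E : Y →L[𝕜] A.domain,
      (∀ y, C.aTilde (E y) = y) ∧ ∀ x, E (C.aTilde x) = x := by
    refine C.exists_aTilde_inverse hν (by rw [ha]; exact hrange) (fun R => ?_) fun R => ?_
    · rw [ha]; exact ADAE.continuous_closed_comp hA le_rfl R
    · rw [hb]; exact ADAE.continuous_closed_comp hB hAB R
  obtain ⟨I⟩ := C.exists_boundedInverse E hE
    (by rw [hb]; exact ADAE.continuous_closed_comp hB hAB E)
  obtain ⟨U, V, hUV⟩ := H.exists_constraintCurve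
  obtain ⟨ψ, hψ⟩ := H.exists_zeroOrderPart hUV I
  rintro t₀ ht₀ x01 ⟨w₀, hw₀, hx01⟩
  have hinv : I.inv w₀ = x01 :=
    Subtype.ext (C.aTilde_injective ((I.aTilde_inv w₀).trans hx01.symm))
  obtain ⟨T, w, hT, hw, hwt₀, hmax⟩ := ADAE.exists_maximal_solution hN
    (H.continuousOn_reducedField hUV hψ) (H.lipschitz_reducedField hUV hψ) ht₀ hw₀
  have hsub := ADAE.rightInterval_subset_Ici ht₀ T
  have hmem₀ : t₀ ∈ ADAE.rightInterval t₀ T := ⟨le_rfl, hT⟩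
  have hP1 : C.P1 (ADAE.CanonicalSystem.fullState I U V ψ t₀ (w t₀)) = x01 := by
    rw [hwt₀, ← hinv]
    exact congrArg Subtype.val (C.comp1_add (I.inv w₀) (ψ t₀ w₀) (fun j => U j t₀) fun j => V j t₀)
  have huniq : ∀ J : Set ℝ, ADAE.IsIntervalFrom t₀ J → ∀ y : ℝ → A.domain,
      ADAE.IsSolutionOn a b f J y → (∀ t ∈ J, y t ∈ C.setM N M20 ML MW) →
      C.P1 (y t₀) = x01 → J ⊆ ADAE.rightInterval t₀ T ∧
        Set.EqOn y (fun t => ADAE.CanonicalSystem.fullState I U V ψ t (w t)) J := by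
    intro J hJ y hy hyM hy₀
    obtain ⟨hode, hstate⟩ := H.solvesODE_of_isSolutionOn hUV hψ ht₀ hJ hy hyM
    have hinit : ADAE.toRange C.Q1 (a (y t₀)) = w₀ := by
      refine Subtype.ext ?_
      rw [ADAE.coe_toRange, C.Q1_a, hy₀, ← hinv, I.a_inv]
    obtain ⟨h1, h2⟩ := hmax J hJ.1 hJ.2.1 _ hode hinit
    refine ⟨h1, fun t ht => ?_⟩
    exact (hstate t ht).trans (congrArg (ADAE.CanonicalSystem.fullState I U V ψ t) (h2 ht))
  refine ⟨T, fun t => ADAE.CanonicalSystem.fullState I U V ψ t (w t), hT,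
    H.isSolutionOn_fullState hUV hψ hsub hw,
    fun t ht => hψ.fullState_mem hUV (hsub ht) (hw t ht).1, hP1, ?_, huniq⟩
  rintro J hJ hlt ⟨y, hyx, hy, hyM⟩
  refine hlt.2 (huniq J hJ y hy hyM ?_).1
  rw [hyx hmem₀, hP1]
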